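/- **Conventions.** All Lie algebras are real and finite-dimensional; brackets of basis vectors that are not listed (and not determined by skew-symmetry) are zero. $\mathcal G^1=[\mathcal G,\mathcal G]$. $\mathcal G$ is 2-step nilpotent if $[\mathcal G,\mathcal G]\neq 0=[\mathcal G,[\mathcal G,\mathcal G]]$, and decomposable if it is a direct sum of two nonzero Lie algebras. For a basis $X_1,\dots,X_n$ with $\mathcal G^1=\mathrm{span}\{X_1,X_2\}$, $a_{X}$ denotes the matrix of $\mathrm{ad}_{X}|_{\mathcal G^1}$ in the basis $(X_1,X_2)$. $\mathrm{aff}(\mathbb R)=\mathrm{span}\{X,Y\}$ with $[X,Y]=Y$; $\mathfrak h_{2m+1}=\mathrm{span}\{X_i,Y_i,Z: 1\le i\le m\}$ with $[X_i,Y_i]=Z$; $\mathbb R^r$ is the commutative Lie algebra of dimension $r$. The first index of $\mathcal G_{d,\dots}$ is its dimension. Consider the following **list** (each algebra has basis $X_1,\dots,X_d$, $[X_1,X_2]=0$, and $a_{X_i}=0$ for $i\ge3$ unless given): - $\mathcal G_{3,2.1(\lambda)}$, $\lambda\in\mathbb R\setminus\{0\}$: $a_{X_3}=\begin{bmatrix}1&0\\0&\lambda\end{bmatrix}$.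 - $\mathcal G_{3,2.2}$: $a_{X_3}=\begin{bmatrix}1&1\\0&1\end{bmatrix}$. - $\mathcal G_{3,2.3(\varphi)}$, $\varphi\in(0,\pi)$: $a_{X_3}=\begin{bmatrix}\cos\varphi&-\sin\varphi\\ \sin\varphi&\cos\varphi\end{bmatrix}$. - $\mathcal G_{4,2.1}$: $a_{X_3}=\begin{bmatrix}1&0\\0&0\end{bmatrix}$, $[X_3,X_4]=X_2$. - $\mathcal G_{4,2.2}$: $a_{X_3}=\begin{bmatrix}0&1\\0&0\end{bmatrix}$, $[X_3,X_4]=X_2$. - $\mathcal G_{4,2.3(\lambda)}$, $\lambda\in\mathbb R$: $a_{X_3}=\begin{bmatrix}0&1\\0&\lambda\end{bmatrix}$, $a_{X_4}=\begin{bmatrix}1&0\\0&1\end{bmatrix}$. - $\mathcal G_{4,2.4}=\mathrm{aff}(\mathbb C)$: $a_{X_3}=\begin{bmatrix}0&1\\-1&0\end{bmatrix}$, $a_{X_4}=\begin{bmatrix}1&0\\0&1\end{bmatrix}$. - $\mathcal G_{5+2k,2}$, $k\ge0$: $a_{X_3}=\begin{bmatrix}0&0\\1&0\end{bmatrix}$,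 $[X_3,X_4]=X_1$, $[X_4,X_5]=[X_6,X_7]=\dots=[X_{4+2k},X_{5+2k}]=X_2$. - $\mathcal G_{6+2k,2.1}$, $k\ge0$: $a_{X_3}=\begin{bmatrix}1&0\\0&0\end{bmatrix}$, $[X_3,X_4]=[X_5,X_6]=\dots=[X_{5+2k},X_{6+2k}]=X_2$. - $\mathcal G_{6+2k,2.2}$, $k\ge0$: $a_{X_3}=\begin{bmatrix}0&0\\1&0\end{bmatrix}$, $[X_3,X_4]=X_1$, $[X_5,X_6]=\dots=[X_{5+2k},X_{6+2k}]=X_2$. **Theorem.** Let $\mathcal G$ be an $n$-dimensional real solvable Lie algebra whose derived ideal $\mathcal G^1$ is 2-dimensional, and assume that $\mathcal G$ is not 2-step nilpotent. Then $\mathcal G^1$ is commutative, and there is a basis $(X_1,\dots,X_n)$ of $\mathcal G$ with $\mathcal G^1=\mathrm{span}\{X_1,X_2\}$ such that the following holds. 1. If $\mathcal G$ is indecomposable, then, in the basis $(X_1,\dots,X_n)$, it has the brackets of an $n$-dimensional algebra of the list. The algebra of the list to which $\mathcal G$ is isomorphic is unique, except that the parameter $\lambda$ of $\mathcal G_{3,2.1(\lambda)}$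 is determined exactly up to $\lambda\leftrightarrow\lambda^{-1}$ and the parameter $\varphi$ of $\mathcal G_{3,2.3(\varphi)}$ exactly up to $\varphi\leftrightarrow\pi-\varphi$. (It is not asserted that every algebra of the list is indecomposable.) 2. If $\mathcal G$ is decomposable, then at least one of the following holds: - 2.1. $n\ge4$ and $\mathcal G\cong\mathrm{aff}(\mathbb R)\oplus\mathrm{aff}(\mathbb R)\oplus\mathbb R^{n-4}$; - 2.2. $\mathcal G\cong\mathrm{aff}(\mathbb R)\oplus\mathfrak h_{2m+1}\oplus\mathbb R^{n-2m-3}$ for some $m\ge1$ with $n\ge 2m+3$; - 2.3. $\mathcal G\cong\mathcal L\oplus\mathbb R^{r}$ for some algebra $\mathcal L$ of the list and some $r\ge1$ with $n=\dim\mathcal L+r$. -/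

import Mathlib

open scoped Matrix

/-- `G` is `k`-step nilpotent (`k ≥ 1`): with `G_0 = G`, `G_{j+1} = [G, G_j]` one has
`G_{k-1} ≠ 0 = G_k`. -/
def IsStepNilpotent (G : Type*) [LieRing G] [LieAlgebra ℝ G] (k : ℕ) : Prop :=
  1 ≤ k ∧ LieModule.lowerCentralSeries ℝ G G (k - 1) ≠ ⊥ ∧
    LieModule.lowerCentralSeries ℝ G G k = ⊥

/-- `G` is the direct sum (of Lie algebras) of two nonzero subalgebras; in a direct sum of
Lie algebras the two summands are ideals. -/
def IsDecomposable (G : Type*) [LieRing G] [LieAlgebra ℝ G] : Prop :=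
  ∃ I J : LieIdeal ℝ G, I ≠ ⊥ ∧ J ≠ ⊥ ∧ IsCompl I J

/-- Structure constants of a real Lie algebra with basis `(V_k)_{k ∈ κ}, (X_i)_{i ∈ ι}` in which
the `V_k` span an abelian ideal containing the derived ideal:
`A i` is the matrix of the restriction of `ad X_i` to `span V`, and `B i j` is the coordinate
vector of `[X_i, X_j] ∈ span V`. -/
structure LieData (κ ι : Type) [Fintype κ] [Fintype ι] where
  A : ι → Matrix κ κ ℝ
  B : ι → ι → κ → ℝ
  comm : ∀ i j, A i * A j = A j * A i
  skew : ∀ i j, B i j = -B j i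
  jacobi : ∀ i j k, A i *ᵥ B j k + A j *ᵥ B k i + A k *ᵥ B i j = 0

namespace LieData

variable {κ ι : Type} [Fintype κ] [Fintype ι]

/-- The underlying vector space `ℝ^κ × ℝ^ι` of the Lie algebra with given structure constants. -/
def Carrier (_ : LieData κ ι) : Type := (κ → ℝ) × (ι → ℝ)

variable (D : LieData κ ι)

instance : AddCommGroup D.Carrier := inferInstanceAs (AddCommGroup ((κ → ℝ) × (ι → ℝ)))

noncomputable instance : Module ℝ D.Carrier :=
  inferInstanceAs (Module ℝ ((κ → ℝ) × (ι → ℝ)))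

/-- The matrix of `∑ wᵢ ad X_i` restricted to `span V`. -/
noncomputable def op (w : ι → ℝ) : Matrix κ κ ℝ := ∑ i, w i • D.A i

/-- The coordinate vector of `[∑ wᵢ X_i, ∑ w'ⱼ X_j]`. -/
noncomputable def form (w w' : ι → ℝ) : κ → ℝ := ∑ i, ∑ j, (w i * w' j) • D.B i j

/-- The bilinear bracket with `[V, V] = 0`, `[X_i, v] = A i v`, `[X_i, X_j] = B i j`. -/
noncomputable def brk (x y : D.Carrier) : D.Carrier :=
  (D.op x.2 *ᵥ y.1 - D.op y.2 *ᵥ x.1 + D.form x.2 y.2, (0 : ι → ℝ))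

noncomputable instance : Bracket D.Carrier D.Carrier := ⟨D.brk⟩

theorem op_add (w w' : ι → ℝ) : D.op (w + w') = D.op w + D.op w' := by
  simp [op, add_smul, Finset.sum_add_distrib]

theorem op_smul (c : ℝ) (w : ι → ℝ) : D.op (c • w) = c • D.op w := by
  simp [op, Finset.smul_sum, mul_smul]

theorem op_zero : D.op 0 = 0 := by simp [op]

theorem form_add_left (w w' u : ι → ℝ) : D.form (w + w') u = D.form w u + D.form w' u := by
  simp [form, add_mul, add_smul, Finset.sum_add_distrib]

theorem form_skew (w u : ι → ℝ) : D.form w u = -D.form u w := by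
  unfold form
  rw [Finset.sum_comm, ← Finset.sum_neg_distrib]
  refine Finset.sum_congr rfl fun i _ => ?_
  rw [← Finset.sum_neg_distrib]
  refine Finset.sum_congr rfl fun j _ => ?_
  rw [D.skew j i, smul_neg, mul_comm]

theorem form_add_right (w u u' : ι → ℝ) : D.form w (u + u') = D.form w u + D.form w u' := by
  rw [form_skew, form_add_left, form_skew D u, form_skew D u']; abel

theorem form_smul_right (c : ℝ) (w u : ι → ℝ) : D.form w (c • u) = c • D.form w u := by
  simp only [form, Finset.smul_sum, smul_smul, Pi.smul_apply, smul_eq_mul]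
  refine Finset.sum_congr rfl fun i _ => Finset.sum_congr rfl fun j _ => ?_
  congr 1; ring

theorem form_zero_right (w : ι → ℝ) : D.form w 0 = 0 := by simp [form]

theorem form_zero_left (w : ι → ℝ) : D.form 0 w = 0 := by simp [form]

theorem form_self (w : ι → ℝ) : D.form w w = 0 := by
  have h := D.form_skew w w
  exact self_eq_neg.mp h

theorem op_comm (w u : ι → ℝ) : D.op w * D.op u = D.op u * D.op w := by
  simp only [op, Finset.sum_mul, Finset.mul_sum]
  rw [Finset.sum_comm]
  refine Finset.sum_congr rfl fun i _ => Finset.sum_congr rfl fun j _ => ?_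
  rw [smul_mul_smul_comm, smul_mul_smul_comm, D.comm, mul_comm]

theorem op_form (w u t : ι → ℝ) : D.op w *ᵥ D.form u t =
    ∑ i, ∑ j, ∑ k, (w i * u j * t k) • (D.A i *ᵥ D.B j k) := by
  simp only [op, Matrix.sum_mulVec]
  refine Finset.sum_congr rfl fun i _ => ?_
  simp only [form, Matrix.mulVec_sum, Matrix.smul_mulVec,
    Matrix.mulVec_smul, smul_smul]
  refine Finset.sum_congr rfl fun j _ => Finset.sum_congr rfl fun k _ => ?_
  congr 1; ring

theorem op_form_cyclic (w u t : ι → ℝ) :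
    D.op w *ᵥ D.form u t + D.op u *ᵥ D.form t w + D.op t *ᵥ D.form w u = 0 := by
  have h2 : D.op u *ᵥ D.form t w =
      ∑ i, ∑ j, ∑ k, (w i * u j * t k) • (D.A j *ᵥ D.B k i) := by
    rw [op_form]
    calc _ = ∑ j, ∑ i, ∑ k, (w i * u j * t k) • (D.A j *ᵥ D.B k i) := by
          refine Finset.sum_congr rfl fun j _ => ?_
          rw [Finset.sum_comm]
          refine Finset.sum_congr rfl fun i _ => Finset.sum_congr rfl fun k _ => ?_
          congr 1; ring
      _ = _ := Finset.sum_comm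
  have h3 : D.op t *ᵥ D.form w u =
      ∑ i, ∑ j, ∑ k, (w i * u j * t k) • (D.A k *ᵥ D.B i j) := by
    rw [op_form, Finset.sum_comm]
    refine Finset.sum_congr rfl fun i _ => ?_
    rw [Finset.sum_comm]
    refine Finset.sum_congr rfl fun j _ => Finset.sum_congr rfl fun k _ => ?_
    congr 1; ring
  rw [h2, h3, op_form]
  simp only [← Finset.sum_add_distrib, ← smul_add, D.jacobi, smul_zero, Finset.sum_const_zero]

noncomputable instance : LieRing D.Carrier where
  add_lie x y z := by
    refine Prod.ext ?_ (add_zero _).symm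
    change D.op (x.2 + y.2) *ᵥ z.1 - D.op z.2 *ᵥ (x.1 + y.1) + D.form (x.2 + y.2) z.2 =
      (D.op x.2 *ᵥ z.1 - D.op z.2 *ᵥ x.1 + D.form x.2 z.2) +
      (D.op y.2 *ᵥ z.1 - D.op z.2 *ᵥ y.1 + D.form y.2 z.2)
    rw [op_add, form_add_left, Matrix.add_mulVec, Matrix.mulVec_add]; abel
  lie_add x y z := by
    refine Prod.ext ?_ (add_zero _).symm
    change D.op x.2 *ᵥ (y.1 + z.1) - D.op (y.2 + z.2) *ᵥ x.1 + D.form x.2 (y.2 + z.2) =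
      (D.op x.2 *ᵥ y.1 - D.op y.2 *ᵥ x.1 + D.form x.2 y.2) +
      (D.op x.2 *ᵥ z.1 - D.op z.2 *ᵥ x.1 + D.form x.2 z.2)
    rw [op_add, form_add_right, Matrix.add_mulVec, Matrix.mulVec_add]; abel
  lie_self x := by
    refine Prod.ext ?_ rfl
    change D.op x.2 *ᵥ x.1 - D.op x.2 *ᵥ x.1 + D.form x.2 x.2 = 0
    rw [form_self, sub_self, add_zero]
  leibniz_lie x y z := by
    refine Prod.ext ?_ (add_zero _).symm
    change D.op x.2 *ᵥ (D.op y.2 *ᵥ z.1 - D.op z.2 *ᵥ y.1 + D.form y.2 z.2)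
        - D.op 0 *ᵥ x.1 + D.form x.2 0 =
      (D.op 0 *ᵥ z.1 - D.op z.2 *ᵥ (D.op x.2 *ᵥ y.1 - D.op y.2 *ᵥ x.1 + D.form x.2 y.2)
        + D.form 0 z.2) +
      (D.op y.2 *ᵥ (D.op x.2 *ᵥ z.1 - D.op z.2 *ᵥ x.1 + D.form x.2 z.2)
        - D.op 0 *ᵥ y.1 + D.form y.2 0)
    have hc := D.op_form_cyclic x.2 y.2 z.2
    rw [D.form_skew z.2 x.2, Matrix.mulVec_neg] at hc
    simp only [op_zero, form_zero_left, form_zero_right, Matrix.zero_mulVec, Matrix.mulVec_add,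
      Matrix.mulVec_sub, Matrix.mulVec_mulVec]
    rw [D.op_comm y.2 x.2, D.op_comm z.2 x.2, D.op_comm z.2 y.2]
    linear_combination (exp := 1) hc

noncomputable instance : LieAlgebra ℝ D.Carrier where
  lie_smul c x y := by
    refine Prod.ext ?_ (smul_zero _).symm
    change D.op x.2 *ᵥ (c • y.1) - D.op (c • y.2) *ᵥ x.1 + D.form x.2 (c • y.2) =
      c • (D.op x.2 *ᵥ y.1 - D.op y.2 *ᵥ x.1 + D.form x.2 y.2)
    rw [op_smul, form_smul_right, Matrix.mulVec_smul, Matrix.smul_mulVec, smul_add, smul_sub]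

/-- The basis vectors: `V_k` for `inl k` and `X_i` for `inr i`. -/
noncomputable def gen [DecidableEq κ] [DecidableEq ι] : κ ⊕ ι → D.Carrier
  | Sum.inl k => ((Pi.single k 1 : κ → ℝ), (0 : ι → ℝ))
  | Sum.inr i => ((0 : κ → ℝ), (Pi.single i 1 : ι → ℝ))

/-- Numbering `X_1, …, X_{m+2}` of the basis when `κ = Fin 2`, `ι = Fin m`: `X_1, X_2` are `V_1, V_2`,
and `D.vec i` is `X_{i+1}`. -/
noncomputable def vec {m : ℕ} (D : LieData (Fin 2) (Fin m)) (i : Fin (2 + m)) : D.Carrier :=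
  D.gen (finSumFinEquiv.symm i)

/-- Lie algebra with basis `X_1, …, X_{m+2}`, where `a_{X_3}` has matrix `M` in the basis
`(X_1, X_2)`, `a_{X_p} = 0` for `p ≥ 4`, and `[X_p, X_q] = u p q` for `3 ≤ p < q`
(coordinates in `(X_1, X_2)`; `u` uses the numbering of the basis starting with `1`, and it is
only to be nonzero for `p < q`). -/
noncomputable def oneOp (m : ℕ) (M : Matrix (Fin 2) (Fin 2) ℝ) (u : ℕ → ℕ → Fin 2 → ℝ)
    (hu : ∀ p q, 4 ≤ p → 4 ≤ q → M *ᵥ u p q = 0) : LieData (Fin 2) (Fin m) where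
  A i := if (i : ℕ) + 3 = 3 then M else 0
  B i j := u (i + 3) (j + 3) - u (j + 3) (i + 3)
  comm i j := by split_ifs <;> simp
  skew i j := by abel
  jacobi i j k := by
    have key : ∀ a b : Fin m, (a : ℕ) ≠ 0 → (b : ℕ) ≠ 0 →
        M *ᵥ (u (a + 3) (b + 3) - u (b + 3) (a + 3)) = 0 := by
      intro a b ha hb
      rw [Matrix.mulVec_sub, hu _ _ (by omega) (by omega), hu _ _ (by omega) (by omega), sub_zero]
    by_cases hi : (i : ℕ) = 0 <;> by_cases hj : (j : ℕ) = 0 <;> by_cases hk : (k : ℕ) = 0 <;>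
      simp only [hi, hj, hk, Nat.add_eq_right, if_true, if_false, Matrix.zero_mulVec, sub_self,
        Matrix.mulVec_zero, add_zero, zero_add]
    · rw [← Matrix.mulVec_add]; simp
    · rw [← Matrix.mulVec_add]; simp
    · simpa using key j k hj hk
    · rw [← Matrix.mulVec_add]; simp
    · simpa using key k i hk hi
    · simpa using key i j hi hj

/-- Lie algebra with basis `X_1, X_2, X_3, X_4`, where `a_{X_3}`, `a_{X_4}` have the matrices
`P`, `Q` in the basis `(X_1, X_2)` and `[X_3, X_4] = 0`. -/
noncomputable def twoOp (P Q : Matrix (Fin 2) (Fin 2) ℝ) (h : P * Q = Q * P) :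
    LieData (Fin 2) (Fin 2) where
  A := ![P, Q]
  B _ _ := 0
  comm i j := by fin_cases i <;> fin_cases j <;> simp [h]
  skew _ _ := by simp
  jacobi _ _ _ := by simp

end LieData

/-- `aff(ℝ) = span {X, Y}`, `[X, Y] = Y`. -/
noncomputable def affR : LieData (Fin 1) (Fin 1) where
  A _ := 1
  B _ _ := 0
  comm _ _ := rfl
  skew _ _ := by simp
  jacobi _ _ _ := by simp

/-- `𝔥_{2m+1} = span {X_i, Y_i, Z}`, `[X_i, Y_i] = Z`; here `X_i`, `Y_i` are indexed by
`inl i`, `inr i`. -/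
noncomputable def heis (m : ℕ) : LieData (Fin 1) (Fin m ⊕ Fin m) where
  A _ := 0
  B
    | Sum.inl i, Sum.inr j => if i = j then 1 else 0
    | Sum.inr i, Sum.inl j => if i = j then -1 else 0
    | _, _ => 0
  comm _ _ := rfl
  skew i j := by
    rcases i with i | i <;> rcases j with j | j <;> simp [eq_comm] <;> split_ifs <;> simp
  jacobi _ _ _ := by simp

/-- The commutative Lie algebra `ℝ^r`. -/
noncomputable def abelianR (r : ℕ) : LieData (Fin r) (Fin 0) where
  A _ := 0
  B _ _ := 0
  comm _ _ := rfl
  skew _ _ := by simp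
  jacobi _ _ _ := by simp

/-- The list of algebras; the names record (dimension, number in the list). -/
inductive Listed : Type
  | g3_1 (c : ℝ) (hc : c ≠ 0)
  | g3_2
  | g3_3 (φ : ℝ) (hφ : φ ∈ Set.Ioo 0 Real.pi)
  | g4_1
  | g4_2
  | g4_3 (c : ℝ)
  | affC
  | g5 (k : ℕ)
  | g6_1 (k : ℕ)
  | g6_2 (k : ℕ)

namespace Listed

/-- The dimension minus `2`. -/
def codim : Listed → ℕ
  | g3_1 _ _ => 1
  | g3_2 => 1
  | g3_3 _ _ => 1
  | g4_1 => 2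
  | g4_2 => 2
  | g4_3 _ => 2
  | affC => 2
  | g5 k => 3 + 2 * k
  | g6_1 k => 4 + 2 * k
  | g6_2 k => 4 + 2 * k

def dim (t : Listed) : ℕ := 2 + t.codim

/-- The structure constants of the listed algebras. -/
noncomputable def data : (t : Listed) → LieData (Fin 2) (Fin t.codim)
  | g3_1 c _ => LieData.oneOp 1 !![1, 0; 0, c] (fun _ _ => 0) (by simp)
  | g3_2 => LieData.oneOp 1 !![1, 1; 0, 1] (fun _ _ => 0) (by simp)
  | g3_3 φ _ => LieData.oneOp 1 !![Real.cos φ, -Real.sin φ; Real.sin φ, Real.cos φ]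
      (fun _ _ => 0) (by simp)
  -- `[X_3, X_4] = X_2`
  | g4_1 => LieData.oneOp 2 !![1, 0; 0, 0]
      (fun p q => if p = 3 ∧ q = 4 then ![0, 1] else 0)
      (by intro p q hp hq; rw [if_neg (by omega)]; simp)
  -- `[X_3, X_4] = X_2`
  | g4_2 => LieData.oneOp 2 !![0, 1; 0, 0]
      (fun p q => if p = 3 ∧ q = 4 then ![0, 1] else 0)
      (by intro p q hp hq; rw [if_neg (by omega)]; simp)
  | g4_3 c => LieData.twoOp !![0, 1; 0, c] !![1, 0; 0, 1] (by simp)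
  -- `X_1 = X`, `X_2 = Y`, `X_3 = Z`, `X_4 = T` with
  -- `[Z, X] = -Y`, `[Z, Y] = X`, `[T, X] = X`, `[T, Y] = Y`
  | affC => LieData.twoOp !![0, 1; -1, 0] !![1, 0; 0, 1] (by simp)
  -- `[X_3, X_4] = X_1`, `[X_4, X_5] = [X_6, X_7] = ⋯ = [X_{4+2k}, X_{5+2k}] = X_2`
  | g5 k => LieData.oneOp (3 + 2 * k) !![0, 0; 1, 0]
      (fun p q => if p = 3 ∧ q = 4 then ![1, 0] else
        if 4 ≤ p ∧ Even p ∧ q = p + 1 then ![0, 1] else 0)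
      (by intro p q hp hq; rw [if_neg (by omega)]; split_ifs <;> ext r <;> fin_cases r <;> simp)
  -- `[X_3, X_4] = [X_5, X_6] = ⋯ = [X_{5+2k}, X_{6+2k}] = X_2`
  | g6_1 k => LieData.oneOp (4 + 2 * k) !![1, 0; 0, 0]
      (fun p q => if 3 ≤ p ∧ Odd p ∧ q = p + 1 then ![0, 1] else 0)
      (by intro p q hp hq; split_ifs <;> ext r <;> fin_cases r <;> simp)
  -- `[X_3, X_4] = X_1`, `[X_5, X_6] = ⋯ = [X_{5+2k}, X_{6+2k}] = X_2`
  | g6_2 k => LieData.oneOp (4 + 2 * k) !![0, 0; 1, 0]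
      (fun p q => if p = 3 ∧ q = 4 then ![1, 0] else
        if 5 ≤ p ∧ Odd p ∧ q = p + 1 then ![0, 1] else 0)
      (by intro p q hp hq; rw [if_neg (by omega)]; split_ifs <;> ext r <;> fin_cases r <;> simp)

/-- The listed Lie algebra. -/
abbrev Alg (t : Listed) : Type := t.data.Carrier

/-- Equality of members of the list, up to replacing the parameter `c` of `g3_1` by `1 / c`
and the parameter `φ` of `g3_3` by `π - φ`. -/
def Same : Listed → Listed → Prop
  | g3_1 c _, g3_1 c' _ => c' = c ∨ c' = c⁻¹
  | g3_3 φ _, g3_3 φ' _ => φ' = φ ∨ φ' = Real.pi - φ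
  | s, t => s = t

end Listed

/-! Let `V` be the derived ideal, a plane. Brackets act on `V` with trace zero, which on a plane
forces `V` to be commutative (`lie_eq_zero_of_mem_derSpan`). Hence the operators `ad g` on `V`
commute, and if one of them, `T`, is not scalar, all lie in the span of `1` and `T`. If `G` is
indecomposable, its centre lies in `V`, since a central line outside `V` would split off.

Suppose some `ad x` is invertible on `V`. Then `G` is the sum of `V` and the centralizer `H` of `x`,
and `H` is commutative and faithful on `V`, so `dim H ≤ 2` (`exists_equiv_of_injective`). Real
normal forms of a plane operator give the three-dimensional algebras, `g4_3 0` and `affC`; a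
diagonalizable two-dimensional `H` would give a sum of two copies of `aff(ℝ)`.

Otherwise `G = ℝ x + C` with `C` the centralizer of `V`, and `x` acts on `V` as `diag(1, 0)` or
nilpotently. Brackets of elements of `C` lie in the line killed by `ad x`, so they form a scalar
alternating form. A maximal hyperbolic family reduces `G` to a few vectors, and the remaining case
distinction is whether the radical of the form pairs with the vector left over
(`equiv_g4_1_or_g6_1`, `equiv_g4_2_or_g5_or_g6_2`).

For uniqueness, an isomorphism conjugates the operators on `V`. Dimension, traces, determinants and
the presence of scalar matrices separate the list, up to the stated changes of parameter.

If `G` is decomposable, split off a maximal abelian summand. If the rest decomposes again, both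
factors have one-dimensional derived algebra containing their centre, so each is `aff(ℝ)` or a
Heisenberg algebra, and not both are Heisenberg. If it does not, it is on the list. -/

namespace LieData

/-! ### Homomorphisms out of an algebra given by structure constants -/

variable {κ ι : Type} [Fintype κ] [Fintype ι]

theorem lie_def (D : LieData κ ι) (x y : D.Carrier) :
    ⁅x, y⁆ = ((D.op x.2 *ᵥ y.1 - D.op y.2 *ᵥ x.1 + D.form x.2 y.2, (0 : ι → ℝ)) : D.Carrier) := rfl

theorem exists_hom {G : Type*} [LieRing G] [LieAlgebra ℝ G] (D : LieData κ ι)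
    (v : κ → G) (x : ι → G) (hvv : ∀ k l, ⁅v k, v l⁆ = 0)
    (hxv : ∀ i k, ⁅x i, v k⁆ = ∑ l, D.A i l k • v l)
    (hxx : ∀ i j, ⁅x i, x j⁆ = ∑ k, D.B i j k • v k) :
    ∃ φ : D.Carrier →ₗ⁅ℝ⁆ G, ∀ z : D.Carrier, φ z = ∑ k, z.1 k • v k + ∑ i, z.2 i • x i := by
  have hVV : ∀ p p' : κ → ℝ, ⁅∑ k, p k • v k, ∑ k, p' k • v k⁆ = 0 := by
    intro p p'
    simp [sum_lie, lie_sum, hvv]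
  have hXV : ∀ (q : ι → ℝ) (p : κ → ℝ),
      ⁅∑ i, q i • x i, ∑ k, p k • v k⁆ = ∑ k, (D.op q *ᵥ p) k • v k := by
    intro q p
    have key : ∀ l, (D.op q *ᵥ p) l = ∑ i, ∑ k, q i * (D.A i l k * p k) := by
      intro l
      rw [op, Matrix.sum_mulVec, Finset.sum_apply]
      refine Finset.sum_congr rfl fun i _ => ?_
      rw [Matrix.smul_mulVec, Pi.smul_apply, smul_eq_mul, Matrix.mulVec, dotProduct,
        Finset.mul_sum]
    simp only [sum_lie, lie_sum, smul_lie, lie_smul, hxv, key, Finset.sum_smul, Finset.smul_sum]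
    have hr : ∑ l, ∑ i, ∑ k, (q i * (D.A i l k * p k)) • v l =
        ∑ i, ∑ k, ∑ l, (q i * (D.A i l k * p k)) • v l := by
      rw [Finset.sum_comm]
      exact Finset.sum_congr rfl fun i _ => Finset.sum_comm
    rw [hr]
    rw [Finset.sum_comm]
    refine Finset.sum_congr rfl fun i _ => Finset.sum_congr rfl fun k _ =>
      Finset.sum_congr rfl fun l _ => ?_
    rw [smul_smul, smul_smul]
    congr 1; ring
  have hXX : ∀ q q' : ι → ℝ,
      ⁅∑ i, q i • x i, ∑ k, q' k • x k⁆ = ∑ k, (D.form q q') k • v k := by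
    intro q q'
    simp only [sum_lie, lie_sum, smul_lie, lie_smul, hxx, form, Finset.sum_apply,
      Finset.sum_smul, Pi.smul_apply, smul_eq_mul, Finset.smul_sum]
    conv_rhs => rw [Finset.sum_comm]
    conv_rhs => enter [2, i]; rw [Finset.sum_comm]
    rw [Finset.sum_comm]
    refine Finset.sum_congr rfl fun i _ => Finset.sum_congr rfl fun k _ =>
      Finset.sum_congr rfl fun l _ => ?_
    rw [smul_smul, smul_smul]
    congr 1; ring
  let f : D.Carrier →ₗ[ℝ] G :=
    { toFun := fun z => ∑ k, z.1 k • v k + ∑ i, z.2 i • x i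
      map_add' := by
        intro z w
        change ∑ k, (z.1 + w.1) k • v k + ∑ i, (z.2 + w.2) i • x i = _
        simp only [Pi.add_apply, add_smul, Finset.sum_add_distrib]
        abel
      map_smul' := by
        intro c z
        change ∑ k, (c • z.1) k • v k + ∑ i, (c • z.2) i • x i = _
        simp only [Pi.smul_apply, smul_eq_mul, mul_smul, smul_add, Finset.smul_sum,
          RingHom.id_apply] }
  refine ⟨{ f with map_lie' := ?_ }, fun z => rfl⟩
  intro z w
  change ∑ k, (D.op z.2 *ᵥ w.1 - D.op w.2 *ᵥ z.1 + D.form z.2 w.2) k • v k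
    + ∑ i, (0 : ι → ℝ) i • x i =
    ⁅∑ k, z.1 k • v k + ∑ i, z.2 i • x i, ∑ k, w.1 k • v k + ∑ i, w.2 i • x i⁆
  rw [add_lie, lie_add, lie_add, hVV, hXV, hXX, ← lie_skew, hXV]
  simp only [Pi.add_apply, Pi.sub_apply, add_smul, sub_smul, Finset.sum_add_distrib,
    Finset.sum_sub_distrib, Pi.zero_apply, zero_smul, Finset.sum_const_zero]
  abel

instance (D : LieData κ ι) : FiniteDimensional ℝ D.Carrier :=
  inferInstanceAs (FiniteDimensional ℝ ((κ → ℝ) × (ι → ℝ)))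

theorem finrank_carrier (D : LieData κ ι) :
    Module.finrank ℝ D.Carrier = Fintype.card κ + Fintype.card ι := by
  change Module.finrank ℝ ((κ → ℝ) × (ι → ℝ)) = _
  simp

/-- The center is contained in `span V`. -/
def CenterLE (D : LieData κ ι) : Prop :=
  ∀ z : D.Carrier, (∀ y : D.Carrier, ⁅z, y⁆ = 0) → z.2 = 0

/-- If `φ z = 0`, then `⁅z, y⁆` lies in `span V` and is killed by `φ`, so it vanishes because `v` is
independent. Thus `z` is central, lies in `span V`, and is zero for the same reason. Independence of
the `x i` never has to be checked. -/
theorem injective_of_centerLE {G : Type*} [LieRing G] [LieAlgebra ℝ G] {D : LieData κ ι}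
    (hD : D.CenterLE) {φ : D.Carrier →ₗ⁅ℝ⁆ G} {v : κ → G} {x : ι → G}
    (hφ : ∀ z : D.Carrier, φ z = ∑ k, z.1 k • v k + ∑ i, z.2 i • x i)
    (hv : LinearIndependent ℝ v) : Function.Injective φ := by
  have h0 : ∀ z : D.Carrier, z.2 = 0 → φ z = 0 → z = 0 := by
    intro z hz h
    rw [hφ, hz] at h
    simp only [Pi.zero_apply, zero_smul, Finset.sum_const_zero, add_zero] at h
    have := Fintype.linearIndependent_iff.1 hv z.1 h
    exact Prod.ext (funext this) hz
  rw [injective_iff_map_eq_zero]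
  intro z hz
  refine h0 z (hD z fun y => h0 _ rfl ?_) hz
  rw [LieHom.map_lie, hz, zero_lie]

theorem surjective_of_forall {G : Type*} [LieRing G] [LieAlgebra ℝ G] {D : LieData κ ι}
    {φ : D.Carrier →ₗ⁅ℝ⁆ G} {v : κ → G} {x : ι → G}
    (hφ : ∀ z : D.Carrier, φ z = ∑ k, z.1 k • v k + ∑ i, z.2 i • x i)
    (h : ∀ g, g ∈ Submodule.span ℝ (Set.range v) ⊔ Submodule.span ℝ (Set.range x)) :
    Function.Surjective φ := by
  intro g
  obtain ⟨a, ha, b, hb, rfl⟩ := Submodule.mem_sup.1 (h g)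
  obtain ⟨c, rfl⟩ := (Submodule.mem_span_range_iff_exists_fun ℝ).1 ha
  obtain ⟨d, rfl⟩ := (Submodule.mem_span_range_iff_exists_fun ℝ).1 hb
  exact ⟨((c, d) : (κ → ℝ) × (ι → ℝ)), hφ _⟩

end LieData

/-! ### The derived algebra under isomorphisms and products -/

section Derived

variable {G H : Type*} [LieRing G] [LieAlgebra ℝ G] [LieRing H] [LieAlgebra ℝ H]

/-- The derived algebra, as the span of the brackets. -/
def derSpan (G : Type*) [LieRing G] [LieAlgebra ℝ G] : Submodule ℝ G :=
  Submodule.span ℝ {z | ∃ x y : G, ⁅x, y⁆ = z}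

theorem derivedSeries_one_eq_derSpan :
    (LieAlgebra.derivedSeries ℝ G 1).toSubmodule = derSpan G :=
  LieAlgebra.coe_derivedSeries_one_eq ℝ G

theorem lie_mem_derSpan (x y : G) : ⁅x, y⁆ ∈ derSpan G := Submodule.subset_span ⟨x, y, rfl⟩

theorem map_mem_derSpan (φ : G →ₗ⁅ℝ⁆ H) {x : G} (hx : x ∈ derSpan G) : φ x ∈ derSpan H := by
  induction hx using Submodule.span_induction with
  | mem x h => obtain ⟨a, b, rfl⟩ := h; rw [LieHom.map_lie]; exact lie_mem_derSpan _ _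
  | zero => rw [map_zero]; exact zero_mem _
  | add x y _ _ hx hy => rw [map_add]; exact add_mem hx hy
  | smul c x _ hx => rw [map_smul]; exact Submodule.smul_mem _ _ hx

theorem LieEquiv.apply_mem_derSpan_iff (e : G ≃ₗ⁅ℝ⁆ H) {x : G} :
    e x ∈ derSpan H ↔ x ∈ derSpan G := by
  refine ⟨fun h => ?_, fun h => map_mem_derSpan e.toLieHom h⟩
  have := map_mem_derSpan e.symm.toLieHom h
  change e.symm (e x) ∈ _ at this
  rwa [LieEquiv.symm_apply_apply] at this

theorem LieEquiv.map_derSpan (e : G ≃ₗ⁅ℝ⁆ H) :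
    (derSpan G).map (e.toLinearEquiv : G →ₗ[ℝ] H) = derSpan H := by
  ext y
  constructor
  · rintro ⟨x, hx, rfl⟩
    exact e.apply_mem_derSpan_iff.2 hx
  · intro hy
    refine ⟨e.symm y, e.symm.apply_mem_derSpan_iff.2 hy, ?_⟩
    exact e.apply_symm_apply y

theorem LieEquiv.finrank_derSpan (e : G ≃ₗ⁅ℝ⁆ H) :
    Module.finrank ℝ (derSpan G) = Module.finrank ℝ (derSpan H) := by
  rw [← e.map_derSpan]
  exact (LinearEquiv.finrank_map_eq e.toLinearEquiv _).symm

theorem derSpan_prod : derSpan (G × H) = (derSpan G).prod (derSpan H) := by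
  apply le_antisymm
  · refine Submodule.span_le.2 ?_
    rintro _ ⟨x, y, rfl⟩
    exact ⟨lie_mem_derSpan _ _, lie_mem_derSpan _ _⟩
  · rintro ⟨x, y⟩ ⟨hx, hy⟩
    have h1 := map_mem_derSpan (LieHom.inl ℝ G H) hx
    have h2 := map_mem_derSpan (LieHom.inr ℝ G H) hy
    have := add_mem h1 h2
    simpa using this

theorem finrank_derSpan_prod [FiniteDimensional ℝ G] [FiniteDimensional ℝ H] :
    Module.finrank ℝ (derSpan (G × H)) =
      Module.finrank ℝ (derSpan G) + Module.finrank ℝ (derSpan H) := by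
  rw [derSpan_prod, ← Module.finrank_prod]
  exact LinearEquiv.finrank_eq
    { toFun := fun x => (⟨x.1.1, x.2.1⟩, ⟨x.1.2, x.2.2⟩)
      map_add' := fun _ _ => rfl
      map_smul' := fun _ _ => rfl
      invFun := fun x => ⟨(x.1, x.2), x.1.2, x.2.2⟩
      left_inv := fun _ => rfl
      right_inv := fun _ => rfl }

/-- Every central element lies in the derived algebra. -/
def CentralInDerived (G : Type*) [LieRing G] [LieAlgebra ℝ G] : Prop :=
  ∀ z : G, (∀ x : G, ⁅x, z⁆ = 0) → z ∈ derSpan G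

theorem CentralInDerived.of_equiv (e : G ≃ₗ⁅ℝ⁆ H) (h : CentralInDerived G) :
    CentralInDerived H := by
  intro z hz
  have := h (e.symm z) fun x => e.injective (by
    change e ⁅x, e.symm z⁆ = e 0
    rw [LieEquiv.map_lie, e.apply_symm_apply, hz, map_zero])
  exact e.symm.apply_mem_derSpan_iff.1 this

theorem CentralInDerived.fst (h : CentralInDerived (G × H)) : CentralInDerived G := by
  intro z hz
  have := h (z, 0) fun x => by simp [LieAlgebra.Prod.bracket_apply, hz]
  rw [derSpan_prod] at this
  exact this.1

theorem CentralInDerived.snd (h : CentralInDerived (G × H)) : CentralInDerived H := by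
  intro z hz
  have := h (0, z) fun x => by simp [LieAlgebra.Prod.bracket_apply, hz]
  rw [derSpan_prod] at this
  exact this.2

end Derived

/-! ### Direct sums and central elements -/

section Decomposition

variable {G H G' H' K : Type*} [LieRing G] [LieAlgebra ℝ G] [LieRing H] [LieAlgebra ℝ H]
  [LieRing G'] [LieAlgebra ℝ G'] [LieRing H'] [LieAlgebra ℝ H'] [LieRing K] [LieAlgebra ℝ K]

/-- Product of two equivalences of Lie algebras. -/
def lieEquivProdCongr (e : G ≃ₗ⁅ℝ⁆ G') (f : H ≃ₗ⁅ℝ⁆ H') : (G × H) ≃ₗ⁅ℝ⁆ G' × H' :=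
  { LieHom.prodMap e.toLieHom f.toLieHom with
    invFun := fun x => (e.symm x.1, f.symm x.2)
    left_inv := fun x => Prod.ext (e.symm_apply_apply x.1) (f.symm_apply_apply x.2)
    right_inv := fun x => Prod.ext (e.apply_symm_apply x.1) (f.apply_symm_apply x.2) }

/-- A direct sum of two ideals is isomorphic to their product. -/
noncomputable def lieEquivProdOfIsCompl (I J : LieIdeal ℝ G) (h : IsCompl I J) :
    (I × J) ≃ₗ⁅ℝ⁆ G :=
  { Submodule.prodEquivOfIsCompl I.toSubmodule J.toSubmodule
      ((LieSubmodule.isCompl_toSubmodule).2 h) with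
    map_lie' := by
      have h0 : ∀ (a : I) (b : J), ⁅(a : G), (b : G)⁆ = 0 := by
        intro a b
        have h1 : ⁅(a : G), (b : G)⁆ ∈ I ⊓ J :=
          ⟨lie_mem_left ℝ G I _ _ a.2, lie_mem_right ℝ G J _ _ b.2⟩
        rw [h.inf_eq_bot] at h1
        simpa using h1
      intro x y
      change ((⁅x.1, y.1⁆ : I) : G) + ((⁅x.2, y.2⁆ : J) : G) =
        ⁅(x.1 : G) + (x.2 : G), (y.1 : G) + (y.2 : G)⁆
      rw [add_lie, lie_add, lie_add, h0, ← lie_skew (x.2 : G), h0]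
      simp }

/-- A submodule closed under brackets with arbitrary elements, as an ideal. -/
def idealOfSubmodule (P : Submodule ℝ G) (hP : ∀ x : G, ∀ y ∈ P, ⁅x, y⁆ ∈ P) : LieIdeal ℝ G :=
  { P with lie_mem := fun {x m} hm => hP x m hm }

theorem isCompl_idealOfSubmodule {P Q : Submodule ℝ G} (hP : ∀ x : G, ∀ y ∈ P, ⁅x, y⁆ ∈ P)
    (hQ : ∀ x : G, ∀ y ∈ Q, ⁅x, y⁆ ∈ Q) (h : IsCompl P Q) :
    IsCompl (idealOfSubmodule P hP) (idealOfSubmodule Q hQ) :=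
  (LieSubmodule.isCompl_toSubmodule).1 h

theorem isDecomposable_of_isCompl {P Q : Submodule ℝ G} (hP : ∀ x : G, ∀ y ∈ P, ⁅x, y⁆ ∈ P)
    (hQ : ∀ x : G, ∀ y ∈ Q, ⁅x, y⁆ ∈ Q) (h : IsCompl P Q) (hP0 : P ≠ ⊥) (hQ0 : Q ≠ ⊥) :
    IsDecomposable G := by
  refine ⟨idealOfSubmodule P hP, idealOfSubmodule Q hQ, ?_, ?_, isCompl_idealOfSubmodule hP hQ h⟩
  · intro h1
    exact hP0 (congrArg LieSubmodule.toSubmodule h1)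
  · intro h1
    exact hQ0 (congrArg LieSubmodule.toSubmodule h1)

theorem exists_equiv_abelianR [FiniteDimensional ℝ G] (h : ∀ x y : G, ⁅x, y⁆ = 0) :
    Nonempty (G ≃ₗ⁅ℝ⁆ (abelianR (Module.finrank ℝ G)).Carrier) := by
  have e : G ≃ₗ[ℝ] (abelianR (Module.finrank ℝ G)).Carrier := by
    apply LinearEquiv.ofFinrankEq
    rw [LieData.finrank_carrier]
    simp
  refine ⟨{ e with map_lie' := ?_ }⟩
  intro x y
  change e ⁅x, y⁆ = ⁅e x, e y⁆
  rw [h, map_zero, LieData.lie_def]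
  symm
  refine Prod.ext ?_ rfl
  change (abelianR _).op _ *ᵥ _ - (abelianR _).op _ *ᵥ _ + (abelianR _).form _ _ = 0
  simp [LieData.op, LieData.form]

/-- A subspace containing the derived algebra is an ideal. Choosing one complementary to the line of
a central `z` outside the derived algebra splits that line off. -/
theorem CentralInDerived.of_not_isDecomposable (hd : derSpan G ≠ ⊥) (h : ¬ IsDecomposable G) :
    CentralInDerived G := by
  intro z hz
  by_contra hzd
  apply h
  have hdis : Disjoint (derSpan G) (Submodule.span ℝ {z}) :=
    (Submodule.disjoint_span_singleton_of_notMem hzd)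
  obtain ⟨P, hP, hPc⟩ := hdis.exists_isCompl
  refine isDecomposable_of_isCompl (P := P) (Q := Submodule.span ℝ {z})
    (fun x y _ => hP (lie_mem_derSpan x y)) ?_ hPc ?_ ?_
  · intro x y hy
    obtain ⟨c, rfl⟩ := Submodule.mem_span_singleton.1 hy
    rw [lie_smul, hz, smul_zero]
    exact zero_mem _
  · rintro rfl
    exact hd (le_bot_iff.1 hP)
  · intro h0
    rw [Submodule.span_singleton_eq_bot] at h0
    rw [h0] at hzd
    exact hzd (zero_mem _)

/-- Splitting off a maximal abelian direct summand. -/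
theorem exists_centralInDerived_summand [FiniteDimensional ℝ G] :
    ∃ (L : LieIdeal ℝ G) (r : ℕ), CentralInDerived L ∧
      Nonempty (G ≃ₗ⁅ℝ⁆ L × (abelianR r).Carrier) ∧ (r = 0 → CentralInDerived G) := by
  let Z : Submodule ℝ G := (LieAlgebra.center ℝ G).toSubmodule
  have hZ : ∀ z, z ∈ Z ↔ ∀ x : G, ⁅x, z⁆ = 0 := fun z => LieModule.mem_maxTrivSubmodule ℝ G G z
  -- By the modular law `A₀ ⊓ Z` complements `derSpan G ⊓ Z` inside the centre; it becomes the
  -- abelian summand.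
  obtain ⟨A₀, hA₀⟩ := exists_isCompl (derSpan G ⊓ Z)
  let A := A₀ ⊓ Z
  have hAZ : A ≤ Z := inf_le_right
  have hAdis : Disjoint (derSpan G) A := by
    rw [disjoint_iff, eq_bot_iff, ← hA₀.inf_eq_bot]
    exact le_inf (le_inf inf_le_left (inf_le_right.trans inf_le_right))
      (inf_le_right.trans inf_le_left)
  have hZle : Z ≤ derSpan G ⊔ A := by
    intro z hz
    have : z ∈ (derSpan G ⊓ Z) ⊔ A₀ := by rw [hA₀.sup_eq_top]; trivial
    obtain ⟨u, hu, a, ha, rfl⟩ := Submodule.mem_sup.1 this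
    refine Submodule.add_mem_sup hu.1 ⟨ha, ?_⟩
    have := sub_mem hz hu.2
    simpa using this
  obtain ⟨P, hP, hPc⟩ := hAdis.exists_isCompl
  have hPi : ∀ x : G, ∀ y ∈ P, ⁅x, y⁆ ∈ P := fun x y _ => hP (lie_mem_derSpan x y)
  have hAi : ∀ x : G, ∀ y ∈ A, ⁅x, y⁆ ∈ A := by
    intro x y hy
    rw [(hZ y).1 (hAZ hy)]
    exact zero_mem _
  let L := idealOfSubmodule P hPi
  let M := idealOfSubmodule A hAi
  have hLM : IsCompl L M := isCompl_idealOfSubmodule hPi hAi hPc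
  let Φ := lieEquivProdOfIsCompl L M hLM
  have hMab : ∀ x y : M, ⁅x, y⁆ = 0 := by
    intro x y
    apply Subtype.ext
    exact (hZ _).1 (hAZ y.2) _
  obtain ⟨f⟩ := exists_equiv_abelianR hMab
  refine ⟨L, Module.finrank ℝ M, ?_, ⟨Φ.symm.trans (lieEquivProdCongr LieEquiv.refl f)⟩, ?_⟩
  · intro z hz
    have hzc : (z : G) ∈ Z := by
      rw [hZ]
      intro x
      have : x ∈ P ⊔ A := by rw [hPc.sup_eq_top]; trivial
      obtain ⟨u, hu, a, ha, rfl⟩ := Submodule.mem_sup.1 this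
      have h1 : ⁅u, (z : G)⁆ = 0 := congrArg Subtype.val (hz ⟨u, hu⟩)
      rw [add_lie, h1, ← lie_skew, (hZ a).1 (hAZ ha), neg_zero, add_zero]
    obtain ⟨v, hv, a, ha, hva⟩ := Submodule.mem_sup.1 (hZle hzc)
    have ha0 : a ∈ P ⊓ A := by
      refine ⟨?_, ha⟩
      have := sub_mem (show (z : G) ∈ P from z.2) (hP hv)
      rw [← hva] at this
      simpa using this
    rw [hPc.inf_eq_bot, Submodule.mem_bot] at ha0
    have hzd : (z : G) ∈ derSpan G := by rw [← hva, ha0, add_zero]; exact hv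
    have h2 : Φ (z, 0) = (z : G) := by
      change (z : G) + ((0 : M) : G) = z
      simp
    rw [← h2, Φ.apply_mem_derSpan_iff, derSpan_prod] at hzd
    exact hzd.1
  · intro hr z hz
    have hA0 : A = ⊥ := Submodule.finrank_eq_zero.1 hr
    rw [hA0, sup_bot_eq] at hZle
    exact hZle ((hZ z).2 hz)

end Decomposition

/-! ### Commutativity of a two-dimensional derived ideal -/

section DerivedAbelian

variable {G : Type*} [LieRing G] [LieAlgebra ℝ G]

theorem trace_toEnd_derivedSeries_eq_zero (x : G) (hx : x ∈ derSpan G) :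
    LinearMap.trace ℝ _ (LieModule.toEnd ℝ G (LieAlgebra.derivedSeries ℝ G 1) x) = 0 := by
  induction hx using Submodule.span_induction with
  | mem x h =>
    obtain ⟨a, b, rfl⟩ := h
    have : LieModule.toEnd ℝ G (LieAlgebra.derivedSeries ℝ G 1) ⁅a, b⁆ =
        LieModule.toEnd ℝ G (LieAlgebra.derivedSeries ℝ G 1) a *
          LieModule.toEnd ℝ G (LieAlgebra.derivedSeries ℝ G 1) b -
        LieModule.toEnd ℝ G (LieAlgebra.derivedSeries ℝ G 1) b *
          LieModule.toEnd ℝ G (LieAlgebra.derivedSeries ℝ G 1) a := by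
      ext m
      simp
    rw [this, map_sub, LinearMap.trace_mul_comm, sub_self]
  | zero => simp
  | add x y _ _ hx hy => rw [map_add, map_add, hx, hy, add_zero]
  | smul c x _ hx => rw [map_smul, map_smul, hx, smul_zero]

/-- For a basis `b 0`, `b 1` of the plane, `ad (b 0)` kills `b 0`, so its trace is the `b
1`-coordinate of `⁅b 0, b 1⁆`; up to sign the trace of `ad (b 1)` is the `b 0`-coordinate. Both
traces vanish. -/
theorem lie_eq_zero_of_mem_derSpan (hd : Module.finrank ℝ (derSpan G) = 2) {x y : G}
    (hx : x ∈ derSpan G) (hy : y ∈ derSpan G) : ⁅x, y⁆ = 0 := by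
  let M := LieAlgebra.derivedSeries ℝ G 1
  have hM : ∀ x, x ∈ M ↔ x ∈ derSpan G := by
    intro x; rw [← derivedSeries_one_eq_derSpan]; rfl
  have hd' : Module.finrank ℝ M = 2 := by
    rw [← hd, ← derivedSeries_one_eq_derSpan]; rfl
  have : FiniteDimensional ℝ M := Module.finite_of_finrank_pos (by omega)
  let b : Module.Basis (Fin 2) ℝ M := Module.finBasisOfFinrankEq ℝ M hd'
  have htr : ∀ x ∈ derSpan G,
      b.repr ⁅x, b 0⁆ 0 + b.repr ⁅x, b 1⁆ 1 = 0 := by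
    intro x hx
    have := trace_toEnd_derivedSeries_eq_zero x hx
    rw [LinearMap.trace_eq_matrix_trace ℝ b, Matrix.trace_fin_two] at this
    rw [LinearMap.toMatrix_apply, LinearMap.toMatrix_apply] at this
    exact this
  have hs : ∀ u w : M, ⁅(u : G), w⁆ = -⁅(w : G), u⁆ := by
    intro u w
    apply Subtype.ext
    exact (lie_skew (u : G) (w : G)).symm
  have h0 := htr _ ((hM _).1 (b 0).2)
  have h1 := htr _ ((hM _).1 (b 1).2)
  have h00 : ⁅(b 0 : G), b 0⁆ = 0 := Subtype.ext (lie_self _)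
  have h11 : ⁅(b 1 : G), b 1⁆ = 0 := Subtype.ext (lie_self _)
  rw [h00] at h0
  rw [h11, hs] at h1
  have h01 : ⁅(b 0 : G), b 1⁆ = 0 := by
    apply b.repr.injective
    ext i
    fin_cases i
    · simpa using h1
    · simpa using h0
  have h10 : ⁅(b 1 : G), b 0⁆ = 0 := by rw [hs, h01, neg_zero]
  have e0 : ⁅(b 0 : G), (b 0 : G)⁆ = 0 := lie_self _
  have e1 : ⁅(b 1 : G), (b 1 : G)⁆ = 0 := lie_self _
  have e01 : ⁅(b 0 : G), (b 1 : G)⁆ = 0 := congrArg Subtype.val h01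
  have e10 : ⁅(b 1 : G), (b 0 : G)⁆ = 0 := congrArg Subtype.val h10
  have hx' := b.sum_repr ⟨x, (hM x).2 hx⟩
  have hy' := b.sum_repr ⟨y, (hM y).2 hy⟩
  have hx'' := congrArg Subtype.val hx'
  have hy'' := congrArg Subtype.val hy'
  simp only [Fin.sum_univ_two] at hx'' hy''
  change _ • (b 0 : G) + _ • (b 1 : G) = x at hx''
  change _ • (b 0 : G) + _ • (b 1 : G) = y at hy''
  rw [← hx'', ← hy'']
  simp [e01, e10]

end DerivedAbelian

/-! ### Alternating forms, and operators on a real plane -/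

section LinearAlgebra

variable {E : Type*} [AddCommGroup E] [Module ℝ E]

/-- A hyperbolic family of length `k` in `C`: `β (x i) (y j) = δ_ij`, all other values being `0`. -/
structure IsHyperbolicFamily (β : E →ₗ[ℝ] E →ₗ[ℝ] ℝ) (C : Submodule ℝ E) (k : ℕ)
    (x y : ℕ → E) : Prop where
  left_mem : ∀ i < k, x i ∈ C
  right_mem : ∀ i < k, y i ∈ C
  left_left : ∀ i < k, ∀ j < k, β (x i) (x j) = 0
  right_right : ∀ i < k, ∀ j < k, β (y i) (y j) = 0
  left_right : ∀ i < k, ∀ j < k, β (x i) (y j) = if i = j then 1 else 0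

/-- The span of a hyperbolic family. -/
def hypSpan (k : ℕ) (x y : ℕ → E) : Submodule ℝ E :=
  Submodule.span ℝ (x '' {i | i < k} ∪ y '' {i | i < k})

theorem left_mem_hypSpan {k : ℕ} {x y : ℕ → E} {i : ℕ} (hi : i < k) : x i ∈ hypSpan k x y :=
  Submodule.subset_span (Or.inl ⟨i, hi, rfl⟩)

theorem right_mem_hypSpan {k : ℕ} {x y : ℕ → E} {i : ℕ} (hi : i < k) : y i ∈ hypSpan k x y :=
  Submodule.subset_span (Or.inr ⟨i, hi, rfl⟩)

theorem hypSpan_le {k : ℕ} {x y : ℕ → E} {P : Submodule ℝ E} (hx : ∀ i < k, x i ∈ P)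
    (hy : ∀ i < k, y i ∈ P) : hypSpan k x y ≤ P := by
  refine Submodule.span_le.2 ?_
  rintro _ (⟨i, hi, rfl⟩ | ⟨i, hi, rfl⟩)
  · exact hx i hi
  · exact hy i hi

theorem IsHyperbolicFamily.hypSpan_le {β : E →ₗ[ℝ] E →ₗ[ℝ] ℝ} {C : Submodule ℝ E} {k : ℕ}
    {x y : ℕ → E} (h : IsHyperbolicFamily β C k x y) : hypSpan k x y ≤ C :=
  _root_.hypSpan_le h.left_mem h.right_mem

theorem alt_neg {β : E →ₗ[ℝ] E →ₗ[ℝ] ℝ} (hβ : ∀ x, β x x = 0) (x y : E) : β x y = -β y x := by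
  have := hβ (x + y)
  simp only [map_add, LinearMap.add_apply, hβ] at this
  linarith

theorem IsHyperbolicFamily.right_left {β : E →ₗ[ℝ] E →ₗ[ℝ] ℝ} (hβ : ∀ x, β x x = 0)
    {C : Submodule ℝ E} {k : ℕ} {x y : ℕ → E} (h : IsHyperbolicFamily β C k x y) :
    ∀ i < k, ∀ j < k, β (y i) (x j) = if i = j then -1 else 0 := by
  intro i hi j hj
  rw [alt_neg hβ, h.left_right j hj i hi]
  by_cases hij : i = j
  · simp [hij]
  · simp [hij, Ne.symm hij]

/-- Orthogonal projection to the complement of a hyperbolic family. -/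
theorem IsHyperbolicFamily.exists_orthogonal {β : E →ₗ[ℝ] E →ₗ[ℝ] ℝ} (hβ : ∀ x, β x x = 0)
    {C : Submodule ℝ E} {k : ℕ} {x y : ℕ → E} (h : IsHyperbolicFamily β C k x y) (u : E) :
    ∃ s ∈ hypSpan k x y, ∀ j < k, β (u - s) (x j) = 0 ∧ β (u - s) (y j) = 0 := by
  refine ⟨∑ i ∈ Finset.range k, β u (y i) • x i - ∑ i ∈ Finset.range k, β u (x i) • y i,
    sub_mem (sum_mem fun i hi => Submodule.smul_mem _ _ (left_mem_hypSpan (Finset.mem_range.1 hi)))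
    (sum_mem fun i hi => Submodule.smul_mem _ _ (right_mem_hypSpan (Finset.mem_range.1 hi))), ?_⟩
  intro j hj
  simp only [map_sub, LinearMap.sub_apply, map_sum, LinearMap.sum_apply, map_smul,
    LinearMap.smul_apply, smul_eq_mul]
  have e1 : ∑ i ∈ Finset.range k, β u (y i) * β (x i) (x j) = 0 :=
    Finset.sum_eq_zero fun i hi => by rw [h.left_left i (Finset.mem_range.1 hi) j hj, mul_zero]
  have e2 : ∑ i ∈ Finset.range k, β u (x i) * β (y i) (y j) = 0 :=
    Finset.sum_eq_zero fun i hi => by rw [h.right_right i (Finset.mem_range.1 hi) j hj, mul_zero]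
  have e3 : ∑ i ∈ Finset.range k, β u (x i) * β (y i) (x j) = -β u (x j) := by
    rw [Finset.sum_eq_single_of_mem j (Finset.mem_range.2 hj), h.right_left hβ j hj j hj]
    · simp
    · intro i hi hij
      rw [h.right_left hβ i (Finset.mem_range.1 hi) j hj, if_neg hij, mul_zero]
  have e4 : ∑ i ∈ Finset.range k, β u (y i) * β (x i) (y j) = β u (y j) := by
    rw [Finset.sum_eq_single_of_mem j (Finset.mem_range.2 hj), h.left_right j hj j hj]
    · simp
    · intro i hi hij
      rw [h.left_right i (Finset.mem_range.1 hi) j hj, if_neg hij, mul_zero]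
  rw [e1, e2, e3, e4]
  constructor <;> ring

theorem IsHyperbolicFamily.eq_zero_of_mem_hypSpan {β : E →ₗ[ℝ] E →ₗ[ℝ] ℝ} {k : ℕ} {x y : ℕ → E}
    {u s : E} (hu : ∀ j < k, β u (x j) = 0 ∧ β u (y j) = 0) (hs : s ∈ hypSpan k x y) :
    β u s = 0 := by
  have : hypSpan k x y ≤ LinearMap.ker (β u) :=
    _root_.hypSpan_le (fun i hi => (hu i hi).1) (fun i hi => (hu i hi).2)
  exact this hs

/-- A vector of `C` orthogonal to a family that cannot be extended lies in the radical of `β` on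
`C`; otherwise it and a corrected partner extend the family. Pairing with the `y j` shows that the
`x i` are independent, which bounds the length. -/
theorem exists_maximal_hyperbolicFamily [FiniteDimensional ℝ E] {β : E →ₗ[ℝ] E →ₗ[ℝ] ℝ}
    (hβ : ∀ x, β x x = 0) (C : Submodule ℝ E) :
    ∃ k x y, IsHyperbolicFamily β C k x y ∧
      ∀ c ∈ C, (∀ j < k, β c (x j) = 0 ∧ β c (y j) = 0) → ∀ c' ∈ C, β c c' = 0 := by
  by_contra! hcon
  have hall : ∀ k, ∃ x y, IsHyperbolicFamily β C k x y := by
    intro k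
    induction k with
    | zero => exact ⟨0, 0, by constructor <;> simp⟩
    | succ k ih =>
      obtain ⟨x, y, h⟩ := ih
      obtain ⟨c, hc, hcx, c', hc', hcc⟩ := hcon k x y h
      -- Since `c` is orthogonal to the family, removing `s` from `c'` does not change its pairing
      -- with `c`.
      obtain ⟨s, hs, hso⟩ := h.exists_orthogonal hβ c'
      have hcs : β c (c' - s) = β c c' := by
        rw [map_sub, IsHyperbolicFamily.eq_zero_of_mem_hypSpan hcx hs, sub_zero]
      let d := (β c c')⁻¹ • (c' - s)
      have hd : d ∈ C := C.smul_mem _ (sub_mem hc' (h.hypSpan_le hs))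
      have hcd : β c d = 1 := by
        simp only [d, map_smul, hcs, smul_eq_mul]
        exact inv_mul_cancel₀ hcc
      have hdx : ∀ j < k, β d (x j) = 0 := fun j hj => by
        simp only [d, map_smul, LinearMap.smul_apply, (hso j hj).1, smul_zero]
      have hdy : ∀ j < k, β d (y j) = 0 := fun j hj => by
        simp only [d, map_smul, LinearMap.smul_apply, (hso j hj).2, smul_zero]
      have hlt : ∀ i < k + 1, ¬ i < k → i = k := by intros; omega
      refine ⟨fun i => if i < k then x i else c, fun i => if i < k then y i else d, ?_⟩
      constructor
      · intro i hi
        split_ifs with h1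
        · exact h.left_mem i h1
        · exact hc
      · intro i hi
        split_ifs with h1
        · exact h.right_mem i h1
        · exact hd
      · intro i hi j hj
        split_ifs with h1 h2 h2
        · exact h.left_left i h1 j h2
        · rw [alt_neg hβ, (hcx i h1).1, neg_zero]
        · exact (hcx j h2).1
        · exact hβ c
      · intro i hi j hj
        split_ifs with h1 h2 h2
        · exact h.right_right i h1 j h2
        · rw [alt_neg hβ, hdy i h1, neg_zero]
        · exact hdy j h2
        · exact hβ d
      · intro i hi j hj
        by_cases h1 : i < k <;> by_cases h2 : j < k
        · rw [if_pos h1, if_pos h2]; exact h.left_right i h1 j h2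
        · rw [if_pos h1, if_neg h2, alt_neg hβ, hdx i h1, neg_zero, if_neg (by omega)]
        · rw [if_neg h1, if_pos h2, (hcx j h2).2, if_neg (by omega)]
        · rw [if_neg h1, if_neg h2, hcd, if_pos (by omega)]
  obtain ⟨x, y, h⟩ := hall (Module.finrank ℝ E + 1)
  have hli : LinearIndependent ℝ fun i : Fin (Module.finrank ℝ E + 1) => x i := by
    rw [Fintype.linearIndependent_iff]
    intro g hg j
    have := congrArg (fun v => β v (y j)) hg
    simp only [map_sum, map_smul, LinearMap.sum_apply, LinearMap.smul_apply, smul_eq_mul,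
      map_zero, LinearMap.zero_apply] at this
    rw [Finset.sum_eq_single_of_mem j (Finset.mem_univ _)] at this
    · rwa [h.left_right j j.2 j j.2, if_pos rfl, mul_one] at this
    · intro i _ hij
      rw [h.left_right i i.2 j j.2, if_neg (fun h => hij (Fin.ext h)), mul_zero]
  have := hli.fintype_card_le_finrank
  simp at this

theorem span_pair_eq_of_finrank_eq_two {V : Submodule ℝ E} (hV : Module.finrank ℝ V = 2) {e f : E}
    (he : e ∈ V) (hf : f ∈ V) (hef : LinearIndependent ℝ ![e, f]) :
    Submodule.span ℝ {e, f} = V := by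
  have : FiniteDimensional ℝ V := Module.finite_of_finrank_pos (by omega)
  refine Submodule.eq_of_le_of_finrank_eq ?_ ?_
  · rw [Submodule.span_le]
    rintro _ (rfl | rfl) <;> assumption
  · rw [hV]
    have := finrank_span_eq_card hef
    rw [Matrix.range_cons_cons_empty] at this
    simpa using this

theorem exists_eq_of_mem {V : Submodule ℝ E} (hV : Module.finrank ℝ V = 2) {e f : E}
    (he : e ∈ V) (hf : f ∈ V) (hef : LinearIndependent ℝ ![e, f]) {v : E} (hv : v ∈ V) :
    ∃ a b : ℝ, v = a • e + b • f := by
  rw [← span_pair_eq_of_finrank_eq_two hV he hf hef, Submodule.mem_span_pair] at hv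
  obtain ⟨a, b, h⟩ := hv
  exact ⟨a, b, h.symm⟩

theorem exists_pair {V : Submodule ℝ E} (hV : Module.finrank ℝ V = 2) :
    ∃ e ∈ V, ∃ f ∈ V, LinearIndependent ℝ ![e, f] := by
  have : FiniteDimensional ℝ V := Module.finite_of_finrank_pos (by omega)
  let b := Module.finBasisOfFinrankEq ℝ V hV
  refine ⟨b 0, (b 0).2, b 1, (b 1).2, ?_⟩
  have := b.linearIndependent.map' V.subtype (Submodule.ker_subtype V)
  have hb : ![(b 0 : E), (b 1 : E)] = V.subtype ∘ b := by
    ext i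
    fin_cases i <;> rfl
  rw [hb]
  exact this

theorem pair_coeff_eq_zero {e f : E} (hef : LinearIndependent ℝ ![e, f]) {a b : ℝ}
    (h : a • e + b • f = 0) : a = 0 ∧ b = 0 :=
  LinearIndependent.pair_iff.1 hef a b h

/-- Without a cyclic vector every nonzero vector of `V` is an eigenvector; comparing `e`, `f` and `e
+ f` shows that all eigenvalues agree. -/
theorem scalar_or_exists_cyclic {V : Submodule ℝ E} (hV : Module.finrank ℝ V = 2)
    (T : E →ₗ[ℝ] E) :
    (∃ a : ℝ, ∀ v ∈ V, T v = a • v) ∨ ∃ e ∈ V, LinearIndependent ℝ ![e, T e] := by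
  by_contra! h
  obtain ⟨h1, h2⟩ := h
  obtain ⟨e, he, f, hf, hef⟩ := exists_pair hV
  have key : ∀ v ∈ V, v ≠ 0 → ∃ a : ℝ, a • v = T v := by
    intro v hv hv0
    have := h2 v hv
    rw [LinearIndependent.pair_iff' hv0] at this
    push Not at this
    exact this
  have he0 : e ≠ 0 := hef.ne_zero 0
  have hf0 : f ≠ 0 := hef.ne_zero 1
  have hef0 : e + f ≠ 0 := by
    intro h0
    have := pair_coeff_eq_zero hef (a := 1) (b := 1) (by simpa using h0)
    simp at this
  obtain ⟨a, ha⟩ := key e he he0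
  obtain ⟨b, hb⟩ := key f hf hf0
  obtain ⟨c, hc⟩ := key (e + f) (add_mem he hf) hef0
  rw [map_add, ← ha, ← hb] at hc
  have := pair_coeff_eq_zero hef (a := c - a) (b := c - b) (by
    rw [smul_add] at hc
    calc (c - a) • e + (c - b) • f = (c • e + c • f) - (a • e + b • f) := by module
      _ = 0 := by rw [hc, sub_self])
  obtain ⟨v, hv, hne⟩ := h1 a
  obtain ⟨p, q, rfl⟩ := exists_eq_of_mem hV he hf hef hv
  apply hne
  have hab : b = a := by linarith [this.1, this.2]
  rw [map_add, map_smul, map_smul, ← ha, ← hb, hab, smul_add, smul_comm p, smul_comm q]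

/-- An operator commuting with `T` is determined by its value at the cyclic vector `e`, and some `p
+ q T` has the same value there. -/
theorem exists_eq_add_smul_of_commute {V : Submodule ℝ E} (hV : Module.finrank ℝ V = 2)
    {S T : E →ₗ[ℝ] E} (hS : ∀ v ∈ V, S v ∈ V) (hT : ∀ v ∈ V, T v ∈ V)
    (hST : ∀ v ∈ V, S (T v) = T (S v)) {e : E} (he : e ∈ V)
    (hli : LinearIndependent ℝ ![e, T e]) : ∃ p q : ℝ, ∀ v ∈ V, S v = p • v + q • T v := by
  obtain ⟨p, q, hpq⟩ := exists_eq_of_mem hV he (hT e he) hli (hS e he)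
  refine ⟨p, q, ?_⟩
  intro v hv
  obtain ⟨a, b, rfl⟩ := exists_eq_of_mem hV he (hT e he) hli hv
  simp only [map_add, map_smul, hST e he, hpq]
  module

/-- Real normal form of a non-scalar operator on a plane. -/
theorem exists_normalForm {V : Submodule ℝ E} (hV : Module.finrank ℝ V = 2)
    {T : E →ₗ[ℝ] E} (hT : ∀ v ∈ V, T v ∈ V) {e : E} (he : e ∈ V)
    (hli : LinearIndependent ℝ ![e, T e]) :
    ∃ e₀ ∈ V, ∃ e₁ ∈ V, LinearIndependent ℝ ![e₀, e₁] ∧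
      ((∃ a b : ℝ, a ≠ b ∧ T e₀ = a • e₀ ∧ T e₁ = b • e₁) ∨
       (∃ a : ℝ, T e₀ = a • e₀ ∧ T e₁ = e₀ + a • e₁) ∨
       (∃ a b : ℝ, 0 < b ∧ T e₀ = a • e₀ + b • e₁ ∧ T e₁ = -b • e₀ + a • e₁)) := by
  -- On `V` the characteristic polynomial of `T` is `X ^ 2 - p * X - q`, with discriminant `p ^ 2 +
  -- 4 * q`.
  obtain ⟨q, p, hpq⟩ := exists_eq_of_mem hV he (hT e he) hli (hT _ (hT e he))
  have hf := hT e he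
  set f := T e with hfdef
  rcases lt_trichotomy (p ^ 2 + 4 * q) 0 with hd | hd | hd
  · set b := Real.sqrt (-(p ^ 2 + 4 * q)) / 2 with hb
    have hbpos : 0 < b := by
      have := Real.sqrt_pos.2 (show 0 < -(p ^ 2 + 4 * q) by linarith)
      positivity
    have hb2 : b ^ 2 = -(p ^ 2 + 4 * q) / 4 := by
      rw [hb, div_pow, Real.sq_sqrt (by linarith)]; norm_num
    -- Here `(T - p / 2) ^ 2 = -b ^ 2` on `V`, so `b⁻¹ (T - p / 2)` is a complex structure.
    refine ⟨e, he, b⁻¹ • (f - (p / 2) • e), V.smul_mem _ (sub_mem hf (V.smul_mem _ he)), ?_,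
      Or.inr (Or.inr ⟨p / 2, b, hbpos, ?_, ?_⟩)⟩
    · rw [LinearIndependent.pair_iff]
      intro s t hst
      have := pair_coeff_eq_zero hli (a := s - t * b⁻¹ * (p / 2)) (b := t * b⁻¹) (by
        rw [← hst]; module)
      have ht : t = 0 := by
        rcases mul_eq_zero.1 this.2 with h | h
        · exact h
        · exact absurd h (inv_ne_zero hbpos.ne')
      refine ⟨?_, ht⟩
      rw [ht] at this
      simpa using this.1
    · rw [← hfdef, smul_smul, mul_inv_cancel₀ hbpos.ne']
      module
    · rw [map_smul, map_sub, map_smul, ← hfdef, hpq, ← sub_eq_zero]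
      have hq : q = -(p ^ 2 / 4) - b ^ 2 := by linarith
      rw [hq]
      match_scalars <;> field_simp <;> ring
  · have hq : q = -(p / 2) ^ 2 := by linarith
    refine ⟨f - (p / 2) • e, sub_mem hf (V.smul_mem _ he), e, he, ?_,
      Or.inr (Or.inl ⟨p / 2, ?_, ?_⟩)⟩
    · rw [LinearIndependent.pair_iff]
      intro s t hst
      have := pair_coeff_eq_zero hli (a := t - s * (p / 2)) (b := s) (by rw [← hst]; module)
      refine ⟨this.2, ?_⟩
      rw [this.2] at this
      simpa using this.1
    · rw [map_sub, map_smul, ← hfdef, hpq, hq, ← sub_eq_zero]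
      module
    · rw [← hfdef]; module
  · set r := Real.sqrt (p ^ 2 + 4 * q) with hr
    have hrpos : 0 < r := Real.sqrt_pos.2 hd
    have hr2 : r ^ 2 = p ^ 2 + 4 * q := Real.sq_sqrt hd.le
    have hq : q = (r ^ 2 - p ^ 2) / 4 := by linarith
    -- Applying `T` minus one root to `e` gives an eigenvector for the other root.
    refine ⟨f - ((p - r) / 2) • e, sub_mem hf (V.smul_mem _ he), f - ((p + r) / 2) • e,
      sub_mem hf (V.smul_mem _ he), ?_, Or.inl ⟨(p + r) / 2, (p - r) / 2, ?_, ?_, ?_⟩⟩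
    · rw [LinearIndependent.pair_iff]
      intro s t hst
      have := pair_coeff_eq_zero hli (a := -(s * ((p - r) / 2) + t * ((p + r) / 2))) (b := s + t)
        (by rw [← hst]; module)
      have ht : t = -s := by linarith [this.2]
      rw [ht] at this
      have h3 : s * r = 0 := by linarith [this.1]
      rcases mul_eq_zero.1 h3 with h | h
      · exact ⟨h, by rw [ht, h, neg_zero]⟩
      · exact absurd h hrpos.ne'
    · intro h; linarith
    · rw [map_sub, map_smul, ← hfdef, hpq, hq, ← sub_eq_zero]
      match_scalars <;> ring
    · rw [map_sub, map_smul, ← hfdef, hpq, hq, ← sub_eq_zero]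
      match_scalars <;> ring

end LinearAlgebra

/-! ### Centres of algebras given by structure constants -/

namespace LieData

variable {κ ι : Type} [Fintype κ] [Fintype ι]

theorem op_single [DecidableEq ι] (D : LieData κ ι) (j : ι) : D.op (Pi.single j 1) = D.A j := by
  rw [op, Finset.sum_eq_single j]
  · simp
  · intro i _ hij; simp [hij]
  · simp

theorem form_single [DecidableEq ι] (D : LieData κ ι) (w : ι → ℝ) (j : ι) :
    D.form w (Pi.single j 1) = ∑ i, w i • D.B i j := by
  rw [form]
  refine Finset.sum_congr rfl fun i _ => ?_
  rw [Finset.sum_eq_single j]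
  · simp
  · intro i _ hij; simp [hij]
  · simp

theorem op_eq_zero_of_central {D : LieData κ ι} {z : D.Carrier} (hz : ∀ y : D.Carrier, ⁅z, y⁆ = 0) :
    D.op z.2 = 0 := by
  classical
  apply Matrix.ext_of_mulVec_single
  intro k
  have := congrArg Prod.fst (hz ((Pi.single k 1, 0) : (κ → ℝ) × (ι → ℝ)))
  change D.op z.2 *ᵥ Pi.single k 1 - D.op 0 *ᵥ z.1 + D.form z.2 0 = 0 at this
  rw [op_zero, form_zero_right, Matrix.zero_mulVec, sub_zero, add_zero] at this
  rw [this, Matrix.zero_mulVec]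

theorem sum_B_of_central {D : LieData κ ι} {z : D.Carrier} (hz : ∀ y : D.Carrier, ⁅z, y⁆ = 0)
    (j : ι) : ∑ i, z.2 i • D.B i j = D.A j *ᵥ z.1 := by
  classical
  have := congrArg Prod.fst (hz ((0, Pi.single j 1) : (κ → ℝ) × (ι → ℝ)))
  change D.op z.2 *ᵥ 0 - D.op (Pi.single j 1) *ᵥ z.1 + D.form z.2 (Pi.single j 1) = 0 at this
  rw [Matrix.mulVec_zero, zero_sub, op_single, form_single] at this
  rw [eq_comm, ← sub_eq_zero, ← neg_eq_zero, ← this]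
  abel

/-- In coordinate `r` of `⁅z, X_j⁆ = 0` only the term `z.2 i * B i j r` survives. -/
theorem coeff_eq_zero_of_central {D : LieData κ ι} {z : D.Carrier}
    (hz : ∀ y : D.Carrier, ⁅z, y⁆ = 0) (i j : ι) (r : κ) (hA : (D.A j *ᵥ z.1) r = 0)
    (hB : ∀ i', i' ≠ i → D.B i' j r = 0) (hne : D.B i j r ≠ 0) : z.2 i = 0 := by
  have := congrFun (sum_B_of_central hz j) r
  rw [hA, Finset.sum_apply, Finset.sum_eq_single i] at this
  · exact (mul_eq_zero.1 this).resolve_right hne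
  · intro i' _ hi
    simp [hB i' hi]
  · simp

/-- `D` has the structure constants of `oneOp m M u`. -/
structure IsOneOp {m : ℕ} (D : LieData (Fin 2) (Fin m)) (M : Matrix (Fin 2) (Fin 2) ℝ)
    (u : ℕ → ℕ → Fin 2 → ℝ) : Prop where
  A_eq : ∀ i, D.A i = if (i : ℕ) + 3 = 3 then M else 0
  B_eq : ∀ i j, D.B i j = u (i + 3) (j + 3) - u (j + 3) (i + 3)

/-- `D` has the structure constants of `twoOp P Q`. -/
structure IsTwoOp (D : LieData (Fin 2) (Fin 2)) (P Q : Matrix (Fin 2) (Fin 2) ℝ) : Prop where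
  A_zero : D.A 0 = P
  A_one : D.A 1 = Q
  B_eq : ∀ i j, D.B i j = 0

variable {m : ℕ} {M P Q : Matrix (Fin 2) (Fin 2) ℝ} {u : ℕ → ℕ → Fin 2 → ℝ}

theorem IsOneOp.op_eq {D : LieData (Fin 2) (Fin m)} (hD : D.IsOneOp M u) (hm : 0 < m)
    (w : Fin m → ℝ) : D.op w = w ⟨0, hm⟩ • M := by
  rw [op, Finset.sum_eq_single ⟨0, hm⟩]
  · simp [hD.A_eq]
  · intro i _ hi
    have : (i : ℕ) ≠ 0 := fun h => hi (Fin.ext h)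
    simp [hD.A_eq, this]
  · simp

theorem IsTwoOp.op_eq {D : LieData (Fin 2) (Fin 2)} (hD : D.IsTwoOp P Q) (w : Fin 2 → ℝ) :
    D.op w = w 0 • P + w 1 • Q := by
  rw [op, Fin.sum_univ_two, hD.A_zero, hD.A_one]

/-- A central element has no `X_3`-coordinate because `M ≠ 0`. Every other generator is detected by
a partner `j` and a coordinate `r` in which it alone has a nonzero bracket with that partner. If the
partner is `X_3`, row `r` of `M` must vanish, so that the part in `span V` does not interfere. -/
theorem IsOneOp.centerLE {D : LieData (Fin 2) (Fin m)} (hD : D.IsOneOp M u) (hM : M ≠ 0)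
    (hp : ∀ i < m, i ≠ 0 → ∃ j < m, ∃ r, (j = 0 → ∀ v, (M *ᵥ v) r = 0) ∧
      (∀ i' < m, i' ≠ i → u (i' + 3) (j + 3) r - u (j + 3) (i' + 3) r = 0) ∧
      u (i + 3) (j + 3) r - u (j + 3) (i + 3) r ≠ 0) : D.CenterLE := by
  intro z hz
  funext i
  by_cases hi : (i : ℕ) = 0
  · have h1 := op_eq_zero_of_central hz
    rw [hD.op_eq (by have := i.2; omega)] at h1
    rw [show i = ⟨0, by have := i.2; omega⟩ from Fin.ext hi]
    exact (smul_eq_zero.1 h1).resolve_right hM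
  · obtain ⟨j, hj, r, h1, h2, h3⟩ := hp i i.2 hi
    refine coeff_eq_zero_of_central hz i ⟨j, hj⟩ r ?_ ?_ ?_
    · rw [hD.A_eq]
      split_ifs with h
      · exact h1 (by simpa using h) _
      · simp
    · intro i' hi'
      rw [hD.B_eq]
      exact h2 i' i'.2 fun h => hi' (Fin.ext h)
    · rw [hD.B_eq]
      exact h3

theorem IsTwoOp.centerLE {D : LieData (Fin 2) (Fin 2)} (hD : D.IsTwoOp P Q)
    (hPQ : ∀ a b : ℝ, a • P + b • Q = 0 → a = 0 ∧ b = 0) : D.CenterLE := by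
  intro z hz
  have := hPQ _ _ ((hD.op_eq z.2).symm.trans (op_eq_zero_of_central hz))
  funext i
  fin_cases i
  · exact this.1
  · exact this.2

end LieData

namespace Listed

open LieData

/-- Recording the list through `IsOneOp` and `IsTwoOp` allows centres, recognition and operator sets
to be treated uniformly. -/
theorem isOneOp_g3_1 (c : ℝ) (hc : c ≠ 0) :
    (g3_1 c hc).data.IsOneOp !![1, 0; 0, c] fun _ _ => 0 :=
  ⟨fun _ => rfl, fun _ _ => rfl⟩

theorem isOneOp_g3_2 : g3_2.data.IsOneOp !![1, 1; 0, 1] fun _ _ => 0 :=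
  ⟨fun _ => rfl, fun _ _ => rfl⟩

theorem isOneOp_g3_3 (φ : ℝ) (hφ : φ ∈ Set.Ioo 0 Real.pi) : (g3_3 φ hφ).data.IsOneOp
    !![Real.cos φ, -Real.sin φ; Real.sin φ, Real.cos φ] fun _ _ => 0 :=
  ⟨fun _ => rfl, fun _ _ => rfl⟩

theorem isOneOp_g4_1 : g4_1.data.IsOneOp !![1, 0; 0, 0]
    fun p q => if p = 3 ∧ q = 4 then ![0, 1] else 0 :=
  ⟨fun _ => rfl, fun _ _ => rfl⟩

theorem isOneOp_g4_2 : g4_2.data.IsOneOp !![0, 1; 0, 0]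
    fun p q => if p = 3 ∧ q = 4 then ![0, 1] else 0 :=
  ⟨fun _ => rfl, fun _ _ => rfl⟩

theorem isTwoOp_g4_3 (c : ℝ) : LieData.IsTwoOp (g4_3 c).data !![0, 1; 0, c] !![1, 0; 0, 1] :=
  ⟨rfl, rfl, fun _ _ => rfl⟩

theorem isTwoOp_affC : LieData.IsTwoOp affC.data !![0, 1; -1, 0] !![1, 0; 0, 1] := ⟨rfl, rfl, fun _ _ => rfl⟩

theorem isOneOp_g5 (k : ℕ) : (g5 k).data.IsOneOp !![0, 0; 1, 0]
    fun p q => if p = 3 ∧ q = 4 then ![1, 0] else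
      if 4 ≤ p ∧ Even p ∧ q = p + 1 then ![0, 1] else 0 :=
  ⟨fun _ => rfl, fun _ _ => rfl⟩

theorem isOneOp_g6_1 (k : ℕ) : (g6_1 k).data.IsOneOp !![1, 0; 0, 0]
    fun p q => if 3 ≤ p ∧ Odd p ∧ q = p + 1 then ![0, 1] else 0 :=
  ⟨fun _ => rfl, fun _ _ => rfl⟩

theorem isOneOp_g6_2 (k : ℕ) : (g6_2 k).data.IsOneOp !![0, 0; 1, 0]
    fun p q => if p = 3 ∧ q = 4 then ![1, 0] else
      if 5 ≤ p ∧ Odd p ∧ q = p + 1 then ![0, 1] else 0 :=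
  ⟨fun _ => rfl, fun _ _ => rfl⟩

end Listed

open LieData

theorem affR_centerLE : affR.CenterLE := by
  intro z hz
  have := op_eq_zero_of_central hz
  funext i
  have h2 := congrFun (congrFun this 0) 0
  rw [Subsingleton.elim i 0]
  simpa [op, affR] using h2

theorem heis_centerLE (m : ℕ) : (heis m).CenterLE := by
  intro z hz
  funext i
  rcases i with i | i
  · refine coeff_eq_zero_of_central hz _ (Sum.inr i) 0 (by simp [heis]) ?_ (by simp [heis])
    rintro (i' | i') h
    · have : i' ≠ i := fun h' => h (by rw [h'])
      simp [heis, this]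
    · simp [heis]
  · refine coeff_eq_zero_of_central hz _ (Sum.inl i) 0 (by simp [heis]) ?_ (by simp [heis])
    rintro (i' | i') h
    · simp [heis]
    · have : i' ≠ i := fun h' => h (by rw [h'])
      simp [heis, this]

theorem Listed.centerLE_g3_1 (c : ℝ) (hc : c ≠ 0) : (Listed.g3_1 c hc).data.CenterLE :=
  (isOneOp_g3_1 c hc).centerLE (fun h => by simpa using congrFun (congrFun h 0) 0)
    (by simp only [codim]; omega)

theorem Listed.centerLE_g3_2 : Listed.g3_2.data.CenterLE :=
  isOneOp_g3_2.centerLE (fun h => by simpa using congrFun (congrFun h 0) 0)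
    (by simp only [codim]; omega)

theorem Listed.centerLE_g3_3 (φ : ℝ) (hφ : φ ∈ Set.Ioo 0 Real.pi) :
    (Listed.g3_3 φ hφ).data.CenterLE :=
  (isOneOp_g3_3 φ hφ).centerLE
    (fun h => (Real.sin_pos_of_mem_Ioo hφ).ne' (congrFun (congrFun h 1) 0))
    (by simp only [codim]; omega)

theorem Listed.centerLE_g4_1 : Listed.g4_1.data.CenterLE := by
  refine (isOneOp_g4_1).centerLE (fun h => by simpa using congrFun (congrFun h 0) 0) ?_
  intro i hi hi0
  simp only [codim] at hi ⊢
  obtain rfl : i = 1 := by omega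
  refine ⟨0, by omega, 1, fun _ v => by simp [Matrix.mulVec, dotProduct], ?_, by simp⟩
  intro i' hi' hne
  obtain rfl : i' = 0 := by omega
  simp

theorem Listed.centerLE_g4_2 : Listed.g4_2.data.CenterLE := by
  refine (isOneOp_g4_2).centerLE (fun h => by simpa using congrFun (congrFun h 0) 1) ?_
  intro i hi hi0
  simp only [codim] at hi ⊢
  obtain rfl : i = 1 := by omega
  refine ⟨0, by omega, 1, fun _ v => by simp [Matrix.mulVec, dotProduct], ?_, by simp⟩
  intro i' hi' hne
  obtain rfl : i' = 0 := by omega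
  simp

theorem Listed.centerLE_g4_3 (c : ℝ) : (Listed.g4_3 c).data.CenterLE := by
  refine (isTwoOp_g4_3 c).centerLE fun a b h => ?_
  have h0 := congrFun (congrFun h 0) 1
  have h1 := congrFun (congrFun h 0) 0
  exact ⟨by simpa using h0, by simpa using h1⟩

theorem Listed.centerLE_affC : Listed.affC.data.CenterLE := by
  refine (isTwoOp_affC).centerLE fun a b h => ?_
  have h0 := congrFun (congrFun h 0) 1
  have h1 := congrFun (congrFun h 0) 0
  exact ⟨by simpa using h0, by simpa using h1⟩

theorem Listed.centerLE_g5 (k : ℕ) : (Listed.g5 k).data.CenterLE := by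
  refine (isOneOp_g5 k).centerLE (fun h => by simpa using congrFun (congrFun h 1) 0) ?_
  intro i hi hi0
  simp only [codim] at hi ⊢
  -- The zero-based pairs are `(1, 2), (3, 4), …`, all with bracket `X_2`. Requiring `0 < j` avoids
  -- `X_3`, whose operator has a nonzero second row.
  obtain ⟨j, hj, hp⟩ : ∃ j : ℕ, j < 3 + 2 * k ∧ 0 < j ∧
      ((i % 2 = 1 ∧ j = i + 1) ∨ (i % 2 = 0 ∧ i = j + 1)) := by
    rcases Nat.mod_two_eq_zero_or_one i with h | h
    · exact ⟨i - 1, by omega, by omega, Or.inr (by omega)⟩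
    · exact ⟨i + 1, by omega, by omega, Or.inl (by omega)⟩
  refine ⟨j, hj, 1, by omega, ?_, ?_⟩
  · intro i' hi' hne
    simp only [Nat.even_iff]
    split_ifs <;> first | omega | simp
  · simp only [Nat.even_iff]
    split_ifs <;> first | omega | simp

theorem Listed.centerLE_g6_1 (k : ℕ) : (Listed.g6_1 k).data.CenterLE := by
  refine (isOneOp_g6_1 k).centerLE (fun h => by simpa using congrFun (congrFun h 0) 0) ?_
  intro i hi hi0
  simp only [codim] at hi ⊢
  -- The zero-based pairs are `(0, 1), (2, 3), …`; index `0` is allowed as a partner because the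
  -- second row of the operator vanishes.
  obtain ⟨j, hj, hp⟩ : ∃ j : ℕ, j < 4 + 2 * k ∧
      ((i % 2 = 0 ∧ j = i + 1) ∨ (i % 2 = 1 ∧ i = j + 1)) := by
    rcases Nat.mod_two_eq_zero_or_one i with h | h
    · exact ⟨i + 1, by omega, Or.inl (by omega)⟩
    · exact ⟨i - 1, by omega, Or.inr (by omega)⟩
  refine ⟨j, hj, 1, fun _ v => by simp [Matrix.mulVec, dotProduct], ?_, ?_⟩
  · intro i' hi' hne
    simp only [Nat.odd_iff]
    split_ifs <;> first | omega | simp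
  · simp only [Nat.odd_iff]
    split_ifs <;> first | omega | simp

theorem Listed.centerLE_g6_2 (k : ℕ) : (Listed.g6_2 k).data.CenterLE := by
  refine (isOneOp_g6_2 k).centerLE (fun h => by simpa using congrFun (congrFun h 1) 0) ?_
  intro i hi hi0
  simp only [codim] at hi ⊢
  -- `X_4` has a nonzero bracket only with `X_3`, and in coordinate `X_1`, where the operator has a
  -- zero row. The other generators pair off in coordinate `X_2`.
  by_cases hi1 : i = 1
  · subst hi1
    refine ⟨0, by omega, 0, fun _ v => by simp [Matrix.mulVec, dotProduct], ?_, ?_⟩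
    · intro i' hi' hne
      simp only [Nat.odd_iff]
      split_ifs <;> first | omega | simp
    · simp
  · obtain ⟨j, hj, hp⟩ : ∃ j : ℕ, j < 4 + 2 * k ∧ 1 < j ∧
        ((i % 2 = 0 ∧ j = i + 1) ∨ (i % 2 = 1 ∧ i = j + 1)) := by
      rcases Nat.mod_two_eq_zero_or_one i with h | h
      · exact ⟨i + 1, by omega, by omega, Or.inl (by omega)⟩
      · exact ⟨i - 1, by omega, by omega, Or.inr (by omega)⟩
    refine ⟨j, hj, 1, by omega, ?_, ?_⟩
    · intro i' hi' hne
      simp only [Nat.odd_iff]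
      split_ifs <;> first | omega | simp
    · simp only [Nat.odd_iff]
      split_ifs <;> first | omega | simp

/-! ### Recognizing an algebra from generators and relations -/

section Realization

variable {G : Type*} [LieRing G] [LieAlgebra ℝ G]

/-- The bilinear form `(x, y) ↦ ψ [x, y]`. -/
def bracketForm (ψ : G →ₗ[ℝ] ℝ) : G →ₗ[ℝ] G →ₗ[ℝ] ℝ :=
  LinearMap.mk₂ ℝ (fun x y => ψ ⁅x, y⁆) (by simp) (by simp) (by simp) (by simp)

theorem bracketForm_apply (ψ : G →ₗ[ℝ] ℝ) (x y : G) : bracketForm ψ x y = ψ ⁅x, y⁆ := rfl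

theorem bracketForm_self (ψ : G →ₗ[ℝ] ℝ) (x : G) : bracketForm ψ x x = 0 := by
  rw [bracketForm_apply, lie_self, map_zero]

theorem exists_functional {E : Type*} [AddCommGroup E] [Module ℝ E] {p : Submodule ℝ E} {v : E}
    (hv : v ∉ p) : ∃ ψ : E →ₗ[ℝ] ℝ, ψ v = 1 ∧ ∀ x ∈ p, ψ x = 0 := by
  obtain ⟨f, hf, hp⟩ := Submodule.exists_le_ker_of_notMem hv
  refine ⟨(f v)⁻¹ • f, ?_, ?_⟩
  · simp [hf]
  · intro x hx
    have : f x = 0 := hp hx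
    simp [this]

theorem nonempty_equiv {κ ι : Type} [Fintype κ] [Fintype ι] {D : LieData κ ι} (hD : D.CenterLE)
    (v : κ → G) (x : ι → G) (hvv : ∀ k l, ⁅v k, v l⁆ = 0)
    (hxv : ∀ i k, ⁅x i, v k⁆ = ∑ l, D.A i l k • v l)
    (hxx : ∀ i j, ⁅x i, x j⁆ = ∑ k, D.B i j k • v k) (hv : LinearIndependent ℝ v)
    (h : ∀ g, g ∈ Submodule.span ℝ (Set.range v) ⊔ Submodule.span ℝ (Set.range x)) :
    Nonempty (D.Carrier ≃ₗ⁅ℝ⁆ G) := by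
  obtain ⟨φ, hφ⟩ := D.exists_hom v x hvv hxv hxx
  exact ⟨LieEquiv.ofBijective φ
    ⟨LieData.injective_of_centerLE hD hφ hv, LieData.surjective_of_forall hφ h⟩⟩

/-- The sequence `X` is numbered from `1` as in the list; only its values at `1, …, m + 2` matter.
-/
theorem LieData.IsOneOp.nonempty_equiv {m : ℕ} {D : LieData (Fin 2) (Fin m)}
    {M : Matrix (Fin 2) (Fin 2) ℝ} {u : ℕ → ℕ → Fin 2 → ℝ} (hD : D.IsOneOp M u)
    (hDc : D.CenterLE) (X : ℕ → G) (h12 : ⁅X 1, X 2⁆ = 0)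
    (hX : LinearIndependent ℝ ![X 1, X 2])
    (h31 : ⁅X 3, X 1⁆ = M 0 0 • X 1 + M 1 0 • X 2)
    (h32 : ⁅X 3, X 2⁆ = M 0 1 • X 1 + M 1 1 • X 2)
    (hp : ∀ p, 4 ≤ p → p < m + 3 → ⁅X p, X 1⁆ = 0 ∧ ⁅X p, X 2⁆ = 0)
    (hpq : ∀ p q, 3 ≤ p → p < q → q < m + 3 → ⁅X p, X q⁆ = u p q 0 • X 1 + u p q 1 • X 2)
    (hu : ∀ p q, q ≤ p → u p q = 0)
    (hspan : ∀ g, g ∈ Submodule.span ℝ (X '' {p | 1 ≤ p ∧ p < m + 3})) :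
    Nonempty (D.Carrier ≃ₗ⁅ℝ⁆ G) := by
  refine _root_.nonempty_equiv hDc ![X 1, X 2] (fun i => X (i + 3)) ?_ ?_ ?_ hX ?_
  · intro k l
    have h21 : ⁅X 2, X 1⁆ = 0 := by rw [← lie_skew, h12, neg_zero]
    fin_cases k <;> fin_cases l <;> simp [h12, h21]
  · intro i k
    rw [hD.A_eq, Fin.sum_univ_two]
    by_cases hi : (i : ℕ) = 0
    · rw [hi]
      fin_cases k
      · simpa using h31
      · simpa using h32
    · have := hp (i + 3) (by omega) (by have := i.2; omega)
      rw [if_neg (by omega)]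
      fin_cases k
      · simpa using this.1
      · simpa using this.2
  · intro i j
    rw [hD.B_eq, Fin.sum_univ_two]
    rcases lt_trichotomy (i : ℕ) j with h | h | h
    · rw [hu (j + 3) (i + 3) (by omega), sub_zero]
      exact hpq _ _ (by omega) (by omega) (by have := j.2; omega)
    · rw [h]; simp
    · rw [hu (i + 3) (j + 3) (by omega), zero_sub, ← lie_skew,
        hpq (j + 3) (i + 3) (by omega) (by omega) (by have := i.2; omega)]
      simp only [Pi.neg_apply, Matrix.cons_val_zero, Matrix.cons_val_one]
      module
  · intro g
    refine (Submodule.span_le.2 ?_ : _ ≤ _) (hspan g)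
    rintro _ ⟨p, ⟨hp1, hp2⟩, rfl⟩
    rcases Nat.lt_or_ge p 3 with h | h
    · refine Submodule.mem_sup_left (Submodule.subset_span ?_)
      rcases (by omega : p = 1 ∨ p = 2) with rfl | rfl
      · exact ⟨0, rfl⟩
      · exact ⟨1, rfl⟩
    · refine Submodule.mem_sup_right (Submodule.subset_span ⟨⟨p - 3, by omega⟩, ?_⟩)
      change X (p - 3 + 3) = X p
      congr 1; omega

theorem LieData.IsTwoOp.nonempty_equiv {D : LieData (Fin 2) (Fin 2)}
    {P Q : Matrix (Fin 2) (Fin 2) ℝ} (hD : D.IsTwoOp P Q)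
    (hDc : D.CenterLE) {X₁ X₂ X₃ X₄ : G} (h12 : ⁅X₁, X₂⁆ = 0)
    (hX : LinearIndependent ℝ ![X₁, X₂])
    (h31 : ⁅X₃, X₁⁆ = P 0 0 • X₁ + P 1 0 • X₂) (h32 : ⁅X₃, X₂⁆ = P 0 1 • X₁ + P 1 1 • X₂)
    (h41 : ⁅X₄, X₁⁆ = Q 0 0 • X₁ + Q 1 0 • X₂) (h42 : ⁅X₄, X₂⁆ = Q 0 1 • X₁ + Q 1 1 • X₂)
    (h34 : ⁅X₃, X₄⁆ = 0) (hspan : ∀ g, g ∈ Submodule.span ℝ {X₁, X₂, X₃, X₄}) :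
    Nonempty (D.Carrier ≃ₗ⁅ℝ⁆ G) := by
  refine _root_.nonempty_equiv hDc ![X₁, X₂] ![X₃, X₄] ?_ ?_ ?_ hX ?_
  · intro k l
    have h21 : ⁅X₂, X₁⁆ = 0 := by rw [← lie_skew, h12, neg_zero]
    fin_cases k <;> fin_cases l <;> simp [h12, h21]
  · intro i k
    rw [Fin.sum_univ_two]
    fin_cases i
    · change _ = D.A 0 _ _ • _ + D.A 0 _ _ • _
      rw [hD.A_zero]
      fin_cases k
      · simpa using h31
      · simpa using h32
    · change _ = D.A 1 _ _ • _ + D.A 1 _ _ • _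
      rw [hD.A_one]
      fin_cases k
      · simpa using h41
      · simpa using h42
  · intro i j
    have h43 : ⁅X₄, X₃⁆ = 0 := by rw [← lie_skew, h34, neg_zero]
    rw [hD.B_eq]
    fin_cases i <;> fin_cases j <;> simp [h34, h43]
  · intro g
    refine (Submodule.span_le.2 ?_ : _ ≤ _) (hspan g)
    rintro _ (rfl | rfl | rfl | rfl)
    · exact Submodule.mem_sup_left (Submodule.subset_span ⟨0, rfl⟩)
    · exact Submodule.mem_sup_left (Submodule.subset_span ⟨1, rfl⟩)
    · exact Submodule.mem_sup_right (Submodule.subset_span ⟨0, rfl⟩)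
    · exact Submodule.mem_sup_right (Submodule.subset_span ⟨1, rfl⟩)

end Realization

/-! ### Algebras with one-dimensional derived algebra -/

section OneDimensionalDerived

variable {G : Type*} [LieRing G] [LieAlgebra ℝ G]

/-- Modulo `z` and `x` every element can be made to commute with both. Two such elements commute:
their bracket is a multiple of `z` killed by `ad x`, while `⁅x, z⁆ = z`. So such an element is
central and lies on the line of `z`. -/
theorem nonempty_equiv_affR (hZ : CentralInDerived G) {x z : G} (hz0 : z ≠ 0)
    (hz : ∀ v ∈ derSpan G, ∃ c : ℝ, c • z = v) (hxz : ⁅x, z⁆ = z) :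
    Nonempty (affR.Carrier ≃ₗ⁅ℝ⁆ G) := by
  have hred : ∀ g, ∃ a b : ℝ, ⁅x, g - a • z - b • x⁆ = 0 ∧ ⁅g - a • z - b • x, z⁆ = 0 := by
    intro g
    obtain ⟨a, ha⟩ := hz _ (lie_mem_derSpan x g)
    obtain ⟨b, hb⟩ := hz _ (lie_mem_derSpan g z)
    refine ⟨a, b, ?_, ?_⟩
    · simp [← ha, hxz]
    · simp [← hb, hxz]
  have hc : ∀ g, ⁅x, g⁆ = 0 → ⁅g, z⁆ = 0 → g ∈ derSpan G := by
    intro g hxg hgz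
    apply hZ
    intro h
    obtain ⟨a, b, h1, h2⟩ := hred h
    set h' := h - a • z - b • x with hh'
    obtain ⟨c, hc⟩ := hz _ (lie_mem_derSpan h' g)
    have h3 : ⁅x, ⁅h', g⁆⁆ = 0 := by rw [leibniz_lie, h1, hxg, zero_lie, lie_zero, add_zero]
    rw [← hc, lie_smul, hxz] at h3
    have h4 : ⁅h', g⁆ = 0 := by rw [← hc, h3]
    have : h = h' + a • z + b • x := by rw [hh']; abel
    rw [this, add_lie, add_lie, h4, smul_lie, smul_lie, hxg, ← lie_skew, hgz]
    simp
  refine nonempty_equiv affR_centerLE (fun _ => z) (fun _ => x) (by simp) ?_ ?_ ?_ ?_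
  · intro i k
    simp [affR, hxz, Subsingleton.elim k 0]
  · intro i j
    simp [affR]
  · exact LinearIndependent.of_subsingleton 0 hz0
  · intro g
    obtain ⟨a, b, h1, h2⟩ := hred g
    obtain ⟨c, hcz⟩ := hz _ (hc _ h1 h2)
    have : g = (c + a) • z + b • x := by
      rw [add_smul, hcz]; abel
    rw [this]
    exact Submodule.add_mem_sup (Submodule.smul_mem _ _ (Submodule.subset_span ⟨0, rfl⟩))
      (Submodule.smul_mem _ _ (Submodule.subset_span ⟨0, rfl⟩))

/-- The bracket is `β x y • z` for an alternating form `β`. Beyond a maximal hyperbolic family only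
the radical remains; it is central, hence on the line of `z`. An empty family would make the bracket
zero. -/
theorem exists_equiv_heis [FiniteDimensional ℝ G] (hZ : CentralInDerived G) {z : G} (hz0 : z ≠ 0)
    (hzd : z ∈ derSpan G) (hz : ∀ v ∈ derSpan G, ∃ c : ℝ, c • z = v)
    (hnil : ∀ x : G, ⁅x, z⁆ = 0) :
    ∃ m, 1 ≤ m ∧ Nonempty ((heis m).Carrier ≃ₗ⁅ℝ⁆ G) := by
  obtain ⟨ψ, hψ, -⟩ := exists_functional (p := ⊥) (v := z) hz0
  have hb : ∀ x y : G, ⁅x, y⁆ = bracketForm ψ x y • z := by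
    intro x y
    obtain ⟨c, hc⟩ := hz _ (lie_mem_derSpan x y)
    rw [bracketForm_apply, ← hc, map_smul, hψ, smul_eq_mul, mul_one]
  obtain ⟨k, a, b, hf, hmax⟩ := exists_maximal_hyperbolicFamily (bracketForm_self ψ) ⊤
  have hortho : ∀ u, (∀ j < k, bracketForm ψ u (a j) = 0 ∧ bracketForm ψ u (b j) = 0) →
      ∃ c : ℝ, c • z = u := by
    intro u hu
    apply hz
    apply hZ
    intro g
    rw [← lie_skew, hb, hmax u trivial hu g trivial, zero_smul, neg_zero]
  refine ⟨k, ?_, nonempty_equiv (heis_centerLE k) (fun _ => z)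
    (Sum.elim (fun i => a i) (fun i => b i)) (by simp) ?_ ?_ ?_ ?_⟩
  · by_contra hk
    obtain rfl : k = 0 := by omega
    apply hz0
    have : derSpan G ≤ ⊥ := by
      refine Submodule.span_le.2 ?_
      rintro _ ⟨x, y, rfl⟩
      rw [hb, hmax x trivial (by simp) y trivial, zero_smul]
      exact zero_mem _
    exact this hzd
  · intro i k
    simp [heis, hnil]
  · rintro (i | i) (j | j)
    · simp [heis, hb, hf.left_left i i.2 j j.2]
    · simp only [heis, Sum.elim_inl, Sum.elim_inr, hb, hf.left_right i i.2 j j.2, Fin.val_inj]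
      split_ifs <;> simp
    · simp only [heis, Sum.elim_inl, Sum.elim_inr, hb, hf.right_left (bracketForm_self ψ) i i.2 j j.2,
        Fin.val_inj]
      split_ifs <;> simp
    · simp [heis, hb, hf.right_right i i.2 j j.2]
  · exact LinearIndependent.of_subsingleton 0 hz0
  · intro g
    obtain ⟨s, hs, hso⟩ := hf.exists_orthogonal (bracketForm_self ψ) g
    obtain ⟨c, hc⟩ := hortho _ hso
    have : g = c • z + s := by rw [hc]; abel
    rw [this]
    refine Submodule.add_mem_sup (Submodule.smul_mem _ _ (Submodule.subset_span ⟨0, rfl⟩)) ?_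
    refine hypSpan_le (fun i hi => ?_) (fun i hi => ?_) hs
    · exact Submodule.subset_span ⟨Sum.inl ⟨i, hi⟩, rfl⟩
    · exact Submodule.subset_span ⟨Sum.inr ⟨i, hi⟩, rfl⟩

/-- The alternatives are whether some `x` scales the derived line nontrivially or none does. The
vanishing of triple brackets later rules out a sum of two Heisenberg algebras. -/
theorem equiv_affR_or_heis [FiniteDimensional ℝ G] (hd : Module.finrank ℝ (derSpan G) = 1)
    (hZ : CentralInDerived G) :
    Nonempty (affR.Carrier ≃ₗ⁅ℝ⁆ G) ∨
      (∃ m, 1 ≤ m ∧ Nonempty ((heis m).Carrier ≃ₗ⁅ℝ⁆ G)) ∧ ∀ x y z : G, ⁅x, ⁅y, z⁆⁆ = 0 := by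
  obtain ⟨⟨z, hzd⟩, hz0, hz⟩ := finrank_eq_one_iff'.1 hd
  have hz0' : z ≠ 0 := fun h => hz0 (Subtype.ext h)
  have hz' : ∀ v ∈ derSpan G, ∃ c : ℝ, c • z = v := by
    intro v hv
    obtain ⟨c, hc⟩ := hz ⟨v, hv⟩
    exact ⟨c, congrArg Subtype.val hc⟩
  by_cases h : ∀ x : G, ⁅x, z⁆ = 0
  · refine Or.inr ⟨exists_equiv_heis hZ hz0' hzd hz' h, ?_⟩
    intro x y w
    obtain ⟨c, hc⟩ := hz' _ (lie_mem_derSpan y w)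
    rw [← hc, lie_smul, h, smul_zero]
  · push Not at h
    obtain ⟨x, hx⟩ := h
    obtain ⟨c, hc⟩ := hz' _ (lie_mem_derSpan x z)
    have hc0 : c ≠ 0 := by
      rintro rfl
      exact hx (by rw [← hc, zero_smul])
    refine Or.inl (nonempty_equiv_affR hZ (x := c⁻¹ • x) hz0' hz' ?_)
    rw [smul_lie, ← hc, smul_smul, inv_mul_cancel₀ hc0, one_smul]

end OneDimensionalDerived

/-! ### Listing hyperbolic pairs consecutively -/

section TailSequence

variable {E : Type*}

/-- The sequence `f 0, …, f (N - 1), a 0, b 0, a 1, b 1, …`. -/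
def tailSeq (N : ℕ) (f a b : ℕ → E) (p : ℕ) : E :=
  if p < N then f p else if (p - N) % 2 = 0 then a ((p - N) / 2) else b ((p - N) / 2)

theorem tailSeq_even (N : ℕ) (f a b : ℕ → E) (i : ℕ) : tailSeq N f a b (N + 2 * i) = a i := by
  rw [tailSeq, if_neg (by omega), if_pos (by omega)]
  congr 1; omega

theorem tailSeq_odd (N : ℕ) (f a b : ℕ → E) (i : ℕ) : tailSeq N f a b (N + 2 * i + 1) = b i := by
  rw [tailSeq, if_neg (by omega), if_neg (by omega)]
  congr 1; omega

variable [AddCommGroup E] [Module ℝ E]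

theorem exists_tail_index {N k p : ℕ} (h1 : N ≤ p) (h2 : p < N + 2 * k) :
    ∃ i < k, p = N + 2 * i ∨ p = N + 2 * i + 1 :=
  ⟨(p - N) / 2, by omega, by omega⟩

theorem tailSeq_mem_hypSpan {N k : ℕ} {f a b : ℕ → E} {p : ℕ} (h1 : N ≤ p) (h2 : p < N + 2 * k) :
    tailSeq N f a b p ∈ hypSpan k a b := by
  obtain ⟨i, hi, rfl | rfl⟩ := exists_tail_index h1 h2
  · rw [tailSeq_even]; exact left_mem_hypSpan hi
  · rw [tailSeq_odd]; exact right_mem_hypSpan hi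

theorem hypSpan_le_tailSeq {N k M : ℕ} {f a b : ℕ → E} (hN : 1 ≤ N) (hM : N + 2 * k ≤ M) :
    hypSpan k a b ≤ Submodule.span ℝ (tailSeq N f a b '' {p | 1 ≤ p ∧ p < M}) := by
  refine hypSpan_le (fun i hi => ?_) (fun i hi => ?_)
  · exact Submodule.subset_span ⟨N + 2 * i, ⟨by omega, by omega⟩, tailSeq_even _ _ _ _ _⟩
  · exact Submodule.subset_span ⟨N + 2 * i + 1, ⟨by omega, by omega⟩, tailSeq_odd _ _ _ _ _⟩

/-- Positions of the parity of `N` carry the `a i`, each followed by its partner `b i`. -/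
theorem IsHyperbolicFamily.tailSeq_form {β : E →ₗ[ℝ] E →ₗ[ℝ] ℝ} (hβ : ∀ x, β x x = 0)
    {C : Submodule ℝ E} {k : ℕ} {a b : ℕ → E} (h : IsHyperbolicFamily β C k a b) {N : ℕ}
    {f : ℕ → E} {p q : ℕ} (hp : N ≤ p) (hpq : p < q) (hq : q < N + 2 * k) :
    β (tailSeq N f a b p) (tailSeq N f a b q) =
      if p % 2 = N % 2 ∧ q = p + 1 then 1 else 0 := by
  obtain ⟨i, hi, rfl | rfl⟩ := exists_tail_index hp (hpq.trans hq) <;>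
  obtain ⟨j, hj, rfl | rfl⟩ := exists_tail_index (hp.trans hpq.le) hq
  · rw [tailSeq_even, tailSeq_even, h.left_left i hi j hj, if_neg (by omega)]
  · rw [tailSeq_even, tailSeq_odd, h.left_right i hi j hj]
    split_ifs <;> first | rfl | omega
  · rw [tailSeq_odd, tailSeq_even, h.right_left hβ i hi j hj, if_neg (by omega), if_neg (by omega)]
  · rw [tailSeq_odd, tailSeq_odd, h.right_right i hi j hj, if_neg (by omega)]

end TailSequence

/-! ### Algebras whose operators on the derived ideal are multiples of one rank-one operator -/

section RankOne

variable {G : Type*} [LieRing G] [LieAlgebra ℝ G]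

/-- The centralizer of the derived algebra. -/
def derCentralizer (G : Type*) [LieRing G] [LieAlgebra ℝ G] : Submodule ℝ G where
  carrier := {c | ∀ v ∈ derSpan G, ⁅c, v⁆ = 0}
  add_mem' := fun {a b} ha hb v hv => by rw [add_lie, ha v hv, hb v hv, add_zero]
  zero_mem' := fun v _ => zero_lie v
  smul_mem' := fun c x hx v hv => by rw [smul_lie, hx v hv, smul_zero]

theorem derSpan_le_derCentralizer (hd : Module.finrank ℝ (derSpan G) = 2) :
    derSpan G ≤ derCentralizer G :=
  fun _ hu _ hv => lie_eq_zero_of_mem_derSpan hd hu hv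

/-- By Jacobi, since `c` and `c'` kill all brackets. When `ad x` has rank one on the derived plane,
brackets inside the centralizer therefore lie on a line and reduce to a scalar form. -/
theorem lie_lie_eq_zero_of_mem_derCentralizer {x c c' : G} (hc : c ∈ derCentralizer G)
    (hc' : c' ∈ derCentralizer G) : ⁅x, ⁅c, c'⁆⁆ = 0 := by
  rw [leibniz_lie, ← lie_skew, hc' _ (lie_mem_derSpan _ _), hc _ (lie_mem_derSpan _ _)]
  simp

/-- Elements acting diagonalizably with rank one on a plane. -/
theorem equiv_g4_1_or_g6_1 [FiniteDimensional ℝ G] (hd : Module.finrank ℝ (derSpan G) = 2)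
    (hZ : CentralInDerived G) (hI : ¬ IsDecomposable G) {x X₁ X₂ : G} (hX₁ : X₁ ∈ derSpan G)
    (hX₂ : X₂ ∈ derSpan G) (hli : LinearIndependent ℝ ![X₁, X₂]) (hx₁ : ⁅x, X₁⁆ = X₁)
    (hx₂ : ⁅x, X₂⁆ = 0) (hq : ∀ g, ∃ q : ℝ, g - q • x ∈ derCentralizer G) :
    Nonempty (Listed.g4_1.Alg ≃ₗ⁅ℝ⁆ G) ∨ ∃ k, Nonempty ((Listed.g6_1 k).Alg ≃ₗ⁅ℝ⁆ G) := by
  have hX₁0 : X₁ ≠ 0 := hli.ne_zero 0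
  have hX₂0 : X₂ ≠ 0 := hli.ne_zero 1
  have hV : ∀ v ∈ derSpan G, ∃ a b : ℝ, v = a • X₁ + b • X₂ :=
    fun v hv => exists_eq_of_mem hd hX₁ hX₂ hli hv
  obtain ⟨ψ, hψ, -⟩ := exists_functional (p := ⊥) (v := X₂) hX₂0
  have hker : ∀ w ∈ derSpan G, ⁅x, w⁆ = 0 → w = ψ w • X₂ := by
    intro w hw h
    obtain ⟨a, b, rfl⟩ := hV w hw
    rw [lie_add, lie_smul, lie_smul, hx₁, hx₂, smul_zero, add_zero] at h
    rw [h]; simp [hψ]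
  have hspanX₂ : ∀ w ∈ Submodule.span ℝ {X₂}, w = ψ w • X₂ := by
    intro w hw
    obtain ⟨c, rfl⟩ := Submodule.mem_span_singleton.1 hw
    simp [hψ]
  let β := bracketForm ψ
  have hβ : ∀ u, β u u = 0 := bracketForm_self ψ
  have hCC : ∀ c ∈ derCentralizer G, ∀ c' ∈ derCentralizer G, ⁅c, c'⁆ = β c c' • X₂ :=
    fun c hc c' hc' => hker _ (lie_mem_derSpan _ _) (lie_lie_eq_zero_of_mem_derCentralizer hc hc')
  -- As `⁅x, X₁⁆ = X₁`, subtracting a multiple of `X₁` moves any element of the centralizer into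
  -- `C'`. Brackets within `C'`, and of `x` with `C'`, are multiples of `X₂`.
  let C' : Submodule ℝ G :=
    derCentralizer G ⊓ (Submodule.span ℝ {X₂}).comap (LieAlgebra.ad ℝ G x : G →ₗ[ℝ] G)
  have hC' : ∀ c, c ∈ C' ↔ c ∈ derCentralizer G ∧ ⁅x, c⁆ ∈ Submodule.span ℝ {X₂} :=
    fun c => Iff.rfl
  have hVC := derSpan_le_derCentralizer hd
  have hX₂C' : X₂ ∈ C' := (hC' _).2 ⟨hVC hX₂, by rw [hx₂]; exact zero_mem _⟩
  have hxC' : ∀ c ∈ C', ⁅x, c⁆ = β x c • X₂ := fun c hc => hspanX₂ _ hc.2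
  have hC'C' : ∀ c ∈ C', ∀ c' ∈ C', ⁅c, c'⁆ = β c c' • X₂ :=
    fun c hc c' hc' => hCC c hc.1 c' hc'.1
  obtain ⟨k, a, b, hf, hmax⟩ := exists_maximal_hyperbolicFamily hβ C'
  -- Removing `s` makes `X₃` orthogonal to the family without changing its action on the derived
  -- plane.
  obtain ⟨s, hs, hso⟩ := hf.exists_orthogonal hβ x
  have hsC' : s ∈ C' := hf.hypSpan_le hs
  set X₃ := x - s with hX₃
  have hX₃C' : ∀ c ∈ C', ⁅X₃, c⁆ = β X₃ c • X₂ := by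
    intro c hc
    rw [hX₃, sub_lie, hxC' c hc, hC'C' s hsC' c hc, map_sub, LinearMap.sub_apply, sub_smul]
  have hX₃V : ∀ v ∈ derSpan G, ⁅X₃, v⁆ = ⁅x, v⁆ := by
    intro v hv
    rw [hX₃, sub_lie, hsC'.1 v hv, sub_zero]
  have hdec : ∀ g, ∃ q α : ℝ, g - q • X₃ - α • X₁ ∈ C' := by
    intro g
    obtain ⟨q, hqg⟩ := hq g
    have h1 : g - q • X₃ ∈ derCentralizer G := by
      have : g - q • X₃ = g - q • x + q • s := by rw [hX₃]; module
      rw [this]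
      exact add_mem hqg (Submodule.smul_mem _ _ hsC'.1)
    obtain ⟨α, γ, h2⟩ := hV _ (lie_mem_derSpan x (g - q • X₃))
    refine ⟨q, α, (hC' _).2 ⟨sub_mem h1 (Submodule.smul_mem _ _ (hVC hX₁)), ?_⟩⟩
    rw [lie_sub, h2, lie_smul, hx₁, add_sub_cancel_left]
    exact Submodule.smul_mem _ _ (Submodule.mem_span_singleton_self _)
  have hX₁C : ∀ c ∈ derCentralizer G, ⁅X₁, c⁆ = 0 := by
    intro c hc
    rw [← lie_skew, hc _ hX₁, neg_zero]
  have hX₃X₁ : ⁅X₃, X₁⁆ = X₁ := by rw [hX₃V _ hX₁, hx₁]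
  have hX₃X₂ : ⁅X₃, X₂⁆ = 0 := by rw [hX₃V _ hX₂, hx₂]
  -- A radical vector of `β` on `C'` pairing with `X₃` becomes its partner `X₄`. If there is none,
  -- `X₃` commutes with `C'`, and the copy `span {X₁, X₃}` of `aff(ℝ)` splits off.
  by_cases hr : ∃ r ∈ C', (∀ j < k, β r (a j) = 0 ∧ β r (b j) = 0) ∧ β X₃ r ≠ 0
  · obtain ⟨r, hrC, hro, hr0⟩ := hr
    set X₄ := (β X₃ r)⁻¹ • r with hX₄
    have hX₄C : X₄ ∈ C' := C'.smul_mem _ hrC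
    have hX₃X₄ : β X₃ X₄ = 1 := by
      rw [hX₄, map_smul, smul_eq_mul, inv_mul_cancel₀ hr0]
    have hX₄o : ∀ c ∈ C', β X₄ c = 0 := by
      intro c hc
      rw [hX₄, map_smul, LinearMap.smul_apply, hmax r hrC hro c hc, smul_zero]
    let X := tailSeq 5 (fun p => if p = 1 then X₁ else if p = 2 then X₂ else
      if p = 3 then X₃ else X₄) a b
    have e1 : X 1 = X₁ := rfl
    have e2 : X 2 = X₂ := rfl
    have e3 : X 3 = X₃ := rfl
    have e4 : X 4 = X₄ := rfl
    have htail : ∀ p, 5 ≤ p → p < 5 + 2 * k → X p ∈ hypSpan k a b :=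
      fun p h1 h2 => tailSeq_mem_hypSpan h1 h2
    have hpC : ∀ p, 4 ≤ p → p < 5 + 2 * k → X p ∈ C' := by
      intro p h1 h2
      rcases h1.eq_or_lt with rfl | h1
      · exact hX₄C
      · exact hf.hypSpan_le (htail p h1 h2)
    have hbr : ∀ p q, 3 ≤ p → p < q → q < 5 + 2 * k →
        ⁅X p, X q⁆ = (if p % 2 = 1 ∧ q = p + 1 then (1 : ℝ) else 0) • X₂ := by
      intro p q h1 h2 h3
      rcases h1.eq_or_lt with rfl | h1
      · rw [e3, hX₃C' _ (hpC q h2 h3)]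
        rcases Nat.lt_or_ge 4 q with h4 | h4
        · rw [IsHyperbolicFamily.eq_zero_of_mem_hypSpan hso (htail q h4 h3), if_neg (by omega)]
        · obtain rfl : q = 4 := by omega
          rw [e4, hX₃X₄, if_pos (by omega)]
      · rw [hC'C' _ (hpC p h1 (h2.trans h3)) _ (hpC q (by omega) h3)]
        rcases Nat.lt_or_ge 4 p with h4 | h4
        · exact congrArg (· • X₂) (hf.tailSeq_form hβ h4 h2 h3)
        · obtain rfl : p = 4 := by omega
          rw [e4, hX₄o _ (hpC q (by omega) h3), if_neg (by omega)]
    have hspan : ∀ g, g ∈ Submodule.span ℝ (X '' {p | 1 ≤ p ∧ p < 5 + 2 * k}) := by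
      intro g
      set S := Submodule.span ℝ (X '' {p | 1 ≤ p ∧ p < 5 + 2 * k})
      have m1 : X₁ ∈ S := Submodule.subset_span ⟨1, ⟨by omega, by omega⟩, e1⟩
      have m2 : X₂ ∈ S := Submodule.subset_span ⟨2, ⟨by omega, by omega⟩, e2⟩
      have m3 : X₃ ∈ S := Submodule.subset_span ⟨3, ⟨by omega, by omega⟩, e3⟩
      have m4 : X₄ ∈ S := Submodule.subset_span ⟨4, ⟨by omega, by omega⟩, e4⟩
      obtain ⟨q, α, hg⟩ := hdec g
      set c := g - q • X₃ - α • X₁ with hc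
      obtain ⟨s₁, hs₁, hs₁o⟩ := hf.exists_orthogonal hβ c
      have hs₁S : s₁ ∈ S := hypSpan_le_tailSeq (by omega) le_rfl hs₁
      have hc₁C : c - s₁ ∈ C' := sub_mem hg (hf.hypSpan_le hs₁)
      -- The remainder commutes with `X₃`, `X₁` and `C'`, so it is central and lies in the derived
      -- plane.
      set c₂ := c - s₁ - β X₃ (c - s₁) • X₄ with hc₂
      have hc₂C : c₂ ∈ C' := sub_mem hc₁C (C'.smul_mem _ hX₄C)
      have hc₂X₃ : ⁅X₃, c₂⁆ = 0 := by
        rw [hX₃C' _ hc₂C, hc₂, map_sub, map_smul, hX₃X₄, smul_eq_mul, mul_one, sub_self, zero_smul]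
      have hc₂C' : ∀ c' ∈ C', ⁅c', c₂⁆ = 0 := by
        intro c' hc'
        rw [← lie_skew, hC'C' _ hc₂C _ hc', hc₂, map_sub, LinearMap.sub_apply, map_smul,
          LinearMap.smul_apply, hX₄o c' hc', hmax _ hc₁C hs₁o c' hc']
        simp
      have hc₂V : c₂ ∈ derSpan G := by
        apply hZ
        intro g'
        obtain ⟨q', α', hg'⟩ := hdec g'
        have : g' = q' • X₃ + α' • X₁ + (g' - q' • X₃ - α' • X₁) := by abel
        rw [this, add_lie, add_lie, smul_lie, smul_lie, hc₂X₃, hX₁C _ hc₂C.1, hc₂C' _ hg']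
        simp
      obtain ⟨γ, δ, h5⟩ := hV _ hc₂V
      have hc₂S : c₂ ∈ S := by
        rw [h5]; exact add_mem (S.smul_mem _ m1) (S.smul_mem _ m2)
      have : g = c₂ + s₁ + β X₃ (c - s₁) • X₄ + q • X₃ + α • X₁ := by
        rw [hc₂, hc]; abel
      rw [this]
      exact add_mem (add_mem (add_mem (add_mem hc₂S hs₁S) (S.smul_mem _ m4)) (S.smul_mem _ m3))
        (S.smul_mem _ m1)
    have h12 : ⁅X 1, X 2⁆ = 0 := hX₁C _ (hVC hX₂)
    -- No hyperbolic pair besides `X₃, X₄` gives `g4_1`; `k + 1` further pairs give `g6_1 k`.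
    rcases k with _ | k
    · left
      refine Listed.isOneOp_g4_1.nonempty_equiv Listed.centerLE_g4_1 X h12 hli ?_ ?_ ?_ ?_ ?_ hspan
      · rw [e1, e2, e3, hX₃X₁]; simp
      · rw [e1, e2, e3, hX₃X₂]; simp
      · intro p h1 h2
        simp only [Listed.codim] at h2
        have := hpC p h1 (by omega)
        exact ⟨this.1 _ hX₁, this.1 _ hX₂⟩
      · intro p q h1 h2 h3
        simp only [Listed.codim] at h3
        rw [hbr p q h1 h2 (by omega), if_pos (by omega), if_pos (by omega)]
        simp [e1, e2]
      · intro p q h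
        rw [if_neg (by omega)]
    · right
      refine ⟨k, (Listed.isOneOp_g6_1 k).nonempty_equiv (Listed.centerLE_g6_1 k) X h12 hli
        ?_ ?_ ?_ ?_ ?_ ?_⟩
      · rw [e1, e2, e3, hX₃X₁]; simp
      · rw [e1, e2, e3, hX₃X₂]; simp
      · intro p h1 h2
        simp only [Listed.codim] at h2
        have := hpC p h1 (by omega)
        exact ⟨this.1 _ hX₁, this.1 _ hX₂⟩
      · intro p q h1 h2 h3
        simp only [Listed.codim] at h3
        rw [hbr p q h1 h2 (by omega)]
        simp only [Nat.odd_iff]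
        split_ifs <;> first | omega | simp [e1, e2]
      · intro p q h
        rw [if_neg (by omega)]
      · intro g
        have := hspan g
        simp only [Listed.codim]
        rwa [show 4 + 2 * k + 3 = 5 + 2 * (k + 1) by ring]
  · exfalso
    push Not at hr
    have hX₃0 : ∀ c ∈ C', ⁅X₃, c⁆ = 0 := by
      intro c hc
      obtain ⟨s₁, hs₁, hs₁o⟩ := hf.exists_orthogonal hβ c
      have h1 := hr _ (sub_mem hc (hf.hypSpan_le hs₁)) hs₁o
      rw [map_sub, IsHyperbolicFamily.eq_zero_of_mem_hypSpan hso hs₁, sub_zero] at h1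
      rw [hX₃C' c hc, h1, zero_smul]
    have hX₁X₃ : ⁅X₁, X₃⁆ = -X₁ := by rw [← lie_skew, hX₃X₁]
    refine hI (isDecomposable_of_isCompl (P := Submodule.span ℝ {X₁, X₃}) (Q := C') ?_ ?_ ?_ ?_ ?_)
    · intro g y hy
      obtain ⟨q, α, hg⟩ := hdec g
      have h0 : ∀ c ∈ C', ⁅c, X₁⁆ = 0 ∧ ⁅c, X₃⁆ = 0 := by
        intro c hc
        refine ⟨hc.1 _ hX₁, ?_⟩
        rw [← lie_skew, hX₃0 c hc, neg_zero]
      obtain ⟨γ, δ, rfl⟩ := Submodule.mem_span_pair.1 hy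
      have : g = q • X₃ + α • X₁ + (g - q • X₃ - α • X₁) := by abel
      rw [this]
      refine Submodule.mem_span_pair.2 ⟨q * γ - α * δ, 0, ?_⟩
      simp only [add_lie, lie_add, smul_lie, lie_smul, hX₃X₁, hX₁X₃, lie_self, (h0 _ hg).1,
        (h0 _ hg).2]
      module
    · intro g c hc
      obtain ⟨q, α, hg⟩ := hdec g
      have : g = q • X₃ + α • X₁ + (g - q • X₃ - α • X₁) := by abel
      rw [this, add_lie, add_lie, smul_lie, smul_lie, hX₃0 c hc, hX₁C c hc.1, hC'C' _ hg _ hc]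
      simpa using C'.smul_mem _ hX₂C'
    · constructor
      · rw [Submodule.disjoint_def]
        intro y hy hyC
        obtain ⟨γ, δ, rfl⟩ := Submodule.mem_span_pair.1 hy
        have h1 := hyC.1 _ hX₁
        simp only [add_lie, smul_lie, lie_self, hX₃X₁, smul_zero, zero_add] at h1
        have hδ : δ = 0 := (smul_eq_zero.1 h1).resolve_right hX₁0
        have h2 := hX₃0 _ hyC
        rw [hδ, zero_smul, add_zero, lie_smul, hX₃X₁] at h2
        rw [hδ, h2, zero_smul, add_zero]
      · rw [codisjoint_iff, eq_top_iff]
        intro g _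
        obtain ⟨q, α, hg⟩ := hdec g
        have : g = (α • X₁ + q • X₃) + (g - q • X₃ - α • X₁) := by abel
        rw [this]
        exact Submodule.add_mem_sup (Submodule.mem_span_pair.2 ⟨α, q, rfl⟩) hg
    · intro h
      have : X₁ ∈ Submodule.span ℝ {X₁, X₃} := Submodule.subset_span (by simp)
      rw [h] at this
      exact hX₁0 this
    · intro h
      rw [h] at hX₂C'
      exact hX₂0 hX₂C'

/-- Elements acting nilpotently with rank one on a plane. -/
theorem equiv_g4_2_or_g5_or_g6_2 [FiniteDimensional ℝ G]
    (hd : Module.finrank ℝ (derSpan G) = 2) (hZ : CentralInDerived G) {x e₁ e₂ : G}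
    (he₁ : e₁ ∈ derSpan G) (he₂ : e₂ ∈ derSpan G) (hli : LinearIndependent ℝ ![e₁, e₂])
    (hx₁ : ⁅x, e₁⁆ = e₂) (hx₂ : ⁅x, e₂⁆ = 0)
    (hq : ∀ g, ∃ q : ℝ, g - q • x ∈ derCentralizer G) :
    Nonempty (Listed.g4_2.Alg ≃ₗ⁅ℝ⁆ G) ∨ (∃ k, Nonempty ((Listed.g5 k).Alg ≃ₗ⁅ℝ⁆ G)) ∨
      ∃ k, Nonempty ((Listed.g6_2 k).Alg ≃ₗ⁅ℝ⁆ G) := by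
  have he₂0 : e₂ ≠ 0 := hli.ne_zero 1
  have hVC := derSpan_le_derCentralizer hd
  have hVe : ∀ v ∈ derSpan G, ∃ a b : ℝ, v = a • e₁ + b • e₂ :=
    fun v hv => exists_eq_of_mem hd he₁ he₂ hli hv
  have hkere : ∀ w ∈ derSpan G, ⁅x, w⁆ = 0 → w ∈ Submodule.span ℝ {e₂} := by
    intro w hw h
    obtain ⟨a, b, rfl⟩ := hVe w hw
    rw [lie_add, lie_smul, lie_smul, hx₁, hx₂, smul_zero, add_zero] at h
    rw [(smul_eq_zero.1 h).resolve_right he₂0, zero_smul, zero_add]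
    exact Submodule.smul_mem _ _ (Submodule.mem_span_singleton_self _)
  -- Otherwise every bracket would lie on the line of `e₂`: writing `g = q x + c` and `g' = q' x +
  -- c'`, the bracket combines `⁅x, c⁆`, `⁅x, c'⁆` and `⁅c, c'⁆`.
  obtain ⟨X₄', hX₄'C, hX₄'⟩ : ∃ c ∈ derCentralizer G, ⁅x, c⁆ ∉ Submodule.span ℝ {e₂} := by
    by_contra! hcon
    have hle : derSpan G ≤ Submodule.span ℝ {e₂} := by
      refine Submodule.span_le.2 ?_
      rintro _ ⟨g, g', rfl⟩
      obtain ⟨q, hg⟩ := hq g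
      obtain ⟨q', hg'⟩ := hq g'
      have h1 := hkere _ (lie_mem_derSpan _ _)
        (lie_lie_eq_zero_of_mem_derCentralizer (x := x) hg hg')
      have h2 := hcon _ hg
      have h3 := hcon _ hg'
      have : ⁅g, g'⁆ = q • ⁅x, g' - q' • x⁆ - q' • ⁅x, g - q • x⁆ +
          ⁅g - q • x, g' - q' • x⁆ := by
        simp only [lie_sub, sub_lie, lie_smul, smul_lie, lie_self]
        rw [← lie_skew x g]
        module
      rw [this]
      exact add_mem (sub_mem (Submodule.smul_mem _ _ h3) (Submodule.smul_mem _ _ h2)) h1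
    obtain ⟨c, hc⟩ := Submodule.mem_span_singleton.1 (hle he₁)
    have := pair_coeff_eq_zero hli (a := -1) (b := c) (by rw [hc]; module)
    norm_num at this
  -- The chain `X₄' ↦ X₁ ↦ X₂ ↦ 0` under `ad x` yields a basis of the derived plane adapted to the
  -- list.
  set X₁ := ⁅x, X₄'⁆ with hX₁def
  set X₂ := ⁅x, X₁⁆ with hX₂def
  have hX₁ : X₁ ∈ derSpan G := lie_mem_derSpan _ _
  have hX₂ : X₂ ∈ derSpan G := lie_mem_derSpan _ _
  have hxX₂ : ⁅x, X₂⁆ = 0 := by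
    obtain ⟨p, q, h⟩ := hVe _ hX₁
    rw [hX₂def, h]
    simp [hx₁, hx₂]
  have hX₂0 : X₂ ≠ 0 := fun h => hX₄' (hkere _ hX₁ h)
  have hliX : LinearIndependent ℝ ![X₁, X₂] := by
    rw [LinearIndependent.pair_iff]
    intro s t hst
    have h1 : ⁅x, s • X₁ + t • X₂⁆ = 0 := by rw [hst, lie_zero]
    rw [lie_add, lie_smul, lie_smul, hxX₂, smul_zero, add_zero] at h1
    have hs : s = 0 := (smul_eq_zero.1 h1).resolve_right hX₂0
    rw [hs, zero_smul, zero_add] at hst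
    exact ⟨hs, (smul_eq_zero.1 hst).resolve_right hX₂0⟩
  have hV : ∀ v ∈ derSpan G, ∃ a b : ℝ, v = a • X₁ + b • X₂ :=
    fun v hv => exists_eq_of_mem hd hX₁ hX₂ hliX hv
  obtain ⟨ψ, hψ, -⟩ := exists_functional (p := ⊥) (v := X₂) hX₂0
  have hker : ∀ w ∈ derSpan G, ⁅x, w⁆ = 0 → w = ψ w • X₂ := by
    intro w hw h
    obtain ⟨a, b, rfl⟩ := hV w hw
    rw [lie_add, lie_smul, lie_smul, hxX₂, smul_zero, add_zero] at h
    rw [(smul_eq_zero.1 h).resolve_right hX₂0]; simp [hψ]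
  let β := bracketForm ψ
  have hβ : ∀ u, β u u = 0 := bracketForm_self ψ
  have hCC : ∀ c ∈ derCentralizer G, ∀ c' ∈ derCentralizer G, ⁅c, c'⁆ = β c c' • X₂ :=
    fun c hc c' hc' => hker _ (lie_mem_derSpan _ _) (lie_lie_eq_zero_of_mem_derCentralizer hc hc')
  -- `ad x` sends `X₄'` and `X₁` to the basis `X₁`, `X₂` of the derived plane, so multiples of these
  -- two correct any element of the centralizer into `C₀`. As `s` below commutes with `x`, passing
  -- from `X₄'` to `X₄` keeps `X₁`.
  let C₀ : Submodule ℝ G :=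
    derCentralizer G ⊓ LinearMap.ker (LieAlgebra.ad ℝ G x : G →ₗ[ℝ] G)
  have hxC₀ : ∀ c ∈ C₀, ⁅x, c⁆ = 0 := fun c hc => hc.2
  obtain ⟨k, a, b, hf, hmax⟩ := exists_maximal_hyperbolicFamily hβ C₀
  obtain ⟨s, hs, hso⟩ := hf.exists_orthogonal hβ X₄'
  have hsC₀ : s ∈ C₀ := hf.hypSpan_le hs
  set X₄ := X₄' - s with hX₄
  have hX₄C : X₄ ∈ derCentralizer G := sub_mem hX₄'C hsC₀.1
  have hxX₄ : ⁅x, X₄⁆ = X₁ := by rw [hX₄, lie_sub, hxC₀ s hsC₀, sub_zero]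
  have hX₁C : ∀ c ∈ derCentralizer G, ⁅X₁, c⁆ = 0 := by
    intro c hc
    rw [← lie_skew, hc _ hX₁, neg_zero]
  have hdec : ∀ g, ∃ q α γ : ℝ, g - q • x - α • X₄ - γ • X₁ ∈ C₀ := by
    intro g
    obtain ⟨q, hqg⟩ := hq g
    obtain ⟨α, γ, h2⟩ := hV _ (lie_mem_derSpan x (g - q • x))
    refine ⟨q, α, γ, sub_mem (sub_mem hqg (Submodule.smul_mem _ _ hX₄C))
      (Submodule.smul_mem _ _ (hVC hX₁)), ?_⟩
    change ⁅x, g - q • x - α • X₄ - γ • X₁⁆ = 0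
    rw [lie_sub, lie_sub, h2, lie_smul, lie_smul, hxX₄, ← hX₂def]
    abel
  have hcentral : ∀ c ∈ C₀, β X₄ c = 0 → (∀ c' ∈ C₀, β c c' = 0) →
      ∃ γ δ : ℝ, c = γ • X₁ + δ • X₂ := by
    intro c hc hc4 hc'
    apply hV
    apply hZ
    intro g'
    obtain ⟨q', α', γ', hg'⟩ := hdec g'
    have : g' = q' • x + α' • X₄ + γ' • X₁ + (g' - q' • x - α' • X₄ - γ' • X₁) := by abel
    rw [this, add_lie, add_lie, add_lie, smul_lie, smul_lie, smul_lie, hxC₀ c hc,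
      hCC _ hX₄C _ hc.1, hc4, hX₁C _ hc.1, ← lie_skew _ c, hCC _ hc.1 _ hg'.1, hc' _ hg']
    simp
  -- A radical vector of `β` on `C₀` pairing with `X₄` becomes `X₅` and leads to `g5`. Otherwise
  -- `X₄` commutes with `C₀`, and the family is a separate tail: empty for `g4_2`, nonempty for
  -- `g6_2`.
  by_cases hr : ∃ r ∈ C₀, (∀ j < k, β r (a j) = 0 ∧ β r (b j) = 0) ∧ β X₄ r ≠ 0
  · obtain ⟨r, hrC, hro, hr0⟩ := hr
    set X₅ := (β X₄ r)⁻¹ • r with hX₅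
    have hX₅C : X₅ ∈ C₀ := C₀.smul_mem _ hrC
    have hX₄X₅ : β X₄ X₅ = 1 := by
      rw [hX₅, map_smul, smul_eq_mul, inv_mul_cancel₀ hr0]
    have hX₅o : ∀ c ∈ C₀, β X₅ c = 0 := by
      intro c hc
      rw [hX₅, map_smul, LinearMap.smul_apply, hmax r hrC hro c hc, smul_zero]
    let X := tailSeq 6 (fun p => if p = 1 then X₁ else if p = 2 then X₂ else
      if p = 3 then x else if p = 4 then X₄ else X₅) a b
    have e1 : X 1 = X₁ := rfl
    have e2 : X 2 = X₂ := rfl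
    have e3 : X 3 = x := rfl
    have e4 : X 4 = X₄ := rfl
    have e5 : X 5 = X₅ := rfl
    have htail : ∀ p, 6 ≤ p → p < 6 + 2 * k → X p ∈ hypSpan k a b :=
      fun p h1 h2 => tailSeq_mem_hypSpan h1 h2
    have hpC₀ : ∀ p, 5 ≤ p → p < 6 + 2 * k → X p ∈ C₀ := by
      intro p h1 h2
      rcases h1.eq_or_lt with rfl | h1
      · exact hX₅C
      · exact hf.hypSpan_le (htail p h1 h2)
    have hpC : ∀ p, 4 ≤ p → p < 6 + 2 * k → X p ∈ derCentralizer G := by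
      intro p h1 h2
      rcases h1.eq_or_lt with rfl | h1
      · exact hX₄C
      · exact (hpC₀ p h1 h2).1
    have hbr : ∀ p q, 4 ≤ p → p < q → q < 6 + 2 * k →
        ⁅X p, X q⁆ = (if p % 2 = 0 ∧ q = p + 1 then (1 : ℝ) else 0) • X₂ := by
      intro p q h1 h2 h3
      rw [hCC _ (hpC p h1 (h2.trans h3)) _ (hpC q (h1.trans h2.le) h3)]
      rcases h1.eq_or_lt with rfl | h1
      · rw [e4]
        rcases Nat.lt_or_ge 5 q with h4 | h4
        · rw [IsHyperbolicFamily.eq_zero_of_mem_hypSpan hso (htail q h4 h3), if_neg (by omega)]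
        · obtain rfl : q = 5 := by omega
          rw [e5, hX₄X₅, if_pos (by omega)]
      · rcases Nat.lt_or_ge 5 p with h4 | h4
        · exact congrArg (· • X₂) (hf.tailSeq_form hβ h4 h2 h3)
        · obtain rfl : p = 5 := by omega
          rw [e5, hX₅o _ (hpC₀ q (by omega) h3), if_neg (by omega)]
    right; left
    refine ⟨k, (Listed.isOneOp_g5 k).nonempty_equiv (Listed.centerLE_g5 k) X (hX₁C _ (hVC hX₂))
      hliX ?_ ?_ ?_ ?_ ?_ ?_⟩
    · rw [e1, e2, e3, ← hX₂def]; simp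
    · rw [e1, e2, e3, hxX₂]; simp
    · intro p h1 h2
      simp only [Listed.codim] at h2
      have := hpC p h1 (by omega)
      exact ⟨this _ hX₁, this _ hX₂⟩
    · intro p q h1 h2 h3
      simp only [Listed.codim] at h3
      rw [e1, e2]
      rcases h1.eq_or_lt with rfl | h1
      · rcases (show 4 ≤ q from h2).eq_or_lt with rfl | h2
        · rw [e3, e4, hxX₄]; simp
        · rw [e3, hxC₀ _ (hpC₀ q h2 (by omega)), if_neg (by omega), if_neg (by omega)]
          simp
      · rw [hbr p q h1 h2 (by omega)]
        simp only [Nat.even_iff]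
        split_ifs <;> first | omega | simp
    · intro p q h
      rw [if_neg (by omega), if_neg (by omega)]
    · intro g
      simp only [Listed.codim]
      set S := Submodule.span ℝ (X '' {p | 1 ≤ p ∧ p < 3 + 2 * k + 3})
      have m1 : X₁ ∈ S := Submodule.subset_span ⟨1, ⟨by omega, by omega⟩, e1⟩
      have m2 : X₂ ∈ S := Submodule.subset_span ⟨2, ⟨by omega, by omega⟩, e2⟩
      have m3 : x ∈ S := Submodule.subset_span ⟨3, ⟨by omega, by omega⟩, e3⟩
      have m4 : X₄ ∈ S := Submodule.subset_span ⟨4, ⟨by omega, by omega⟩, e4⟩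
      have m5 : X₅ ∈ S := Submodule.subset_span ⟨5, ⟨by omega, by omega⟩, e5⟩
      obtain ⟨q, α, γ, hg⟩ := hdec g
      set c := g - q • x - α • X₄ - γ • X₁ with hc
      obtain ⟨s₁, hs₁, hs₁o⟩ := hf.exists_orthogonal hβ c
      have hs₁S : s₁ ∈ S := hypSpan_le_tailSeq (by omega) (by omega) hs₁
      have hc₁C : c - s₁ ∈ C₀ := sub_mem hg (hf.hypSpan_le hs₁)
      obtain ⟨γ', δ', h5⟩ := hcentral (c - s₁ - β X₄ (c - s₁) • X₅)
        (sub_mem hc₁C (C₀.smul_mem _ hX₅C))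
        (by rw [map_sub, map_smul, hX₄X₅, smul_eq_mul, mul_one, sub_self])
        (by
          intro c' hc'
          rw [map_sub, LinearMap.sub_apply, map_smul, LinearMap.smul_apply, hX₅o c' hc',
            hmax _ hc₁C hs₁o c' hc']
          simp)
      have : g = (c - s₁ - β X₄ (c - s₁) • X₅) + s₁ + β X₄ (c - s₁) • X₅ + q • x + α • X₄
          + γ • X₁ := by
        rw [hc]; abel
      rw [this, h5]
      exact add_mem (add_mem (add_mem (add_mem (add_mem (add_mem (S.smul_mem _ m1)
        (S.smul_mem _ m2)) hs₁S) (S.smul_mem _ m5)) (S.smul_mem _ m3)) (S.smul_mem _ m4))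
        (S.smul_mem _ m1)
  · push Not at hr
    have hX₄0 : ∀ c ∈ C₀, β X₄ c = 0 := by
      intro c hc
      obtain ⟨s₁, hs₁, hs₁o⟩ := hf.exists_orthogonal hβ c
      have h1 := hr _ (sub_mem hc (hf.hypSpan_le hs₁)) hs₁o
      rwa [map_sub, IsHyperbolicFamily.eq_zero_of_mem_hypSpan hso hs₁, sub_zero] at h1
    have hgdec : ∀ g, ∃ q α γ δ : ℝ, ∃ s₁ ∈ hypSpan k a b,
        g = γ • X₁ + δ • X₂ + s₁ + q • x + α • X₄ := by
      intro g
      obtain ⟨q, α, γ, hg⟩ := hdec g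
      set c := g - q • x - α • X₄ - γ • X₁ with hc
      obtain ⟨s₁, hs₁, hs₁o⟩ := hf.exists_orthogonal hβ c
      have hc₁C : c - s₁ ∈ C₀ := sub_mem hg (hf.hypSpan_le hs₁)
      obtain ⟨γ', δ', h5⟩ := hcentral (c - s₁) hc₁C (hX₄0 _ hc₁C)
        (fun c' hc' => hmax _ hc₁C hs₁o c' hc')
      refine ⟨q, α, γ' + γ, δ', s₁, hs₁, ?_⟩
      have : g = (c - s₁) + s₁ + q • x + α • X₄ + γ • X₁ := by rw [hc]; abel
      rw [this, h5]
      module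
    rcases k with _ | k
    · left
      -- In `g4_2` the vector killed by `ad X_3` comes first, so `X₁` and `X₂` change places.
      refine Listed.isOneOp_g4_2.nonempty_equiv Listed.centerLE_g4_2
        (fun p => if p = 1 then X₂ else if p = 2 then X₁ else if p = 3 then x else X₄)
        ?_ ?_ ?_ ?_ ?_ ?_ ?_ ?_
      · exact hVC hX₂ _ hX₁
      · change LinearIndependent ℝ ![X₂, X₁]
        exact LinearIndependent.pair_symm_iff.1 hliX
      · simp [hxX₂]
      · simp [← hX₂def]
      · intro p h1 h2
        simp only [Listed.codim] at h2
        obtain rfl : p = 4 := by omega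
        exact ⟨hX₄C _ hX₂, hX₄C _ hX₁⟩
      · intro p q h1 h2 h3
        simp only [Listed.codim] at h3
        obtain rfl : p = 3 := by omega
        obtain rfl : q = 4 := by omega
        simp [hxX₄]
      · intro p q h
        rw [if_neg (by omega)]
      · intro g
        simp only [Listed.codim]
        set S := Submodule.span ℝ ((fun p => if p = 1 then X₂ else if p = 2 then X₁ else
          if p = 3 then x else X₄) '' {p | 1 ≤ p ∧ p < 2 + 3})
        have m1 : X₂ ∈ S := Submodule.subset_span ⟨1, ⟨by omega, by omega⟩, rfl⟩
        have m2 : X₁ ∈ S := Submodule.subset_span ⟨2, ⟨by omega, by omega⟩, rfl⟩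
        have m3 : x ∈ S := Submodule.subset_span ⟨3, ⟨by omega, by omega⟩, rfl⟩
        have m4 : X₄ ∈ S := Submodule.subset_span ⟨4, ⟨by omega, by omega⟩, rfl⟩
        obtain ⟨q, α, γ, δ, s₁, hs₁, h5⟩ := hgdec g
        have hs₁S : s₁ ∈ S := hypSpan_le (by simp) (by simp) hs₁
        rw [h5]
        exact add_mem (add_mem (add_mem (add_mem (S.smul_mem _ m2) (S.smul_mem _ m1)) hs₁S)
          (S.smul_mem _ m3)) (S.smul_mem _ m4)
    · right; right
      let X := tailSeq 5 (fun p => if p = 1 then X₁ else if p = 2 then X₂ else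
        if p = 3 then x else X₄) a b
      have e1 : X 1 = X₁ := rfl
      have e2 : X 2 = X₂ := rfl
      have e3 : X 3 = x := rfl
      have e4 : X 4 = X₄ := rfl
      have hpC₀ : ∀ p, 5 ≤ p → p < 5 + 2 * (k + 1) → X p ∈ C₀ :=
        fun p h1 h2 => hf.hypSpan_le (tailSeq_mem_hypSpan h1 h2)
      have hpC : ∀ p, 4 ≤ p → p < 5 + 2 * (k + 1) → X p ∈ derCentralizer G := by
        intro p h1 h2
        rcases h1.eq_or_lt with rfl | h1
        · exact hX₄C
        · exact (hpC₀ p h1 h2).1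
      refine ⟨k, (Listed.isOneOp_g6_2 k).nonempty_equiv (Listed.centerLE_g6_2 k) X
        (hX₁C _ (hVC hX₂)) hliX ?_ ?_ ?_ ?_ ?_ ?_⟩
      · rw [e1, e2, e3, ← hX₂def]; simp
      · rw [e1, e2, e3, hxX₂]; simp
      · intro p h1 h2
        simp only [Listed.codim] at h2
        have := hpC p h1 (by omega)
        exact ⟨this _ hX₁, this _ hX₂⟩
      · intro p q h1 h2 h3
        simp only [Listed.codim] at h3
        rw [e1, e2]
        rcases h1.eq_or_lt with rfl | h1
        · rcases (show 4 ≤ q from h2).eq_or_lt with rfl | h2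
          · rw [e3, e4, hxX₄]; simp
          · rw [e3, hxC₀ _ (hpC₀ q h2 (by omega)), if_neg (by omega), if_neg (by omega)]
            simp
        · rw [hCC _ (hpC p h1 (by omega)) _ (hpC q (by omega) (by omega)), if_neg (by omega)]
          rcases (show 4 ≤ p from h1).eq_or_lt with rfl | h1
          · rw [e4, hX₄0 _ (hpC₀ q h2 (by omega)), if_neg (by omega)]
            simp
          · have h6 := hf.tailSeq_form hβ (f := fun p => if p = 1 then X₁ else
              if p = 2 then X₂ else if p = 3 then x else X₄) h1 h2 (by omega)
            change β (X p) (X q) = _ at h6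
            rw [h6]
            simp only [Nat.odd_iff]
            split_ifs <;> first | omega | simp
      · intro p q h
        rw [if_neg (by omega), if_neg (by omega)]
      · intro g
        simp only [Listed.codim]
        set S := Submodule.span ℝ (X '' {p | 1 ≤ p ∧ p < 4 + 2 * k + 3})
        have m1 : X₁ ∈ S := Submodule.subset_span ⟨1, ⟨by omega, by omega⟩, e1⟩
        have m2 : X₂ ∈ S := Submodule.subset_span ⟨2, ⟨by omega, by omega⟩, e2⟩
        have m3 : x ∈ S := Submodule.subset_span ⟨3, ⟨by omega, by omega⟩, e3⟩
        have m4 : X₄ ∈ S := Submodule.subset_span ⟨4, ⟨by omega, by omega⟩, e4⟩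
        obtain ⟨q, α, γ, δ, s₁, hs₁, h5⟩ := hgdec g
        have hs₁S : s₁ ∈ S := hypSpan_le_tailSeq (by omega) (by omega) hs₁
        rw [h5]
        exact add_mem (add_mem (add_mem (add_mem (S.smul_mem _ m1) (S.smul_mem _ m2)) hs₁S)
          (S.smul_mem _ m3)) (S.smul_mem _ m4)

end RankOne

/-- The listed algebras without the decomposable algebras `g4_3 c`, `c ≠ 0`. -/
def Listed.IsReduced : Listed → Prop
  | .g4_3 c => c = 0
  | _ => True

/-! ### Classification of the indecomposable algebras -/

section Classification

variable {G : Type*} [LieRing G] [LieAlgebra ℝ G]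

theorem LieData.IsOneOp.nonempty_equiv_three {D : LieData (Fin 2) (Fin 1)}
    {M : Matrix (Fin 2) (Fin 2) ℝ} {u : ℕ → ℕ → Fin 2 → ℝ} (hD : D.IsOneOp M u)
    (hDc : D.CenterLE) (hu : ∀ p q, u p q = 0) {X₁ X₂ X₃ : G} (h12 : ⁅X₁, X₂⁆ = 0)
    (hX : LinearIndependent ℝ ![X₁, X₂])
    (h31 : ⁅X₃, X₁⁆ = M 0 0 • X₁ + M 1 0 • X₂) (h32 : ⁅X₃, X₂⁆ = M 0 1 • X₁ + M 1 1 • X₂)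
    (hspan : ∀ g, ∃ α β γ : ℝ, g = α • X₁ + β • X₂ + γ • X₃) :
    Nonempty (D.Carrier ≃ₗ⁅ℝ⁆ G) := by
  refine hD.nonempty_equiv hDc (fun p => if p = 1 then X₁ else if p = 2 then X₂ else X₃)
    h12 hX h31 h32 (by omega) (by omega) (fun p q _ => hu p q) ?_
  intro g
  set S := Submodule.span ℝ ((fun p => if p = 1 then X₁ else if p = 2 then X₂ else X₃) ''
    {p | 1 ≤ p ∧ p < 1 + 3})
  have m1 : X₁ ∈ S := Submodule.subset_span ⟨1, ⟨by omega, by omega⟩, rfl⟩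
  have m2 : X₂ ∈ S := Submodule.subset_span ⟨2, ⟨by omega, by omega⟩, rfl⟩
  have m3 : X₃ ∈ S := Submodule.subset_span ⟨3, ⟨by omega, by omega⟩, rfl⟩
  obtain ⟨α, β, γ, rfl⟩ := hspan g
  exact add_mem (add_mem (S.smul_mem _ m1) (S.smul_mem _ m2)) (S.smul_mem _ m3)

theorem lie_lie_comm_of_mem_derSpan (hd : Module.finrank ℝ (derSpan G) = 2) {g h v : G}
    (hv : v ∈ derSpan G) : ⁅g, ⁅h, v⁆⁆ = ⁅h, ⁅g, v⁆⁆ := by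
  rw [leibniz_lie, lie_eq_zero_of_mem_derSpan hd (lie_mem_derSpan g h) hv, zero_add]

/-- `x` acts invertibly on the derived algebra, and the centralizer of `x` is one-dimensional. -/
theorem exists_equiv_of_centralizer_line (hd : Module.finrank ℝ (derSpan G) = 2) {y : G}
    (hy : ∀ v ∈ derSpan G, ⁅y, v⁆ = 0 → v = 0)
    (hdec : ∀ g, ∃ c : ℝ, ∃ v ∈ derSpan G, g = v + c • y) :
    ∃ t : Listed, t.IsReduced ∧ Nonempty (t.Alg ≃ₗ⁅ℝ⁆ G) := by
  have hab : ∀ {u v : G}, u ∈ derSpan G → v ∈ derSpan G → ⁅u, v⁆ = 0 :=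
    fun hu hv => lie_eq_zero_of_mem_derSpan hd hu hv
  have hspan : ∀ {X₁ X₂ X₃ : G} {c : ℝ}, X₁ ∈ derSpan G → X₂ ∈ derSpan G →
      LinearIndependent ℝ ![X₁, X₂] → c ≠ 0 → X₃ = c⁻¹ • y →
      ∀ g, ∃ α β γ : ℝ, g = α • X₁ + β • X₂ + γ • X₃ := by
    intro X₁ X₂ X₃ c h1 h2 hli hc h3 g
    obtain ⟨p, v, hv, rfl⟩ := hdec g
    obtain ⟨α, β, rfl⟩ := exists_eq_of_mem hd h1 h2 hli hv
    refine ⟨α, β, p * c, ?_⟩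
    rw [h3, smul_smul, mul_assoc, mul_inv_cancel₀ hc, mul_one]
  rcases scalar_or_exists_cyclic hd (LieAlgebra.ad ℝ G y : G →ₗ[ℝ] G) with ⟨a, ha⟩ | ⟨e, he, hli⟩
  · obtain ⟨e, he, f, hf, hef⟩ := exists_pair hd
    have ha' : ∀ v ∈ derSpan G, ⁅y, v⁆ = a • v := ha
    have ha0 : a ≠ 0 := by
      rintro rfl
      exact hef.ne_zero 0 (hy e he (by rw [ha' e he, zero_smul]))
    refine ⟨.g3_1 1 one_ne_zero, trivial, (Listed.isOneOp_g3_1 1 _).nonempty_equiv_three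
      (Listed.centerLE_g3_1 1 _) (fun _ _ => rfl) (X₃ := a⁻¹ • y) (hab he hf) hef ?_ ?_
      (hspan he hf hef ha0 rfl)⟩
    · rw [smul_lie, ha' e he, smul_smul, inv_mul_cancel₀ ha0]; simp
    · rw [smul_lie, ha' f hf, smul_smul, inv_mul_cancel₀ ha0]; simp
  · obtain ⟨e₀, h0, e₁, h1, hli', h⟩ :=
      exists_normalForm hd (fun v _ => lie_mem_derSpan y v) he hli
    simp only [LieAlgebra.ad_apply] at h
    have h00 : e₀ ≠ 0 := hli'.ne_zero 0
    have h10 : e₁ ≠ 0 := hli'.ne_zero 1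
    rcases h with ⟨a, b, -, ha, hb⟩ | ⟨a, ha, hb⟩ | ⟨a, b, hb0, ha, hb⟩
    · have ha0 : a ≠ 0 := by
        rintro rfl
        exact h00 (hy _ h0 (by rw [ha, zero_smul]))
      have hb0 : b ≠ 0 := by
        rintro rfl
        exact h10 (hy _ h1 (by rw [hb, zero_smul]))
      refine ⟨.g3_1 (a⁻¹ * b) (mul_ne_zero (inv_ne_zero ha0) hb0), trivial,
        (Listed.isOneOp_g3_1 _ _).nonempty_equiv_three (Listed.centerLE_g3_1 _ _)
        (fun _ _ => rfl) (X₃ := a⁻¹ • y) (hab h0 h1) hli' ?_ ?_ (hspan h0 h1 hli' ha0 rfl)⟩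
      · rw [smul_lie, ha, smul_smul, inv_mul_cancel₀ ha0]; simp
      · rw [smul_lie, hb, smul_smul]; simp
    · have ha0 : a ≠ 0 := by
        rintro rfl
        exact h00 (hy _ h0 (by rw [ha, zero_smul]))
      -- Dividing `y` by `a` leaves `a⁻¹` off the diagonal; it is absorbed into the first basis
      -- vector.
      have hX : LinearIndependent ℝ ![a⁻¹ • e₀, e₁] := by
        rw [LinearIndependent.pair_iff]
        intro s t hst
        rw [smul_smul] at hst
        have := pair_coeff_eq_zero hli' hst
        exact ⟨(mul_eq_zero.1 this.1).resolve_right (inv_ne_zero ha0), this.2⟩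
      have h0' : a⁻¹ • e₀ ∈ derSpan G := Submodule.smul_mem _ _ h0
      refine ⟨.g3_2, trivial, Listed.isOneOp_g3_2.nonempty_equiv_three Listed.centerLE_g3_2
        (fun _ _ => rfl) (X₁ := a⁻¹ • e₀) (X₃ := a⁻¹ • y) (hab h0' h1) hX ?_ ?_
        (hspan h0' h1 hX ha0 rfl)⟩
      · rw [smul_lie, lie_smul, ha, smul_smul a⁻¹ a, inv_mul_cancel₀ ha0]; simp
      · rw [smul_lie, hb, smul_add, smul_smul a⁻¹ a, inv_mul_cancel₀ ha0]; simp
    -- Polar form of `a + i b`; the sign `b > 0` places the angle in `(0, π)`.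
    · set r := Real.sqrt (a ^ 2 + b ^ 2) with hr
      have hr2 : r ^ 2 = a ^ 2 + b ^ 2 := Real.sq_sqrt (by positivity)
      have hr0 : 0 < r := Real.sqrt_pos.2 (by positivity)
      have hlt : |a / r| < 1 := by
        rw [← sq_lt_one_iff_abs_lt_one, div_pow, hr2, div_lt_one (by positivity)]
        nlinarith [hb0]
      have hcos : Real.cos (Real.arccos (a / r)) = r⁻¹ * a := by
        rw [Real.cos_arccos (abs_lt.1 hlt).1.le (abs_lt.1 hlt).2.le]; ring
      have hsin : Real.sin (Real.arccos (a / r)) = r⁻¹ * b := by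
        rw [Real.sin_arccos]
        have : 1 - (a / r) ^ 2 = (r⁻¹ * b) ^ 2 := by
          field_simp; linarith
        rw [this, Real.sqrt_sq (by positivity)]
      have hφ : Real.arccos (a / r) ∈ Set.Ioo 0 Real.pi :=
        ⟨Real.arccos_pos.2 (abs_lt.1 hlt).2, Real.arccos_lt_pi.2 (abs_lt.1 hlt).1⟩
      refine ⟨.g3_3 _ hφ, trivial,
        (Listed.isOneOp_g3_3 _ hφ).nonempty_equiv_three (Listed.centerLE_g3_3 _ hφ)
        (fun _ _ => rfl) (X₃ := r⁻¹ • y) (hab h0 h1) hli' ?_ ?_ (hspan h0 h1 hli' hr0.ne' rfl)⟩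
      · rw [smul_lie, ha, hcos, hsin]
        simp only [Matrix.of_apply, Matrix.cons_val', Matrix.cons_val_zero, Matrix.cons_val_one,
          Matrix.cons_val_fin_one]
        module
      · rw [smul_lie, hb, hcos, hsin]
        simp only [Matrix.of_apply, Matrix.cons_val', Matrix.cons_val_zero, Matrix.cons_val_one,
          Matrix.cons_val_fin_one]
        module

/-- The centralizer of an invertibly acting element is spanned by `y` and `w`, where `w` acts as
the identity and `y` does not act as a scalar. -/
theorem exists_equiv_of_centralizer_plane (hd : Module.finrank ℝ (derSpan G) = 2)
    (hI : ¬ IsDecomposable G) {y w e : G} (he : e ∈ derSpan G)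
    (hli : LinearIndependent ℝ ![e, ⁅y, e⁆]) (hw : ∀ v ∈ derSpan G, ⁅w, v⁆ = v) (hyw : ⁅y, w⁆ = 0)
    (hdec : ∀ g, ∃ c d : ℝ, ∃ v ∈ derSpan G, g = v + c • y + d • w) :
    ∃ t : Listed, t.IsReduced ∧ Nonempty (t.Alg ≃ₗ⁅ℝ⁆ G) := by
  have hab : ∀ {u v : G}, u ∈ derSpan G → v ∈ derSpan G → ⁅u, v⁆ = 0 :=
    fun hu hv => lie_eq_zero_of_mem_derSpan hd hu hv
  obtain ⟨e₀, h0, e₁, h1, hli', h⟩ :=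
    exists_normalForm hd (T := (LieAlgebra.ad ℝ G y : G →ₗ[ℝ] G))
      (fun v _ => lie_mem_derSpan y v) he hli
  simp only [LieAlgebra.ad_apply] at h
  have h00 : e₀ ≠ 0 := hli'.ne_zero 0
  have h10 : e₁ ≠ 0 := hli'.ne_zero 1
  have hV : ∀ v ∈ derSpan G, ∃ α β : ℝ, v = α • e₀ + β • e₁ :=
    fun v hv => exists_eq_of_mem hd h0 h1 hli' hv
  rcases h with ⟨a, b, hab', ha, hb⟩ | ⟨a, ha, hb⟩ | ⟨a, b, hb0, ha, hb⟩
  · exfalso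
    have hc0 : a - b ≠ 0 := sub_ne_zero.2 hab'
    -- `p` acts as `diag(1, 0)` and `w - p` as `diag(0, 1)`, so two copies of `aff(ℝ)` split the
    -- algebra.
    set p := (a - b)⁻¹ • (y - b • w) with hp
    have hwe₀ := hw _ h0
    have hwe₁ := hw _ h1
    have hpe₀ : ⁅p, e₀⁆ = e₀ := by
      rw [hp, smul_lie, sub_lie, smul_lie, ha, hwe₀, ← sub_smul, smul_smul, inv_mul_cancel₀ hc0,
        one_smul]
    have hpe₁ : ⁅p, e₁⁆ = 0 := by
      rw [hp, smul_lie, sub_lie, smul_lie, hb, hwe₁, sub_self, smul_zero]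
    have hpw : ⁅p, w⁆ = 0 := by
      rw [hp, smul_lie, sub_lie, smul_lie, hyw, lie_self]; simp
    have he₀p : ⁅e₀, p⁆ = -e₀ := by rw [← lie_skew, hpe₀]
    have he₁p : ⁅e₁, p⁆ = 0 := by rw [← lie_skew, hpe₁, neg_zero]
    have hwp : ⁅w, p⁆ = 0 := by rw [← lie_skew, hpw, neg_zero]
    have he₀w : ⁅e₀, w⁆ = -e₀ := by rw [← lie_skew, hwe₀]
    have he₁w : ⁅e₁, w⁆ = -e₁ := by rw [← lie_skew, hwe₁]
    have he₀e₁ : ⁅e₀, e₁⁆ = 0 := hab h0 h1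
    have he₁e₀ : ⁅e₁, e₀⁆ = 0 := hab h1 h0
    have hy : y = (a - b) • p + b • w := by
      rw [hp, smul_smul, mul_inv_cancel₀ hc0]; module
    have hg : ∀ g, ∃ α β γ δ : ℝ, g = α • e₀ + β • p + (γ • e₁ + δ • (w - p)) := by
      intro g
      obtain ⟨c, d, v, hv, rfl⟩ := hdec g
      obtain ⟨α, β, rfl⟩ := hV v hv
      refine ⟨α, c * (a - b) + c * b + d, β, c * b + d, ?_⟩
      rw [hy]; module
    refine hI (isDecomposable_of_isCompl (P := Submodule.span ℝ {e₀, p})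
      (Q := Submodule.span ℝ {e₁, w - p}) ?_ ?_ ?_ ?_ ?_)
    · intro g z hz
      obtain ⟨α, β, γ, δ, rfl⟩ := hg g
      obtain ⟨s, t, rfl⟩ := Submodule.mem_span_pair.1 hz
      refine Submodule.mem_span_pair.2 ⟨β * s - α * t, 0, ?_⟩
      simp only [add_lie, lie_add, smul_lie, lie_smul, sub_lie, lie_self, hpe₀, he₀p, he₁e₀, he₁p,
        hwe₀, hwp]
      module
    · intro g z hz
      obtain ⟨α, β, γ, δ, rfl⟩ := hg g
      obtain ⟨s, t, rfl⟩ := Submodule.mem_span_pair.1 hz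
      refine Submodule.mem_span_pair.2 ⟨δ * s - γ * t, 0, ?_⟩
      simp only [add_lie, lie_add, smul_lie, lie_smul, sub_lie, lie_sub, lie_self, hpe₁, hpw,
        he₀e₁, he₀p, he₀w, he₁w, hwe₁, he₁p, hwp]
      module
    · constructor
      · rw [Submodule.disjoint_def]
        intro z hz hz'
        obtain ⟨s, t, rfl⟩ := Submodule.mem_span_pair.1 hz
        obtain ⟨s', t', h2⟩ := Submodule.mem_span_pair.1 hz'
        have h3 := congrArg (fun u => ⁅u, e₀⁆) h2
        simp only [add_lie, smul_lie, sub_lie, lie_self, he₁e₀, hwe₀, hpe₀, sub_self, smul_zero,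
          add_zero, zero_add] at h3
        have ht : t = 0 := (smul_eq_zero.1 h3.symm).resolve_right h00
        have h4 := congrArg (fun u => ⁅p, u⁆) h2
        simp only [lie_add, lie_smul, lie_sub, lie_self, hpe₁, hpw, hpe₀, sub_self, smul_zero,
          add_zero] at h4
        rw [ht, ← h4, zero_smul, add_zero]
      · rw [codisjoint_iff, eq_top_iff]
        intro g _
        obtain ⟨α, β, γ, δ, rfl⟩ := hg g
        exact Submodule.add_mem_sup (Submodule.mem_span_pair.2 ⟨_, _, rfl⟩)
          (Submodule.mem_span_pair.2 ⟨_, _, rfl⟩)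
    · intro h
      have : e₀ ∈ Submodule.span ℝ {e₀, p} := Submodule.subset_span (by simp)
      rw [h] at this
      exact h00 this
    · intro h
      have : e₁ ∈ Submodule.span ℝ {e₁, w - p} := Submodule.subset_span (by simp)
      rw [h] at this
      exact h10 this
  · refine ⟨.g4_3 0, rfl, (Listed.isTwoOp_g4_3 0).nonempty_equiv (Listed.centerLE_g4_3 0)
      (X₁ := e₀) (X₂ := e₁) (X₃ := y - a • w) (X₄ := w) (hab h0 h1) hli' ?_ ?_ ?_ ?_ ?_ ?_⟩
    · rw [sub_lie, smul_lie, ha, hw _ h0]; simp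
    · rw [sub_lie, smul_lie, hb, hw _ h1]; simp
    · rw [hw _ h0]; simp
    · rw [hw _ h1]; simp
    · rw [sub_lie, smul_lie, hyw, lie_self]; simp
    · intro g
      obtain ⟨c, d, v, hv, rfl⟩ := hdec g
      obtain ⟨α, β, rfl⟩ := hV v hv
      simp only [Submodule.mem_span_insert, Submodule.mem_span_singleton]
      refine ⟨α, _, ⟨β, _, ⟨c, _, ⟨c * a + d, rfl⟩, rfl⟩, rfl⟩, ?_⟩
      module
  -- In this order `X₃` sends `e₁` to `-e₀` and `e₀` to `e₁`, which matches the listed signs.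
  · refine ⟨.affC, trivial, Listed.isTwoOp_affC.nonempty_equiv Listed.centerLE_affC
      (X₁ := e₁) (X₂ := e₀) (X₃ := b⁻¹ • (y - a • w)) (X₄ := w) (hab h1 h0)
      (LinearIndependent.pair_symm_iff.1 hli') ?_ ?_ ?_ ?_ ?_ ?_⟩
    · rw [smul_lie, sub_lie, smul_lie, hb, hw _ h1, add_sub_cancel_right, smul_smul]
      simp [hb0.ne']
    · rw [smul_lie, sub_lie, smul_lie, ha, hw _ h0, add_sub_cancel_left, smul_smul]
      simp [hb0.ne']
    · rw [hw _ h1]; simp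
    · rw [hw _ h0]; simp
    · rw [smul_lie, sub_lie, smul_lie, hyw, lie_self]; simp
    · intro g
      obtain ⟨c, d, v, hv, rfl⟩ := hdec g
      obtain ⟨α, β, rfl⟩ := hV v hv
      simp only [Submodule.mem_span_insert, Submodule.mem_span_singleton]
      refine ⟨β, _, ⟨α, _, ⟨c * b, _, ⟨c * a + d, rfl⟩, rfl⟩, rfl⟩, ?_⟩
      rw [smul_smul, mul_assoc, mul_inv_cancel₀ hb0.ne']
      module

/-- `ad x` is bijective on the derived plane `V`, so `G` is `V` plus the centralizer `H` of `x`.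
Brackets within `H` lie in `V` and are killed by `ad x`, so `H` is commutative. An element of `H`
killing `V` is central, hence in `V`, hence zero; so linear relations between operators of `H` lift
to `H`. -/
theorem exists_equiv_of_injective (hd : Module.finrank ℝ (derSpan G) = 2)
    (hZ : CentralInDerived G) (hI : ¬ IsDecomposable G) {x : G}
    (hx : ∀ v ∈ derSpan G, ⁅x, v⁆ = 0 → v = 0) :
    ∃ t : Listed, t.IsReduced ∧ Nonempty (t.Alg ≃ₗ⁅ℝ⁆ G) := by
  have : FiniteDimensional ℝ (derSpan G) := Module.finite_of_finrank_pos (by omega)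
  have hdec : ∀ g, ∃ v ∈ derSpan G, ⁅x, g - v⁆ = 0 := by
    intro g
    let T : derSpan G →ₗ[ℝ] derSpan G := (LieAlgebra.ad ℝ G x : G →ₗ[ℝ] G).restrict
      (p := derSpan G) (q := derSpan G) (fun v _ => lie_mem_derSpan x v)
    have hT : Function.Injective T := by
      rw [injective_iff_map_eq_zero]
      intro v hv
      exact Subtype.ext (hx v v.2 (congrArg Subtype.val hv))
    obtain ⟨v, hv⟩ := (LinearMap.injective_iff_surjective.1 hT) ⟨⁅x, g⁆, lie_mem_derSpan _ _⟩
    have hv' : ⁅x, (v : G)⁆ = ⁅x, g⁆ := congrArg Subtype.val hv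
    exact ⟨v, v.2, by rw [lie_sub, hv', sub_self]⟩
  have hcomm : ∀ h h' : G, ⁅x, h⁆ = 0 → ⁅x, h'⁆ = 0 → ⁅h, h'⁆ = 0 := by
    intro h h' h1 h2
    exact hx _ (lie_mem_derSpan _ _) (by rw [leibniz_lie, h1, h2, zero_lie, lie_zero, add_zero])
  have hfaith : ∀ h : G, ⁅x, h⁆ = 0 → (∀ v ∈ derSpan G, ⁅h, v⁆ = 0) → h = 0 := by
    intro h h1 h2
    refine hx _ (hZ _ fun g => ?_) h1
    obtain ⟨v, hv, hgv⟩ := hdec g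
    have : g = v + (g - v) := by abel
    rw [this, add_lie, ← lie_skew, h2 v hv, hcomm _ _ hgv h1]
    simp
  by_cases hns : ∃ y e : G, ⁅x, y⁆ = 0 ∧ e ∈ derSpan G ∧ LinearIndependent ℝ ![e, ⁅y, e⁆]
  · obtain ⟨y, e, hxy, he, hli⟩ := hns
    have hact : ∀ h : G, ∃ p q : ℝ, ∀ v ∈ derSpan G, ⁅h, v⁆ = p • v + q • ⁅y, v⁆ := fun h =>
      exists_eq_add_smul_of_commute hd (S := (LieAlgebra.ad ℝ G h : G →ₗ[ℝ] G))
        (T := (LieAlgebra.ad ℝ G y : G →ₗ[ℝ] G)) (fun v _ => lie_mem_derSpan h v)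
        (fun v _ => lie_mem_derSpan y v) (fun v hv => lie_lie_comm_of_mem_derSpan hd hv) he hli
    -- Every operator is `p + q ad y`. If `p ≠ 0` occurs in `H`, then `H` contains some `w` acting
    -- as the identity and is spanned by `y` and `w`; otherwise `H = ℝ y`.
    by_cases hp : ∃ h : G, ⁅x, h⁆ = 0 ∧ ∃ p q : ℝ, p ≠ 0 ∧ ∀ v ∈ derSpan G, ⁅h, v⁆ = p • v + q • ⁅y, v⁆
    · obtain ⟨h, hxh, p, q, hp0, hh⟩ := hp
      have hxw : ⁅x, p⁻¹ • (h - q • y)⁆ = 0 := by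
        rw [lie_smul, lie_sub, lie_smul, hxh, hxy]; simp
      have hw : ∀ v ∈ derSpan G, ⁅p⁻¹ • (h - q • y), v⁆ = v := by
        intro v hv
        rw [smul_lie, sub_lie, smul_lie, hh v hv, add_sub_cancel_right, smul_smul,
          inv_mul_cancel₀ hp0, one_smul]
      set w := p⁻¹ • (h - q • y)
      refine exists_equiv_of_centralizer_plane hd hI he hli hw (hcomm _ _ hxy hxw) ?_
      intro g
      obtain ⟨v, hv, hgv⟩ := hdec g
      obtain ⟨d, c, hdc⟩ := hact (g - v)
      refine ⟨c, d, v, hv, ?_⟩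
      have h0 := hfaith (g - v - c • y - d • w)
        (by rw [lie_sub, lie_sub, lie_smul, lie_smul, hgv, hxy, hxw]; simp)
        (by
          intro u hu
          rw [sub_lie, sub_lie, smul_lie, smul_lie, hdc u hu, hw u hu]
          abel)
      rw [← sub_eq_zero, ← h0]
      abel
    · push Not at hp
      have hline : ∀ h : G, ⁅x, h⁆ = 0 → ∃ c : ℝ, h = c • y := by
        intro h hxh
        obtain ⟨p, q, hpq⟩ := hact h
        have hp0 : p = 0 := by
          by_contra hp0
          obtain ⟨v, hv, hne⟩ := hp h hxh p q hp0
          exact hne (hpq v hv)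
        refine ⟨q, ?_⟩
        have h0 := hfaith (h - q • y) (by rw [lie_sub, lie_smul, hxh, hxy]; simp)
          (by
            intro u hu
            rw [sub_lie, smul_lie, hpq u hu, hp0]
            simp)
        exact sub_eq_zero.1 h0
      obtain ⟨c, hc⟩ := hline x (lie_self x)
      refine exists_equiv_of_centralizer_line hd (y := y) ?_ ?_
      · intro v hv h
        exact hx v hv (by rw [hc, smul_lie, h, smul_zero])
      · intro g
        obtain ⟨v, hv, hgv⟩ := hdec g
        obtain ⟨c, hc⟩ := hline _ hgv
        exact ⟨c, v, hv, by rw [← hc]; abel⟩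
  · push Not at hns
    have hscal : ∀ h : G, ⁅x, h⁆ = 0 → ∃ a : ℝ, ∀ v ∈ derSpan G, ⁅h, v⁆ = a • v := by
      intro h hxh
      rcases scalar_or_exists_cyclic hd (LieAlgebra.ad ℝ G h : G →ₗ[ℝ] G) with ha | ⟨e, he, hli⟩
      · exact ha
      · exact absurd hli (hns h e hxh he)
    obtain ⟨a, ha⟩ := hscal x (lie_self x)
    obtain ⟨e, he, f, hf, hef⟩ := exists_pair hd
    have ha0 : a ≠ 0 := by
      rintro rfl
      exact hef.ne_zero 0 (hx e he (by rw [ha e he, zero_smul]))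
    refine exists_equiv_of_centralizer_line hd hx ?_
    intro g
    obtain ⟨v, hv, hgv⟩ := hdec g
    obtain ⟨c, hc⟩ := hscal _ hgv
    refine ⟨c * a⁻¹, v, hv, ?_⟩
    have h0 := hfaith (g - v - (c * a⁻¹) • x) (by rw [lie_sub, lie_smul, hgv, lie_self]; simp)
      (by
        intro u hu
        rw [sub_lie, smul_lie, hc u hu, ha u hu, smul_smul, mul_assoc, inv_mul_cancel₀ ha0, mul_one,
          sub_self])
    rw [← sub_eq_zero, ← h0]
    abel

/-- Classification of the indecomposable algebras. -/
theorem exists_equiv_of_not_isDecomposable [FiniteDimensional ℝ G]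
    (hd : Module.finrank ℝ (derSpan G) = 2) (hN : ∃ x y z : G, ⁅x, ⁅y, z⁆⁆ ≠ 0)
    (hI : ¬ IsDecomposable G) : ∃ t : Listed, t.IsReduced ∧ Nonempty (t.Alg ≃ₗ⁅ℝ⁆ G) := by
  have hZ : CentralInDerived G := by
    refine CentralInDerived.of_not_isDecomposable ?_ hI
    intro h
    rw [h, finrank_bot] at hd
    omega
  by_cases hinj : ∃ x : G, ∀ v ∈ derSpan G, ⁅x, v⁆ = 0 → v = 0
  · obtain ⟨x, hx⟩ := hinj
    exact exists_equiv_of_injective hd hZ hI hx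
  push Not at hinj
  obtain ⟨x, y, z, hxyz⟩ := hN
  -- A nonzero scalar operator would be injective.
  have hnscal : ∀ g : G, ∀ a : ℝ, (∀ v ∈ derSpan G, ⁅g, v⁆ = a • v) → a = 0 := by
    intro g a ha
    obtain ⟨v, hv, h1, h2⟩ := hinj g
    rw [ha v hv] at h1
    exact (smul_eq_zero.1 h1).resolve_right h2
  obtain ⟨e, he, hli⟩ : ∃ e ∈ derSpan G, LinearIndependent ℝ ![e, ⁅x, e⁆] := by
    rcases scalar_or_exists_cyclic hd (LieAlgebra.ad ℝ G x : G →ₗ[ℝ] G) with ⟨a, ha⟩ | h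
    · exfalso
      have ha0 := hnscal x a ha
      apply hxyz
      have := ha _ (lie_mem_derSpan y z)
      rwa [ha0, zero_smul] at this
    · exact h
  -- If `ad g = p + q ad x` on the plane, then `g - q • x` acts as the scalar `p`, which must be
  -- `0`.
  have hq : ∀ g, ∃ q : ℝ, g - q • x ∈ derCentralizer G := by
    intro g
    obtain ⟨p, q, hpq⟩ := exists_eq_add_smul_of_commute hd
      (S := (LieAlgebra.ad ℝ G g : G →ₗ[ℝ] G))
      (T := (LieAlgebra.ad ℝ G x : G →ₗ[ℝ] G)) (fun v _ => lie_mem_derSpan g v)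
      (fun v _ => lie_mem_derSpan x v) (fun v hv => lie_lie_comm_of_mem_derSpan hd hv) he hli
    have hpq' : ∀ v ∈ derSpan G, ⁅g - q • x, v⁆ = p • v := by
      intro v hv
      have := hpq v hv
      simp only [LieAlgebra.ad_apply] at this
      rw [sub_lie, smul_lie, this, add_sub_cancel_right]
    have hp0 := hnscal _ _ hpq'
    refine ⟨q, fun v hv => ?_⟩
    rw [hpq' v hv, hp0, zero_smul]
  have hdiag : ∀ {e₀ e₁ : G} {a : ℝ}, e₀ ∈ derSpan G → e₁ ∈ derSpan G →
      LinearIndependent ℝ ![e₀, e₁] → a ≠ 0 → ⁅x, e₀⁆ = a • e₀ → ⁅x, e₁⁆ = 0 →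
      ∃ t : Listed, t.IsReduced ∧ Nonempty (t.Alg ≃ₗ⁅ℝ⁆ G) := by
    intro e₀ e₁ a h0 h1 hli' ha0 ha hb
    have := equiv_g4_1_or_g6_1 hd hZ hI (x := a⁻¹ • x) h0 h1 hli'
      (by rw [smul_lie, ha, smul_smul, inv_mul_cancel₀ ha0, one_smul])
      (by rw [smul_lie, hb, smul_zero])
      (by
        intro g
        obtain ⟨q, h⟩ := hq g
        refine ⟨q * a, ?_⟩
        rwa [smul_smul, mul_assoc, mul_inv_cancel₀ ha0, mul_one])
    rcases this with h | ⟨k, h⟩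
    · exact ⟨.g4_1, trivial, h⟩
    · exact ⟨.g6_1 k, trivial, h⟩
  obtain ⟨e₀, h0, e₁, h1, hli', h⟩ :=
    exists_normalForm hd (T := (LieAlgebra.ad ℝ G x : G →ₗ[ℝ] G))
      (fun v _ => lie_mem_derSpan x v) he hli
  simp only [LieAlgebra.ad_apply] at h
  obtain ⟨v, hv, hxv, hv0⟩ := hinj x
  obtain ⟨α, β, rfl⟩ := exists_eq_of_mem hd h0 h1 hli' hv
  rcases h with ⟨a, b, hab, ha, hb⟩ | ⟨a, ha, hb⟩ | ⟨a, b, hb0, ha, hb⟩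
  · by_cases hb0 : b = 0
    · subst hb0
      exact hdiag h0 h1 hli' hab ha (by rw [hb, zero_smul])
    · by_cases ha0 : a = 0
      · subst ha0
        exact hdiag h1 h0 (LinearIndependent.pair_symm_iff.1 hli') hb0 hb (by rw [ha, zero_smul])
      · exfalso
        rw [lie_add, lie_smul, lie_smul, ha, hb, smul_smul, smul_smul] at hxv
        have := pair_coeff_eq_zero hli' hxv
        apply hv0
        rw [(mul_eq_zero.1 this.1).resolve_right ha0, (mul_eq_zero.1 this.2).resolve_right hb0]
        simp
  · have ha0 : a = 0 := by
      by_contra ha0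
      rw [lie_add, lie_smul, lie_smul, ha, hb] at hxv
      have := pair_coeff_eq_zero hli' (a := α * a + β) (b := β * a) (by rw [← hxv]; module)
      have hβ := (mul_eq_zero.1 this.2).resolve_right ha0
      rw [hβ, add_zero] at this
      apply hv0
      rw [hβ, (mul_eq_zero.1 this.1).resolve_right ha0]
      simp
    rw [ha0, zero_smul] at ha
    rw [ha0, zero_smul, add_zero] at hb
    rcases equiv_g4_2_or_g5_or_g6_2 hd hZ h1 h0 (LinearIndependent.pair_symm_iff.1 hli') hb ha hq
      with h | ⟨k, h⟩ | ⟨k, h⟩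
    · exact ⟨.g4_2, trivial, h⟩
    · exact ⟨.g5 k, trivial, h⟩
    · exact ⟨.g6_2 k, trivial, h⟩
  · exfalso
    rw [lie_add, lie_smul, lie_smul, ha, hb] at hxv
    have := pair_coeff_eq_zero hli' (a := α * a - β * b) (b := α * b + β * a)
      (by rw [← hxv]; module)
    have hpos : 0 < a ^ 2 + b ^ 2 := by positivity
    have hα : α * (a ^ 2 + b ^ 2) = 0 := by linear_combination a * this.1 + b * this.2
    have hβ : β * (a ^ 2 + b ^ 2) = 0 := by linear_combination a * this.2 - b * this.1
    apply hv0
    rw [(mul_eq_zero.1 hα).resolve_right hpos.ne', (mul_eq_zero.1 hβ).resolve_right hpos.ne']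
    simp

end Classification

/-! ### Invariance of the operators on the derived plane -/

namespace LieData

variable {ι ι' : Type} [Fintype ι] [Fintype ι']

/-- The element with given coordinates. -/
def elem {κ ι : Type} [Fintype κ] [Fintype ι] (D : LieData κ ι) (p : κ → ℝ) (w : ι → ℝ) :
    D.Carrier := (p, w)

theorem lie_inl_inl {κ ι : Type} [Fintype κ] [Fintype ι] (D : LieData κ ι) (p p' : κ → ℝ) :
    ⁅(D.elem p 0), D.elem p' 0⁆ = 0 := by
  refine Prod.ext ?_ rfl
  change D.op 0 *ᵥ p' - D.op 0 *ᵥ p + D.form 0 0 = 0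
  rw [op_zero, form_zero_left]
  simp

theorem lie_inr_inl {κ ι : Type} [Fintype κ] [Fintype ι] (D : LieData κ ι) (w : ι → ℝ)
    (p : κ → ℝ) : ⁅D.elem 0 w, (D.elem p 0)⁆ =
      D.elem (D.op w *ᵥ p) 0 := by
  refine Prod.ext ?_ rfl
  change D.op w *ᵥ p - D.op 0 *ᵥ 0 + D.form w 0 = _
  rw [form_zero_right, Matrix.mulVec_zero, sub_zero, add_zero]
  rfl

theorem snd_eq_zero_of_mem_derSpan {κ : Type} [Fintype κ] {D : LieData κ ι} {z : D.Carrier}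
    (hz : z ∈ derSpan D.Carrier) : z.2 = 0 := by
  induction hz using Submodule.span_induction with
  | mem x h => obtain ⟨a, b, rfl⟩ := h; rfl
  | zero => rfl
  | add x y _ _ hx hy =>
    change x.2 + y.2 = 0
    rw [hx, hy, add_zero]
  | smul c x _ hx =>
    change c • x.2 = 0
    rw [hx, smul_zero]

/-- The derived algebra lies in `span V`, and both have dimension two. -/
theorem mem_derSpan_of_snd_eq_zero {D : LieData (Fin 2) ι}
    (hd : Module.finrank ℝ (derSpan D.Carrier) = 2) {z : D.Carrier} (hz : z.2 = 0) :
    z ∈ derSpan D.Carrier := by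
  let W : Submodule ℝ D.Carrier := LinearMap.range (LinearMap.inl ℝ (Fin 2 → ℝ) (ι → ℝ))
  have hW : Module.finrank ℝ W = 2 := by
    refine (LinearMap.finrank_range_of_inj (f := LinearMap.inl ℝ (Fin 2 → ℝ) (ι → ℝ))
      LinearMap.inl_injective).trans ?_
    simp
  have hle : derSpan D.Carrier ≤ W := by
    intro y hy
    exact ⟨y.1, Prod.ext rfl (snd_eq_zero_of_mem_derSpan hy).symm⟩
  rw [Submodule.eq_of_le_of_finrank_eq hle (hd.trans hW.symm)]
  exact ⟨z.1, Prod.ext rfl hz.symm⟩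

/-- The map induced on `span V` by an isomorphism. -/
noncomputable def inducedMatrix {D : LieData (Fin 2) ι} {D' : LieData (Fin 2) ι'}
    (e : D.Carrier ≃ₗ⁅ℝ⁆ D'.Carrier) : Matrix (Fin 2) (Fin 2) ℝ :=
  LinearMap.toMatrix' ((LinearMap.fst ℝ (Fin 2 → ℝ) (ι' → ℝ)) ∘ₗ
    (e.toLinearEquiv : D.Carrier →ₗ[ℝ] D'.Carrier) ∘ₗ (LinearMap.inl ℝ (Fin 2 → ℝ) (ι → ℝ)))

theorem apply_inl {D : LieData (Fin 2) ι} {D' : LieData (Fin 2) ι'}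
    (e : D.Carrier ≃ₗ⁅ℝ⁆ D'.Carrier) (hd : Module.finrank ℝ (derSpan D.Carrier) = 2)
    (p : Fin 2 → ℝ) :
    e (D.elem p 0) = D'.elem (inducedMatrix e *ᵥ p) 0 := by
  refine Prod.ext ?_ ?_
  · rw [inducedMatrix, LinearMap.toMatrix'_mulVec]
    rfl
  · exact snd_eq_zero_of_mem_derSpan
      (e.apply_mem_derSpan_iff.2 (mem_derSpan_of_snd_eq_zero hd rfl))

theorem inducedMatrix_mul_symm {D : LieData (Fin 2) ι} {D' : LieData (Fin 2) ι'}
    (e : D.Carrier ≃ₗ⁅ℝ⁆ D'.Carrier) (hd : Module.finrank ℝ (derSpan D.Carrier) = 2) :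
    inducedMatrix e * inducedMatrix e.symm = 1 := by
  have hd' : Module.finrank ℝ (derSpan D'.Carrier) = 2 := by rw [← e.finrank_derSpan, hd]
  apply Matrix.ext_of_mulVec_single
  intro i
  have h := e.apply_symm_apply (D'.elem (Pi.single i 1) 0)
  rw [apply_inl e.symm hd', apply_inl e hd] at h
  rw [Matrix.one_mulVec, ← Matrix.mulVec_mulVec]
  exact congrArg Prod.fst h

/-- This is `e ∘ ad X = ad (e X) ∘ e` on the derived plane, where `ad (e X)` depends only on the
second component of `e X`. -/
theorem exists_op_conj {D : LieData (Fin 2) ι} {D' : LieData (Fin 2) ι'}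
    (e : D.Carrier ≃ₗ⁅ℝ⁆ D'.Carrier) (hd : Module.finrank ℝ (derSpan D.Carrier) = 2)
    (w : ι → ℝ) :
    ∃ w', D'.op w' = inducedMatrix e * D.op w * inducedMatrix e.symm := by
  set z := e (D.elem 0 w) with hz
  refine ⟨z.2, ?_⟩
  have key : inducedMatrix e * D.op w = D'.op z.2 * inducedMatrix e := by
    apply Matrix.ext_of_mulVec_single
    intro i
    have h := e.map_lie (D.elem 0 w)
      (D.elem (Pi.single i 1) 0)
    rw [lie_inr_inl, apply_inl e hd, apply_inl e hd, ← hz] at h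
    have h2 : inducedMatrix e *ᵥ (D.op w *ᵥ Pi.single i 1) =
        D'.op z.2 *ᵥ (inducedMatrix e *ᵥ Pi.single i 1) - D'.op 0 *ᵥ z.1 + D'.form z.2 0 :=
      congrArg Prod.fst h
    rw [form_zero_right, op_zero, Matrix.zero_mulVec, sub_zero, add_zero] at h2
    rw [← Matrix.mulVec_mulVec, h2, Matrix.mulVec_mulVec]
  rw [key, Matrix.mul_assoc, inducedMatrix_mul_symm e hd, Matrix.mul_one]

end LieData

/-- Every matrix of `S` has a partner in `S'` with the same trace and determinant, and equal to it
if it is scalar. -/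
def SpectralLE (S S' : Set (Matrix (Fin 2) (Fin 2) ℝ)) : Prop :=
  ∀ A ∈ S, ∃ A' ∈ S', A'.trace = A.trace ∧ A'.det = A.det ∧
    ∀ c : ℝ, A = c • (1 : Matrix (Fin 2) (Fin 2) ℝ) → A' = A

theorem LieData.spectralLE {ι ι' : Type} [Fintype ι] [Fintype ι'] {D : LieData (Fin 2) ι}
    {D' : LieData (Fin 2) ι'} (e : D.Carrier ≃ₗ⁅ℝ⁆ D'.Carrier)
    (hd : Module.finrank ℝ (derSpan D.Carrier) = 2) :
    SpectralLE (Set.range D.op) (Set.range D'.op) := by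
  have h1 := inducedMatrix_mul_symm e hd
  have h2 : inducedMatrix e.symm * inducedMatrix e = 1 := mul_eq_one_comm.1 h1
  rintro _ ⟨w, rfl⟩
  obtain ⟨w', hw'⟩ := exists_op_conj e hd w
  refine ⟨_, ⟨w', rfl⟩, ?_, ?_, ?_⟩
  · rw [hw', Matrix.trace_mul_comm, ← Matrix.mul_assoc, h2, Matrix.one_mul]
  · rw [hw', Matrix.det_mul, Matrix.det_mul, mul_comm (Matrix.det (inducedMatrix e)), mul_assoc,
      ← Matrix.det_mul, h1, Matrix.det_one, mul_one]
  · intro c hc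
    rw [hw', hc, Matrix.mul_smul, Matrix.mul_one, Matrix.smul_mul, h1]

theorem LieData.IsOneOp.mem_range_op {m : ℕ} {D : LieData (Fin 2) (Fin m)}
    {M : Matrix (Fin 2) (Fin 2) ℝ} {u : ℕ → ℕ → Fin 2 → ℝ} (hD : D.IsOneOp M u) (hm : 0 < m)
    {A : Matrix (Fin 2) (Fin 2) ℝ} : A ∈ Set.range D.op ↔ ∃ x : ℝ, A = x • M := by
  constructor
  · rintro ⟨w, rfl⟩
    exact ⟨_, hD.op_eq hm w⟩
  · rintro ⟨x, rfl⟩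
    exact ⟨fun _ => x, hD.op_eq hm _⟩

theorem LieData.IsTwoOp.mem_range_op {D : LieData (Fin 2) (Fin 2)}
    {P Q : Matrix (Fin 2) (Fin 2) ℝ} (hD : D.IsTwoOp P Q)
    {A : Matrix (Fin 2) (Fin 2) ℝ} : A ∈ Set.range D.op ↔ ∃ x y : ℝ, A = x • P + y • Q := by
  constructor
  · rintro ⟨w, rfl⟩
    exact ⟨_, _, hD.op_eq w⟩
  · rintro ⟨x, y, rfl⟩
    exact ⟨![x, y], hD.op_eq _⟩

/-! ### Separating the listed algebras -/

namespace Listed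

/-- The set of matrices of the operators `ad x` on `span {X_1, X_2}`. -/
def opSet (t : Listed) : Set (Matrix (Fin 2) (Fin 2) ℝ) := Set.range t.data.op

theorem mem_opSet_g3_1 {c : ℝ} {hc : c ≠ 0} {A : Matrix (Fin 2) (Fin 2) ℝ} :
    A ∈ (g3_1 c hc).opSet ↔ ∃ x : ℝ, A = !![x, 0; 0, x * c] := by
  refine ((isOneOp_g3_1 c hc).mem_range_op (by simp [codim])).trans ?_
  simp [Matrix.smul_of]

theorem mem_opSet_g3_2 {A : Matrix (Fin 2) (Fin 2) ℝ} :
    A ∈ g3_2.opSet ↔ ∃ x : ℝ, A = !![x, x; 0, x] := by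
  refine (isOneOp_g3_2.mem_range_op (by simp [codim])).trans ?_
  simp [Matrix.smul_of]

theorem mem_opSet_g3_3 {φ : ℝ} {hφ : φ ∈ Set.Ioo 0 Real.pi} {A : Matrix (Fin 2) (Fin 2) ℝ} :
    A ∈ (g3_3 φ hφ).opSet ↔ ∃ x : ℝ, A = !![x * Real.cos φ, -(x * Real.sin φ);
      x * Real.sin φ, x * Real.cos φ] := by
  refine ((isOneOp_g3_3 φ hφ).mem_range_op (by simp [codim])).trans ?_
  simp [Matrix.smul_of]

theorem mem_opSet_g4_1 {A : Matrix (Fin 2) (Fin 2) ℝ} :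
    A ∈ g4_1.opSet ↔ ∃ x : ℝ, A = !![x, 0; 0, 0] := by
  refine (isOneOp_g4_1.mem_range_op (by simp [codim])).trans ?_
  simp [Matrix.smul_of]

theorem mem_opSet_g4_2 {A : Matrix (Fin 2) (Fin 2) ℝ} :
    A ∈ g4_2.opSet ↔ ∃ x : ℝ, A = !![0, x; 0, 0] := by
  refine (isOneOp_g4_2.mem_range_op (by simp [codim])).trans ?_
  simp [Matrix.smul_of]

theorem mem_opSet_g4_3 {c : ℝ} {A : Matrix (Fin 2) (Fin 2) ℝ} :
    A ∈ (g4_3 c).opSet ↔ ∃ x y : ℝ, A = !![y, x; 0, x * c + y] := by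
  refine (isTwoOp_g4_3 c).mem_range_op.trans ?_
  simp [Matrix.smul_of]

theorem mem_opSet_affC {A : Matrix (Fin 2) (Fin 2) ℝ} :
    A ∈ affC.opSet ↔ ∃ x y : ℝ, A = !![y, x; -x, y] := by
  refine isTwoOp_affC.mem_range_op.trans ?_
  simp [Matrix.smul_of]

theorem mem_opSet_g6_1 {k : ℕ} {A : Matrix (Fin 2) (Fin 2) ℝ} :
    A ∈ (g6_1 k).opSet ↔ ∃ x : ℝ, A = !![x, 0; 0, 0] := by
  refine ((isOneOp_g6_1 k).mem_range_op (by simp [codim])).trans ?_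
  simp [Matrix.smul_of]

theorem mem_opSet_g6_2 {k : ℕ} {A : Matrix (Fin 2) (Fin 2) ℝ} :
    A ∈ (g6_2 k).opSet ↔ ∃ x : ℝ, A = !![0, 0; x, 0] := by
  refine ((isOneOp_g6_2 k).mem_range_op (by simp [codim])).trans ?_
  simp [Matrix.smul_of]

/-- The quotient `trace ^ 2 / det` does not change under scaling; equating `(1 + c) ^ 2 / c` for the
two parameters gives `(c - c') * (1 - c * c') = 0`. -/
theorem eq_or_eq_inv_of_spectralLE {c c' : ℝ} {hc : c ≠ 0} {hc' : c' ≠ 0}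
    (h : SpectralLE (g3_1 c hc).opSet (g3_1 c' hc').opSet) : c' = c ∨ c' = c⁻¹ := by
  obtain ⟨A', hA', htr, hdet, -⟩ := h _ (mem_opSet_g3_1.2 ⟨1, rfl⟩)
  obtain ⟨x, rfl⟩ := mem_opSet_g3_1.1 hA'
  simp only [Matrix.trace_fin_two_of, Matrix.det_fin_two_of] at htr hdet
  have hx : x ≠ 0 := by
    rintro rfl
    apply hc
    linarith
  have h1 : x ^ 2 * ((c - c') * (1 - c * c')) = 0 := by
    have e1 : c = x ^ 2 * c' := by linarith
    have e2 : 1 + c = x * (1 + c') := by linarith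
    linear_combination (-(x ^ 2 * c' * (1 + c) + x ^ 2 * c' * (x * (1 + c')))) * e2 +
      x ^ 2 * (1 + c') ^ 2 * e1
  rcases mul_eq_zero.1 ((mul_eq_zero.1 h1).resolve_left (pow_ne_zero 2 hx)) with h2 | h2
  · left; linarith
  · right
    exact eq_inv_of_mul_eq_one_right (by linarith)

/-- Trace and determinant force `c = 1`; then the scalar clause would put the identity among the
multiples of a Jordan block. -/
theorem not_spectralLE_g3_1_g3_2 {c : ℝ} {hc : c ≠ 0} :
    ¬ SpectralLE (g3_1 c hc).opSet g3_2.opSet := by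
  intro h
  obtain ⟨A', hA', htr, hdet, hs⟩ := h _ (mem_opSet_g3_1.2 ⟨1, rfl⟩)
  obtain ⟨x, rfl⟩ := mem_opSet_g3_2.1 hA'
  simp only [Matrix.trace_fin_two_of, Matrix.det_fin_two_of] at htr hdet
  have hc1 : c = 1 := by nlinarith [sq_nonneg (c - 1)]
  subst hc1
  have h1 := hs 1 (by ext i j; fin_cases i <;> fin_cases j <;> simp)
  have h01 := congrFun (congrFun h1 0) 1
  have h00 := congrFun (congrFun h1 0) 0
  simp at h01 h00
  linarith

/-- Equal discriminants would give `(1 - c) ^ 2 = -4 * (x * sin φ) ^ 2`. -/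
theorem not_spectralLE_g3_1_g3_3 {c : ℝ} {hc : c ≠ 0} {φ : ℝ} {hφ : φ ∈ Set.Ioo 0 Real.pi} :
    ¬ SpectralLE (g3_1 c hc).opSet (g3_3 φ hφ).opSet := by
  intro h
  obtain ⟨A', hA', htr, hdet, -⟩ := h _ (mem_opSet_g3_1.2 ⟨1, rfl⟩)
  obtain ⟨x, rfl⟩ := mem_opSet_g3_3.1 hA'
  simp only [Matrix.trace_fin_two_of, Matrix.det_fin_two_of] at htr hdet
  have hsin := Real.sin_pos_of_mem_Ioo hφ
  have hsc := Real.sin_sq_add_cos_sq φ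
  have hc2 : c = x ^ 2 := by linear_combination -hdet + x ^ 2 * hsc
  have h1 : (1 - c) ^ 2 + 4 * (x * Real.sin φ) ^ 2 = 0 := by
    have : (1 + c) ^ 2 = (2 * (x * Real.cos φ)) ^ 2 := by
      congr 1; linarith
    linear_combination this + 4 * x ^ 2 * hsc - 4 * hc2
  have h2 : x * Real.sin φ = 0 := by
    have := sq_nonneg (1 - c)
    have := sq_nonneg (x * Real.sin φ)
    exact pow_eq_zero_iff (two_ne_zero) |>.1 (by linarith)
  have hx := (mul_eq_zero.1 h2).resolve_right hsin.ne'
  apply hc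
  rw [hc2, hx]; norm_num

theorem not_spectralLE_g3_2_g3_3 {φ : ℝ} {hφ : φ ∈ Set.Ioo 0 Real.pi} :
    ¬ SpectralLE g3_2.opSet (g3_3 φ hφ).opSet := by
  intro h
  obtain ⟨A', hA', htr, hdet, -⟩ := h _ (mem_opSet_g3_2.2 ⟨1, rfl⟩)
  obtain ⟨x, rfl⟩ := mem_opSet_g3_3.1 hA'
  simp only [Matrix.trace_fin_two_of, Matrix.det_fin_two_of] at htr hdet
  have hsin := Real.sin_pos_of_mem_Ioo hφ
  have h1 : x * Real.cos φ = 1 := by linarith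
  have h2 : x * Real.sin φ = 0 := by
    rw [h1] at hdet
    exact pow_eq_zero_iff (two_ne_zero) |>.1 (by linarith)
  have hx := (mul_eq_zero.1 h2).resolve_right hsin.ne'
  rw [hx] at h1
  norm_num at h1

/-- Determinants give `x ^ 2 = 1`; the sign of `x` decides between `cos φ' = cos φ` and `cos φ' =
-cos φ`. -/
theorem eq_or_eq_pi_sub_of_spectralLE {φ φ' : ℝ} {hφ : φ ∈ Set.Ioo 0 Real.pi}
    {hφ' : φ' ∈ Set.Ioo 0 Real.pi} (h : SpectralLE (g3_3 φ hφ).opSet (g3_3 φ' hφ').opSet) :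
    φ' = φ ∨ φ' = Real.pi - φ := by
  obtain ⟨A', hA', htr, hdet, -⟩ := h _ (mem_opSet_g3_3.2 ⟨1, rfl⟩)
  obtain ⟨x, rfl⟩ := mem_opSet_g3_3.1 hA'
  simp only [Matrix.trace_fin_two_of, Matrix.det_fin_two_of] at htr hdet
  have hsc := Real.sin_sq_add_cos_sq φ
  have hsc' := Real.sin_sq_add_cos_sq φ'
  have hx : (x - 1) * (x + 1) = 0 := by linear_combination hdet - x ^ 2 * hsc' + hsc
  rcases mul_eq_zero.1 hx with h1 | h1
  · left
    have hx1 : x = 1 := by linarith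
    rw [hx1] at htr
    exact Real.injOn_cos ⟨hφ'.1.le, hφ'.2.le⟩ ⟨hφ.1.le, hφ.2.le⟩ (by linarith)
  · right
    have hx1 : x = -1 := by linarith
    rw [hx1] at htr
    refine Real.injOn_cos ⟨hφ'.1.le, hφ'.2.le⟩
      ⟨by linarith [hφ.2], by linarith [hφ.1]⟩ ?_
    rw [Real.cos_pi_sub]
    linarith

theorem not_spectralLE_g4_1_g4_2 : ¬ SpectralLE g4_1.opSet g4_2.opSet := by
  intro h
  obtain ⟨A', hA', htr, -, -⟩ := h _ (mem_opSet_g4_1.2 ⟨1, rfl⟩)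
  obtain ⟨x, rfl⟩ := mem_opSet_g4_2.1 hA'
  simp [Matrix.trace_fin_two_of] at htr

theorem not_spectralLE_g6_1_g6_2 {k k' : ℕ} : ¬ SpectralLE (g6_1 k).opSet (g6_2 k').opSet := by
  intro h
  obtain ⟨A', hA', htr, -, -⟩ := h _ (mem_opSet_g6_1.2 ⟨1, rfl⟩)
  obtain ⟨x, rfl⟩ := mem_opSet_g6_2.1 hA'
  simp [Matrix.trace_fin_two_of] at htr

theorem not_spectralLE_of_one_mem {S S' : Set (Matrix (Fin 2) (Fin 2) ℝ)} (h1 : 1 ∈ S)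
    (h2 : ∀ A ∈ S', A.det = 0) : ¬ SpectralLE S S' := by
  intro h
  obtain ⟨A', hA', -, hdet, -⟩ := h _ h1
  rw [h2 A' hA', Matrix.det_one] at hdet
  exact zero_ne_one hdet

theorem one_mem_opSet_g4_3 (c : ℝ) : 1 ∈ (g4_3 c).opSet :=
  mem_opSet_g4_3.2 ⟨0, 1, by ext i j; fin_cases i <;> fin_cases j <;> simp⟩

theorem one_mem_opSet_affC : 1 ∈ affC.opSet :=
  mem_opSet_affC.2 ⟨0, 1, by ext i j; fin_cases i <;> fin_cases j <;> simp⟩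

theorem det_eq_zero_of_mem_opSet_g4_1 : ∀ A ∈ g4_1.opSet, A.det = 0 := by
  intro A hA
  obtain ⟨x, rfl⟩ := mem_opSet_g4_1.1 hA
  simp [Matrix.det_fin_two_of]

theorem det_eq_zero_of_mem_opSet_g4_2 : ∀ A ∈ g4_2.opSet, A.det = 0 := by
  intro A hA
  obtain ⟨x, rfl⟩ := mem_opSet_g4_2.1 hA
  simp [Matrix.det_fin_two_of]

/-- For parameter `0` every singular operator has trace zero, while `X_3` in `g4_3 c` acts
singularly with trace `c`. -/
theorem eq_zero_of_spectralLE_g4_3 {c : ℝ} (h : SpectralLE (g4_3 c).opSet (g4_3 0).opSet) :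
    c = 0 := by
  obtain ⟨A', hA', htr, hdet, -⟩ := h _ (mem_opSet_g4_3.2 ⟨1, 0, rfl⟩)
  obtain ⟨x, y, rfl⟩ := mem_opSet_g4_3.1 hA'
  simp only [Matrix.trace_fin_two_of, Matrix.det_fin_two_of] at htr hdet
  have hy : y = 0 := pow_eq_zero_iff (two_ne_zero) |>.1 (by linarith : y ^ 2 = 0)
  rw [hy] at htr
  linarith

/-- A trace-zero operator of `g4_3 c` is triangular with determinant `-y ^ 2`, whereas `affC` has
one of determinant `1`. -/
theorem not_spectralLE_affC_g4_3 {c : ℝ} : ¬ SpectralLE affC.opSet (g4_3 c).opSet := by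
  intro h
  obtain ⟨A', hA', htr, hdet, -⟩ := h _ (mem_opSet_affC.2 ⟨1, 0, rfl⟩)
  obtain ⟨x, y, rfl⟩ := mem_opSet_g4_3.1 hA'
  simp only [Matrix.trace_fin_two_of, Matrix.det_fin_two_of] at htr hdet
  have h1 : x * c + y = -y := by linarith
  rw [h1] at hdet
  nlinarith [sq_nonneg y]

theorem codim_eq_of_equiv {t s : Listed} (e : t.Alg ≃ₗ⁅ℝ⁆ s.Alg) : t.codim = s.codim := by
  have := e.toLinearEquiv.finrank_eq
  rw [LieData.finrank_carrier, LieData.finrank_carrier] at this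
  simpa using this

/-- Reducedness excludes `g4_3 c` with `c ≠ 0`: these are all isomorphic to a sum of two copies of
`aff(ℝ)`, so their parameter is not an invariant. From dimension five on, dimension leaves only
`g6_1` and `g6_2` to be told apart. -/
theorem same_of_equiv {t s : Listed} (ht : t.IsReduced) (e : t.Alg ≃ₗ⁅ℝ⁆ s.Alg)
    (hd : Module.finrank ℝ (derSpan t.Alg) = 2) : Same t s := by
  have hcodim := codim_eq_of_equiv e
  have hts : SpectralLE t.opSet s.opSet := LieData.spectralLE e hd
  have hst : SpectralLE s.opSet t.opSet :=
    LieData.spectralLE e.symm (by rw [← e.finrank_derSpan, hd])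
  cases t with
  | g3_1 c hc =>
    cases s with
    | g3_1 c' hc' => exact eq_or_eq_inv_of_spectralLE hts
    | g3_2 => exact (not_spectralLE_g3_1_g3_2 hts).elim
    | g3_3 φ hφ => exact (not_spectralLE_g3_1_g3_3 hts).elim
    | _ => exfalso; simp only [codim] at hcodim; omega
  | g3_2 =>
    cases s with
    | g3_1 c' hc' => exact (not_spectralLE_g3_1_g3_2 hst).elim
    | g3_2 => exact rfl
    | g3_3 φ hφ => exact (not_spectralLE_g3_2_g3_3 hts).elim
    | _ => exfalso; simp only [codim] at hcodim; omega
  | g3_3 φ hφ =>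
    cases s with
    | g3_1 c' hc' => exact (not_spectralLE_g3_1_g3_3 hst).elim
    | g3_2 => exact (not_spectralLE_g3_2_g3_3 hst).elim
    | g3_3 φ' hφ' => exact eq_or_eq_pi_sub_of_spectralLE hts
    | _ => exfalso; simp only [codim] at hcodim; omega
  | g4_1 =>
    cases s with
    | g4_1 => exact rfl
    | g4_2 => exact (not_spectralLE_g4_1_g4_2 hts).elim
    | g4_3 c => exact (not_spectralLE_of_one_mem (one_mem_opSet_g4_3 c)
        det_eq_zero_of_mem_opSet_g4_1 hst).elim
    | affC => exact (not_spectralLE_of_one_mem one_mem_opSet_affC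
        det_eq_zero_of_mem_opSet_g4_1 hst).elim
    | _ => exfalso; simp only [codim] at hcodim; omega
  | g4_2 =>
    cases s with
    | g4_1 => exact (not_spectralLE_g4_1_g4_2 hst).elim
    | g4_2 => exact rfl
    | g4_3 c => exact (not_spectralLE_of_one_mem (one_mem_opSet_g4_3 c)
        det_eq_zero_of_mem_opSet_g4_2 hst).elim
    | affC => exact (not_spectralLE_of_one_mem one_mem_opSet_affC
        det_eq_zero_of_mem_opSet_g4_2 hst).elim
    | _ => exfalso; simp only [codim] at hcodim; omega
  | g4_3 c =>
    obtain rfl : c = 0 := ht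
    cases s with
    | g4_1 => exact (not_spectralLE_of_one_mem (one_mem_opSet_g4_3 0)
        det_eq_zero_of_mem_opSet_g4_1 hts).elim
    | g4_2 => exact (not_spectralLE_of_one_mem (one_mem_opSet_g4_3 0)
        det_eq_zero_of_mem_opSet_g4_2 hts).elim
    | g4_3 c' =>
      obtain rfl := eq_zero_of_spectralLE_g4_3 hst
      exact rfl
    | affC => exact (not_spectralLE_affC_g4_3 hst).elim
    | _ => exfalso; simp only [codim] at hcodim; omega
  | affC =>
    cases s with
    | g4_1 => exact (not_spectralLE_of_one_mem one_mem_opSet_affC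
        det_eq_zero_of_mem_opSet_g4_1 hts).elim
    | g4_2 => exact (not_spectralLE_of_one_mem one_mem_opSet_affC
        det_eq_zero_of_mem_opSet_g4_2 hts).elim
    | g4_3 c' => exact (not_spectralLE_affC_g4_3 hts).elim
    | affC => exact rfl
    | _ => exfalso; simp only [codim] at hcodim; omega
  | g5 k =>
    cases s with
    | g5 k' =>
      obtain rfl : k = k' := by simp only [codim] at hcodim; omega
      exact rfl
    | _ => exfalso; simp only [codim] at hcodim; omega
  | g6_1 k =>
    cases s with
    | g6_1 k' =>
      obtain rfl : k = k' := by simp only [codim] at hcodim; omega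
      exact rfl
    | g6_2 k' => exact (not_spectralLE_g6_1_g6_2 hts).elim
    | _ => exfalso; simp only [codim] at hcodim; omega
  | g6_2 k =>
    cases s with
    | g6_1 k' => exact (not_spectralLE_g6_1_g6_2 hst).elim
    | g6_2 k' =>
      obtain rfl : k = k' := by simp only [codim] at hcodim; omega
      exact rfl
    | _ => exfalso; simp only [codim] at hcodim; omega

end Listed

/-! ### The isomorphisms within the two parametric families -/

namespace LieData

/-- Isomorphism of three-dimensional algebras induced by `Q⁻¹ M Q = c M'`, where the columns of `Q`
are `p` and `p'`. -/
theorem IsOneOp.equiv_of_conj {D D' : LieData (Fin 2) (Fin 1)}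
    {M M' : Matrix (Fin 2) (Fin 2) ℝ} {u u' : ℕ → ℕ → Fin 2 → ℝ} (hD : D.IsOneOp M u)
    (hD' : D'.IsOneOp M' u') (hDc : D.CenterLE) (hu : ∀ p q, u p q = 0) {p p' : Fin 2 → ℝ} {c : ℝ}
    (hc : c ≠ 0) (hp : LinearIndependent ℝ ![p, p'])
    (h1 : c • (M' *ᵥ p) = M 0 0 • p + M 1 0 • p')
    (h2 : c • (M' *ᵥ p') = M 0 1 • p + M 1 1 • p') :
    Nonempty (D.Carrier ≃ₗ⁅ℝ⁆ D'.Carrier) := by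
  have hop : D'.op (fun _ => c) = c • M' := hD'.op_eq Nat.one_pos _
  refine hD.nonempty_equiv_three hDc hu (X₁ := D'.elem p 0)
    (X₂ := D'.elem p' 0)
    (X₃ := D'.elem 0 fun _ => c) (lie_inl_inl _ _ _) ?_ ?_ ?_ ?_
  · rw [LinearIndependent.pair_iff]
    intro s t hst
    exact pair_coeff_eq_zero hp (congrArg Prod.fst hst)
  · rw [lie_inr_inl, hop, Matrix.smul_mulVec, h1]
    refine Prod.ext rfl ?_
    change (0 : Fin 1 → ℝ) = M 0 0 • 0 + M 1 0 • 0
    simp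
  · rw [lie_inr_inl, hop, Matrix.smul_mulVec, h2]
    refine Prod.ext rfl ?_
    change (0 : Fin 1 → ℝ) = M 0 1 • 0 + M 1 1 • 0
    simp
  · intro g
    have hV : Module.finrank ℝ (⊤ : Submodule ℝ (Fin 2 → ℝ)) = 2 := by simp
    obtain ⟨α, β, h⟩ := exists_eq_of_mem hV (v := g.1) trivial trivial hp trivial
    refine ⟨α, β, g.2 0 / c, Prod.ext ?_ ?_⟩
    · change g.1 = α • p + β • p' + (g.2 0 / c) • 0
      rw [h, smul_zero, add_zero]
    · change g.2 = α • 0 + β • 0 + (g.2 0 / c) • (fun _ => c)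
      funext i
      rw [Subsingleton.elim i 0]
      simp [hc]

end LieData

theorem Listed.equiv_of_same {t s : Listed} (h : Same t s) : Nonempty (t.Alg ≃ₗ⁅ℝ⁆ s.Alg) := by
  cases t with
  | g3_1 c hc =>
    cases s with
    | g3_1 c' hc' =>
      rcases h with rfl | rfl
      · exact ⟨LieEquiv.refl⟩
      -- `c • diag(1, c⁻¹) = diag(c, 1)`, and interchanging the basis vectors gives `diag(1, c)`.
      · refine (isOneOp_g3_1 c hc).equiv_of_conj (isOneOp_g3_1 c⁻¹ hc') (centerLE_g3_1 c hc)
          (fun _ _ => rfl) (p := ![0, 1]) (p' := ![1, 0]) hc ?_ ?_ ?_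
        · rw [LinearIndependent.pair_iff]
          intro s t hst
          have h0 := congrFun hst 0
          have h1 := congrFun hst 1
          simp at h0 h1
          exact ⟨h1, h0⟩
        · ext i; fin_cases i <;> simp [hc]
        · ext i; fin_cases i <;> simp
    | _ => obtain h : _ = _ := h; cases h
  | g3_3 φ hφ =>
    cases s with
    | g3_3 φ' hφ' =>
      rcases h with rfl | rfl
      · exact ⟨LieEquiv.refl⟩
      -- Minus the rotation by `π - φ` is the rotation by `-φ`; reflecting the second basis vector
      -- turns it into the rotation by `φ`.
      · refine (isOneOp_g3_3 φ hφ).equiv_of_conj (isOneOp_g3_3 _ hφ') (centerLE_g3_3 φ hφ)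
          (fun _ _ => rfl) (p := ![1, 0]) (p' := ![0, -1]) (c := -1) (by norm_num) ?_ ?_ ?_
        · rw [LinearIndependent.pair_iff]
          intro s t hst
          have h0 := congrFun hst 0
          have h1 := congrFun hst 1
          simp at h0 h1
          exact ⟨h0, h1⟩
        · ext i; fin_cases i <;> simp
        · ext i; fin_cases i <;> simp
    | _ => obtain h : _ = _ := h; cases h
  | _ =>
    obtain h : _ = s := by cases s <;> exact h
    subst h
    exact ⟨LieEquiv.refl⟩

/-! ### Classification of the decomposable algebras -/

section Decomposable

variable {G : Type*} [LieRing G] [LieAlgebra ℝ G]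

theorem lie_eq_zero_of_finrank_derSpan_eq_zero [FiniteDimensional ℝ G]
    (h : Module.finrank ℝ (derSpan G) = 0) (x y : G) : ⁅x, y⁆ = 0 := by
  have := lie_mem_derSpan x y
  rwa [Submodule.finrank_eq_zero.1 h, Submodule.mem_bot] at this

theorem CentralInDerived.finrank_derSpan_ne_zero [FiniteDimensional ℝ G]
    (hZ : CentralInDerived G) (hG : ∃ x : G, x ≠ 0) : Module.finrank ℝ (derSpan G) ≠ 0 := by
  intro h
  obtain ⟨x, hx⟩ := hG
  have := hZ x fun y => lie_eq_zero_of_finrank_derSpan_eq_zero h y x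
  rw [Submodule.finrank_eq_zero.1 h, Submodule.mem_bot] at this
  exact hx this

theorem exists_lie_lie_ne_zero_of_equiv {H : Type*} [LieRing H] [LieAlgebra ℝ H] (e : G ≃ₗ⁅ℝ⁆ H)
    (h : ∃ x y z : G, ⁅x, ⁅y, z⁆⁆ ≠ 0) : ∃ x y z : H, ⁅x, ⁅y, z⁆⁆ ≠ 0 := by
  obtain ⟨x, y, z, hxyz⟩ := h
  refine ⟨e x, e y, e z, fun h0 => hxyz (e.injective ?_)⟩
  change e ⁅x, ⁅y, z⁆⁆ = e 0
  rw [LieEquiv.map_lie, LieEquiv.map_lie, h0, map_zero]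

/-- Decomposable algebras without abelian direct summand. -/
theorem equiv_of_isDecomposable_of_centralInDerived [FiniteDimensional ℝ G]
    (hd : Module.finrank ℝ (derSpan G) = 2) (hN : ∃ x y z : G, ⁅x, ⁅y, z⁆⁆ ≠ 0)
    (hZ : CentralInDerived G) (hD : IsDecomposable G) :
    Nonempty (G ≃ₗ⁅ℝ⁆ affR.Carrier × affR.Carrier) ∨
      ∃ m, 1 ≤ m ∧ Nonempty (G ≃ₗ⁅ℝ⁆ affR.Carrier × (heis m).Carrier) := by
  obtain ⟨I, J, hI, hJ, hIJ⟩ := hD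
  let Φ := (lieEquivProdOfIsCompl I J hIJ).symm
  have hZ' := hZ.of_equiv Φ
  have hd' := Φ.finrank_derSpan
  rw [hd, finrank_derSpan_prod] at hd'
  have hne : ∀ K : LieIdeal ℝ G, K ≠ ⊥ → ∃ x : K, x ≠ 0 := by
    intro K hK
    by_contra! h
    exact hK ((LieSubmodule.eq_bot_iff K).2 fun x hx => congrArg Subtype.val (h ⟨x, hx⟩))
  have hI0 := hZ'.fst.finrank_derSpan_ne_zero (hne I hI)
  have hJ0 := hZ'.snd.finrank_derSpan_ne_zero (hne J hJ)
  -- The dimensions of the two derived algebras are nonzero and add up to two, so each is one.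
  rcases equiv_affR_or_heis (by omega) hZ'.fst with ⟨⟨f⟩⟩ | ⟨⟨m, hm, ⟨f⟩⟩, hf⟩ <;>
  rcases equiv_affR_or_heis (by omega) hZ'.snd with ⟨⟨g⟩⟩ | ⟨⟨m', hm', ⟨g⟩⟩, hg⟩
  · exact Or.inl ⟨Φ.trans (lieEquivProdCongr f.symm g.symm)⟩
  · exact Or.inr ⟨m', hm', ⟨Φ.trans (lieEquivProdCongr f.symm g.symm)⟩⟩
  · exact Or.inr ⟨m, hm, ⟨(Φ.trans (LieEquiv.prodComm ℝ _ _)).trans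
      (lieEquivProdCongr g.symm f.symm)⟩⟩
  · exfalso
    obtain ⟨x, y, z, h⟩ := exists_lie_lie_ne_zero_of_equiv Φ hN
    exact h (Prod.ext (hf _ _ _) (hg _ _ _))

theorem equiv_prod_abelianR_zero : Nonempty (G ≃ₗ⁅ℝ⁆ G × (abelianR 0).Carrier) := by
  have : Subsingleton (abelianR 0).Carrier :=
    inferInstanceAs (Subsingleton ((Fin 0 → ℝ) × (Fin 0 → ℝ)))
  exact ⟨LieEquiv.ofBijective (LieHom.inl ℝ G _) ⟨LieHom.inl_injective,
    fun x => ⟨x.1, Prod.ext rfl (Subsingleton.elim _ _)⟩⟩⟩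

theorem lie_abelianR (r : ℕ) (x y : (abelianR r).Carrier) : ⁅x, y⁆ = 0 := by
  refine Prod.ext ?_ rfl
  change (abelianR _).op _ *ᵥ _ - (abelianR _).op _ *ᵥ _ + (abelianR _).form _ _ = 0
  simp [LieData.op, LieData.form]

theorem finrank_derSpan_abelianR (r : ℕ) :
    Module.finrank ℝ (derSpan (abelianR r).Carrier) = 0 := by
  have : derSpan (abelianR r).Carrier = ⊥ := by
    rw [eq_bot_iff]
    refine Submodule.span_le.2 ?_
    rintro _ ⟨x, y, rfl⟩
    exact lie_abelianR r x y
  rw [this, finrank_bot]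

/-- Classification of the decomposable algebras. -/
theorem equiv_of_isDecomposable [FiniteDimensional ℝ G]
    (hd : Module.finrank ℝ (derSpan G) = 2) (hN : ∃ x y z : G, ⁅x, ⁅y, z⁆⁆ ≠ 0)
    (hD : IsDecomposable G) :
    (∃ r : ℕ, Nonempty (G ≃ₗ⁅ℝ⁆ (affR.Carrier × affR.Carrier) × (abelianR r).Carrier)) ∨
    (∃ m r : ℕ, 1 ≤ m ∧
      Nonempty (G ≃ₗ⁅ℝ⁆ (affR.Carrier × (heis m).Carrier) × (abelianR r).Carrier)) ∨
    (∃ (t : Listed) (r : ℕ), 1 ≤ r ∧ Nonempty (G ≃ₗ⁅ℝ⁆ t.Alg × (abelianR r).Carrier)) := by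
  -- If the centre lies in the derived algebra, no abelian summand is needed and `r = 0`; otherwise
  -- the summand split off is nonzero.
  by_cases hZ : CentralInDerived G
  · rcases equiv_of_isDecomposable_of_centralInDerived hd hN hZ hD with ⟨⟨f⟩⟩ | ⟨m, hm, ⟨f⟩⟩
    · obtain ⟨g⟩ := equiv_prod_abelianR_zero (G := affR.Carrier × affR.Carrier)
      exact Or.inl ⟨0, ⟨f.trans g⟩⟩
    · obtain ⟨g⟩ := equiv_prod_abelianR_zero (G := affR.Carrier × (heis m).Carrier)
      exact Or.inr (Or.inl ⟨m, 0, hm, ⟨f.trans g⟩⟩)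
  · obtain ⟨L, r, hZL, ⟨Φ⟩, hr⟩ := exists_centralInDerived_summand (G := G)
    have hr1 : 1 ≤ r := Nat.one_le_iff_ne_zero.2 fun h => hZ (hr h)
    have hdL : Module.finrank ℝ (derSpan L) = 2 := by
      have := Φ.finrank_derSpan
      rw [hd, finrank_derSpan_prod, finrank_derSpan_abelianR] at this
      omega
    have hNL : ∃ x y z : L, ⁅x, ⁅y, z⁆⁆ ≠ 0 := by
      obtain ⟨x, y, z, h⟩ := exists_lie_lie_ne_zero_of_equiv Φ hN
      exact ⟨x.1, y.1, z.1, fun h0 => h (Prod.ext h0 (lie_abelianR r _ _))⟩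
    by_cases hDL : IsDecomposable L
    · rcases equiv_of_isDecomposable_of_centralInDerived hdL hNL hZL hDL with
        ⟨⟨f⟩⟩ | ⟨m, hm, ⟨f⟩⟩
      · exact Or.inl ⟨r, ⟨Φ.trans (lieEquivProdCongr f LieEquiv.refl)⟩⟩
      · exact Or.inr (Or.inl ⟨m, r, hm, ⟨Φ.trans (lieEquivProdCongr f LieEquiv.refl)⟩⟩)
    · obtain ⟨t, -, ⟨f⟩⟩ := exists_equiv_of_not_isDecomposable hdL hNL hDL
      exact Or.inr (Or.inr ⟨t, r, hr1, ⟨Φ.trans (lieEquivProdCongr f.symm LieEquiv.refl)⟩⟩)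

end Decomposable

/-! ### Adapted bases and the final assembly -/

section Bases

theorem LieData.exists_basis_gen {κ ι : Type} [Fintype κ] [Fintype ι] [DecidableEq κ]
    [DecidableEq ι] (D : LieData κ ι) : ∃ b : Module.Basis (κ ⊕ ι) ℝ D.Carrier,
      ∀ i, b i = D.gen i := by
  let b : Module.Basis (κ ⊕ ι) ℝ ((κ → ℝ) × (ι → ℝ)) :=
    (Pi.basisFun ℝ κ).prod (Pi.basisFun ℝ ι)
  refine ⟨b, ?_⟩
  rintro (i | i)
  · change b (Sum.inl i) = (Pi.single i 1, 0)
    simp [b]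
  · change b (Sum.inr i) = (0, Pi.single i 1)
    simp [b]

theorem Module.Basis.span_image_lt_two {E : Type*} [AddCommGroup E] [Module ℝ E] {n : ℕ}
    (b : Module.Basis (Fin n) ℝ E) {V : Submodule ℝ E} (hV : Module.finrank ℝ V = 2) (hn : 2 ≤ n)
    (h : ∀ i : Fin n, (i : ℕ) < 2 → b i ∈ V) :
    V = Submodule.span ℝ (b '' {i | (i : ℕ) < 2}) := by
  have : FiniteDimensional ℝ V := Module.finite_of_finrank_pos (by omega)
  symm
  refine Submodule.eq_of_le_of_finrank_eq ?_ ?_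
  · refine Submodule.span_le.2 ?_
    rintro _ ⟨i, hi, rfl⟩
    exact h i hi
  · have hli : LinearIndependent ℝ (b ∘ Fin.castLE hn) :=
      b.linearIndependent.comp _ (Fin.castLE_injective hn)
    have hset : b '' {i : Fin n | (i : ℕ) < 2} = Set.range (b ∘ Fin.castLE hn) := by
      rw [Set.range_comp]
      congr 1
      ext i
      constructor
      · intro hi
        exact ⟨⟨i, hi⟩, rfl⟩
      · rintro ⟨j, rfl⟩
        exact j.2
    rw [hset, hV]
    exact (finrank_span_eq_card hli).trans (by simp)

theorem exists_basis_mem {E : Type*} [AddCommGroup E] [Module ℝ E] [FiniteDimensional ℝ E] {n : ℕ}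
    (hn : Module.finrank ℝ E = n) {V : Submodule ℝ E} (hV : Module.finrank ℝ V = 2) :
    2 ≤ n ∧ ∃ b : Module.Basis (Fin n) ℝ E, ∀ i : Fin n, (i : ℕ) < 2 → b i ∈ V := by
  obtain ⟨W, hW⟩ := exists_isCompl V
  have hsum := Submodule.finrank_add_eq_of_isCompl hW
  have hn' : 2 + Module.finrank ℝ W = n := by omega
  let b := ((Module.finBasisOfFinrankEq ℝ V hV).prod (Module.finBasis ℝ W)).map
    (Submodule.prodEquivOfIsCompl V W hW)
  refine ⟨by omega, (b.reindex finSumFinEquiv).reindex (finCongr hn'), ?_⟩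
  intro i hi
  have : finSumFinEquiv.symm ((finCongr hn').symm i) = Sum.inl ⟨i, hi⟩ := by
    rw [Equiv.symm_apply_eq]
    exact Fin.ext rfl
  rw [Module.Basis.reindex_apply, Module.Basis.reindex_apply, this]
  simp [b]

/-- The basis of an algebra isomorphic to a listed one that has the listed brackets. -/
theorem Listed.exists_basis_vec {G : Type*} [LieRing G] [LieAlgebra ℝ G] {t : Listed}
    (e : G ≃ₗ⁅ℝ⁆ t.Alg) (hd : Module.finrank ℝ (derSpan G) = 2) {n : ℕ} (h : n = t.dim) :
    ∃ b : Module.Basis (Fin n) ℝ G, (∀ i, e (b i) = t.data.vec (Fin.cast h i)) ∧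
      ∀ i : Fin n, (i : ℕ) < 2 → b i ∈ derSpan G := by
  obtain ⟨b₀, hb₀⟩ := t.data.exists_basis_gen
  have hb : ∀ i, e ((((b₀.map e.symm.toLinearEquiv).reindex finSumFinEquiv).reindex
      (finCongr h.symm)) i) = t.data.vec (Fin.cast h i) := by
    intro i
    rw [Module.Basis.reindex_apply, Module.Basis.reindex_apply, Module.Basis.map_apply, hb₀]
    exact e.apply_symm_apply _
  refine ⟨_, hb, ?_⟩
  intro i hi
  rw [← e.apply_mem_derSpan_iff, hb]
  refine LieData.mem_derSpan_of_snd_eq_zero (by rw [← e.finrank_derSpan, hd]) ?_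
  have : finSumFinEquiv.symm (Fin.cast h i) = (Sum.inl ⟨i, hi⟩ : Fin 2 ⊕ Fin t.codim) := by
    rw [Equiv.symm_apply_eq]
    exact Fin.ext rfl
  rw [LieData.vec, this]
  rfl

end Bases

theorem exists_lie_lie_ne_zero {G : Type*} [LieRing G] [LieAlgebra ℝ G]
    (hd : Module.finrank ℝ (derSpan G) = 2) (h : ¬ IsStepNilpotent G 2) :
    ∃ x y z : G, ⁅x, ⁅y, z⁆⁆ ≠ 0 := by
  by_contra! h0
  refine h ⟨by norm_num, ?_, ?_⟩
  · intro h1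
    have h2 : (LieAlgebra.derivedSeries ℝ G 1).toSubmodule = ⊥ := congrArg LieSubmodule.toSubmodule h1
    rw [derivedSeries_one_eq_derSpan] at h2
    rw [h2, finrank_bot] at hd
    omega
  · rw [LieModule.lowerCentralSeries_succ, LieSubmodule.lie_eq_bot_iff]
    intro x _ m hm
    have hm' : m ∈ derSpan G := by
      rw [← derivedSeries_one_eq_derSpan]
      exact hm
    clear hm
    induction hm' using Submodule.span_induction with
    | mem m h => obtain ⟨a, b, rfl⟩ := h; exact h0 _ _ _
    | zero => exact lie_zero _
    | add a b _ _ ha hb => rw [lie_add, ha, hb, add_zero]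
    | smul c a _ ha => rw [lie_smul, ha, smul_zero]

theorem mainTheorem1 (n : ℕ) (G : Type*) [LieRing G] [LieAlgebra ℝ G] [FiniteDimensional ℝ G]
    [LieAlgebra.IsSolvable G] (hn : Module.finrank ℝ G = n)
    (hG1 : Module.finrank ℝ (LieAlgebra.derivedSeries ℝ G 1) = 2)
    (hG2 : ¬ IsStepNilpotent G 2) :
    ∃ b : Module.Basis (Fin n) ℝ G,
      (LieAlgebra.derivedSeries ℝ G 1).toSubmodule = Submodule.span ℝ (b '' {i | (i : ℕ) < 2}) ∧
      IsLieAbelian (LieAlgebra.derivedSeries ℝ G 1) ∧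
      (¬ IsDecomposable G →
        ∃ t : Listed,
          (∃ (h : n = t.dim) (e : G ≃ₗ⁅ℝ⁆ t.Alg), ∀ i, e (b i) = t.data.vec (Fin.cast h i)) ∧
          ∀ s : Listed, Nonempty (G ≃ₗ⁅ℝ⁆ s.Alg) ↔ Listed.Same t s) ∧
      (IsDecomposable G →
        (∃ r : ℕ, n = 4 + r ∧
          Nonempty (G ≃ₗ⁅ℝ⁆ (affR.Carrier × affR.Carrier) × (abelianR r).Carrier)) ∨
        (∃ m r : ℕ, 1 ≤ m ∧ n = (2 * m + 3) + r ∧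
          Nonempty (G ≃ₗ⁅ℝ⁆ (affR.Carrier × (heis m).Carrier) × (abelianR r).Carrier)) ∨
        (∃ (t : Listed) (r : ℕ), 1 ≤ r ∧ n = t.dim + r ∧
          Nonempty (G ≃ₗ⁅ℝ⁆ t.Alg × (abelianR r).Carrier))) := by
  have hd : Module.finrank ℝ (derSpan G) = 2 := by
    rw [← hG1, ← derivedSeries_one_eq_derSpan]
    rfl
  have hN := exists_lie_lie_ne_zero hd hG2
  have hab : IsLieAbelian (LieAlgebra.derivedSeries ℝ G 1) := by
    constructor
    intro x y
    have hx : (x : G) ∈ derSpan G := by rw [← derivedSeries_one_eq_derSpan]; exact x.2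
    have hy : (y : G) ∈ derSpan G := by rw [← derivedSeries_one_eq_derSpan]; exact y.2
    exact Subtype.ext (lie_eq_zero_of_mem_derSpan hd hx hy)
  obtain ⟨h2n, b, hb⟩ := exists_basis_mem hn hd
  rw [derivedSeries_one_eq_derSpan]
  -- A decomposable algebra needs only a basis adapted to the derived ideal; in the indecomposable
  -- case the basis is carried over from the listed algebra.
  by_cases hD : IsDecomposable G
  · refine ⟨b, b.span_image_lt_two hd h2n hb, hab, fun h => absurd hD h, fun _ => ?_⟩
    rcases equiv_of_isDecomposable hd hN hD with ⟨r, ⟨e⟩⟩ | ⟨m, r, hm, ⟨e⟩⟩ | ⟨t, r, hr, ⟨e⟩⟩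
    · refine Or.inl ⟨r, ?_, ⟨e⟩⟩
      rw [← hn, e.toLinearEquiv.finrank_eq]
      simp [LieData.finrank_carrier]
    · refine Or.inr (Or.inl ⟨m, r, hm, ?_, ⟨e⟩⟩)
      rw [← hn, e.toLinearEquiv.finrank_eq]
      simp [LieData.finrank_carrier]
      ring
    · refine Or.inr (Or.inr ⟨t, r, hr, ?_, ⟨e⟩⟩)
      rw [← hn, e.toLinearEquiv.finrank_eq]
      simp [LieData.finrank_carrier, Listed.dim]
  · obtain ⟨t, ht, ⟨e⟩⟩ := exists_equiv_of_not_isDecomposable hd hN hD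
    have hnt : n = t.dim := by
      rw [← hn, ← e.toLinearEquiv.finrank_eq, LieData.finrank_carrier]
      simp [Listed.dim]
    obtain ⟨b, hb, hbd⟩ := Listed.exists_basis_vec e.symm hd hnt
    refine ⟨b, b.span_image_lt_two hd h2n hbd, hab, fun _ => ⟨t, ⟨hnt, e.symm, hb⟩, fun s => ?_⟩,
      fun h => absurd h hD⟩
    constructor
    · rintro ⟨f⟩
      exact Listed.same_of_equiv ht (e.trans f) (by rw [e.finrank_derSpan, hd])
    · intro h
      obtain ⟨f⟩ := Listed.equiv_of_same h
      exact ⟨e.symm.trans f⟩
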